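/- **Setting.** Consider a Markov decision process with state space $\mathcal S$, action space $\mathcal A$, initial law $\rho$, transition kernel $\mathcal P$, reward $\mathcal R(s,a)\in[-R,R]$ ($R>0$), discount factor $\gamma\in(0,1)$ and horizon $H$, and policies $\pi_\theta(a|s)>0$, $\theta\in\mathbb R^d$. Let $p(\cdot|\theta)$ be the law of the trajectory $\tau=(s_0,a_0,\dots,s_{H-1},a_{H-1})$ with $s_0\sim\rho$, $a_h\sim\pi_\theta(\cdot|s_h)$, $s_{h+1}\sim\mathcal P(\cdot|s_h,a_h)$; let $J(\theta)=\mathbb E_{\tau\sim p(\cdot|\theta)}\sum_{h<H}\gamma^h\mathcal R(s_h,a_h)$, and let $$g(\tau|\theta)=\sum_{h=0}^{H-1}\sum_{j=h}^{H-1}(\gamma^j\mathcal R(s_j,a_j)-b_j)\nabla_\theta\log\pi_\theta(a_h|s_h),\qquad w(\tau|\theta',\theta)=\prod_{h=0}^{H-1}\frac{\pi_{\theta'}(a_h|s_h)}{\pi_\theta(a_h|s_h)},$$ with baselines $b_j\in\mathbb R$ such that $|\gamma^j\mathcal R(s,a)-b_j|\le\gamma^jR$ for all $s,a$ (for instance $b_j=0$).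 **Assumptions.** There are constants $M_g,M_h,\sigma,W>0$ such that (1) $\log\pi_\theta(a|s)$ is twice differentiable in $\theta$ with $\|\nabla_\theta\log\pi_\theta(a|s)\|\le M_g$ and $\|\nabla^2_\theta\log\pi_\theta(a|s)\|\le M_h$ for all $\theta,s,a$; (2) $\mathbb E_{\tau\sim p(\cdot|\theta)}\|g(\tau|\theta)-\nabla J(\theta)\|^2\le\sigma^2$ for all $\theta$; (3) $\mathbb V_{\tau\sim p(\cdot|\theta)}(w(\tau|\theta',\theta))\le W$ for all $\theta,\theta'$. **Algorithm (IS-MBPG).** From $\theta_1\in\mathbb R^d$, for $t=1,\dots,T$: sample one trajectory $\tau_t\sim p(\cdot|\theta_t)$ (conditionally on $\tau_1,\dots,\tau_{t-1}$); set $u_1=g(\tau_1|\theta_1)$ and, for $t\ge2$, $$u_t=\beta_tg(\tau_t|\theta_t)+(1-\beta_t)\big[u_{t-1}+g(\tau_t|\theta_t)-w(\tau_t|\theta_{t-1},\theta_t)g(\tau_t|\theta_{t-1})\big];$$ set $G_t=\|g(\tau_t|\theta_t)\|$, $\eta_t=k/(m+\sum_{i=1}^tG_i^2)^{1/3}$,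 $\theta_{t+1}=\theta_t+\eta_tu_t$, $\beta_{t+1}=c\,\eta_t^2$. The output is $\theta_\zeta$, with $\zeta$ uniform on $\{1,\dots,T\}$ and independent of the trajectories. **Constants.** $G=\frac{M_gR}{(1-\gamma)^2}$, $L=\max\Big\{\frac{M_hR}{(1-\gamma)^2},\frac{\sqrt{H^2M_g^4R^2+M_h^2R^2}}{(1-\gamma)^2}\Big\}$, $C_w^2=H(2HM_g^2+M_h)(W+1)$, $B^2=L^2+2G^2C_w^2$; $k>0$ is arbitrary (in particular any constant multiple of $G^{2/3}/L$), $c=\frac{G^2}{3k^3L}+104B^2$, $m=\max\{2G^2,(2Lk)^3,(\frac{ck}{2L})^3\}$. **Theorem.** $J$ is differentiable and $J^*=\sup_\theta J(\theta)<\infty$. For every $T\ge1$, $$\mathbb E\|\nabla J(\theta_\zeta)\|=\frac1T\sum_{t=1}^T\mathbb E\|\nabla J(\theta_t)\|\le\frac{\sqrt{2\Omega}\,m^{1/6}+2\Omega^{3/4}}{\sqrt T}+\frac{2\sqrt\Omega\,\sigma^{1/3}}{T^{1/3}},$$ where $$\Omega=\frac1k\Big(16(J^*-J(\theta_1))+\frac{m^{1/3}}{8B^2k}\sigma^2+\frac{c^2k^3}{4B^2}\ln(T+2)\Big).$$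 Moreover there is a constant $C>0$, depending only on $R,\gamma,H,M_g,M_h,\sigma,W,k$, such that $\Omega\le C\ln T$ for all $T\ge2$, and such that for every $\epsilon\in(0,\frac12]$ there is an integer $1\le N\le C\epsilon^{-3}(\ln\frac1\epsilon)^{3/2}$ with $\mathbb E\|\nabla J(\theta_\zeta)\|\le\epsilon$ for all $T\ge N$. Since each iteration samples one trajectory, the sample complexity is $\tilde O(\epsilon^{-3})$, without large batches. -/

import Mathlib

open MeasureTheory ProbabilityTheory

noncomputable section

/-- The parameter space `ℝ^d` with the Euclidean norm. -/
abbrev Param (d : ℕ) : Type := EuclideanSpace ℝ (Fin d)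

/-- A trajectory `(s_0, a_0, …, s_{H-1}, a_{H-1})`. -/
abbrev Trajectory (S A : Type*) (H : ℕ) : Type _ := Fin H → S × A

/-- Initial law, transition kernel and reward of a Markov decision process. -/
structure MDP (S A : Type*) [MeasurableSpace S] [MeasurableSpace A] where
  init : Measure S
  init_prob : IsProbabilityMeasure init
  trans : Kernel (S × A) S
  trans_markov : IsMarkovKernel trans
  reward : S → A → ℝ
  measurable_reward : Measurable (Function.uncurry reward)

attribute [instance] MDP.init_prob MDP.trans_markov

/-- A parameterized stochastic policy: `density θ s a` is `π_θ(a|s)`, a strictly positive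
probability density in `a` with respect to the reference measure `ref` on the actions
(counting measure for finite `A`, Lebesgue measure for `A = ℝ^p`). -/
structure Policy (d : ℕ) (S A : Type*) [MeasurableSpace S] [MeasurableSpace A] where
  ref : Measure A
  ref_sigmaFinite : SigmaFinite ref
  density : Param d → S → A → ℝ
  density_pos : ∀ θ s a, 0 < density θ s a
  measurable_density : ∀ θ, Measurable (Function.uncurry (density θ))
  lintegral_density : ∀ θ s, ∫⁻ a, ENNReal.ofReal (density θ s a) ∂ref = 1

attribute [instance] Policy.ref_sigmaFinite

namespace Policy

variable {d : ℕ} {S A : Type*} [MeasurableSpace S] [MeasurableSpace A] (π : Policy d S A)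

/-- The Markov kernel `s ↦ π_θ(a|s) da`. -/
def kernel (θ : Param d) : Kernel S A :=
  (Kernel.const S π.ref).withDensity fun s a => ENNReal.ofReal (π.density θ s a)

/-- The score `∇_θ log π_θ(a|s)`. -/
def score (θ : Param d) (s : S) (a : A) : Param d :=
  gradient (fun θ' => Real.log (π.density θ' s a)) θ

/-- `log π_θ(a|s)` is twice differentiable in `θ`, with gradient bounded by `Mg` in Euclidean norm
and Hessian bounded by `Mh` in spectral norm. -/
def BoundedScore (Mg Mh : ℝ) : Prop :=
  ∀ s a, Differentiable ℝ (fun θ => Real.log (π.density θ s a)) ∧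
    Differentiable ℝ (fun θ => π.score θ s a) ∧
    ∀ θ, ‖π.score θ s a‖ ≤ Mg ∧ ‖fderiv ℝ (fun θ' => π.score θ' s a) θ‖ ≤ Mh

/-- The importance weight `w(τ|θ',θ) = p(τ|θ') / p(τ|θ) = ∏_h π_θ'(a_h|s_h) / π_θ(a_h|s_h)`. -/
def weight {H : ℕ} (τ : Trajectory S A H) (θ' θ : Param d) : ℝ :=
  ∏ h, π.density θ' (τ h).1 (τ h).2 / π.density θ (τ h).1 (τ h).2

end Policy

namespace MDP

variable {d : ℕ} {S A : Type*} [MeasurableSpace S] [MeasurableSpace A]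
  (M : MDP S A) (π : Policy d S A)

/-- Law of the next state given the history of the first `n` state-action pairs. -/
def stateKernel : (n : ℕ) → Kernel (Trajectory S A n) S
  | 0 => Kernel.const _ M.init
  | n + 1 => M.trans.comap (fun τ => τ (Fin.last n)) (measurable_pi_apply _)

/-- Law of the next state-action pair given the history, when acting with `π_θ`. -/
def pairKernel (θ : Param d) (n : ℕ) : Kernel (Trajectory S A n) (S × A) :=
  M.stateKernel n ⊗ₖ (π.kernel θ).comap Prod.snd measurable_snd

/-- The law `p(·|θ)` of the trajectory of horizon `H`:
`s_0 ~ init`, `a_h ~ π_θ(·|s_h)`, `s_{h+1} ~ trans (s_h, a_h)`. -/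
def trajLaw (θ : Param d) : (H : ℕ) → Measure (Trajectory S A H)
  | 0 => Measure.dirac Fin.elim0
  | n + 1 => (trajLaw θ n ⊗ₘ M.pairKernel π θ n).map
      fun x => Fin.snoc (α := fun _ => S × A) x.1 x.2

/-- The cumulative discounted reward `∑_h γ^h r(s_h, a_h)`. -/
def trajReward (γ : ℝ) {H : ℕ} (τ : Trajectory S A H) : ℝ :=
  ∑ h : Fin H, γ ^ (h : ℕ) * M.reward (τ h).1 (τ h).2

/-- The objective `J(θ) = E_{τ ~ p(·|θ)} [∑_h γ^h r(s_h, a_h)]`. -/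
def J (γ : ℝ) (H : ℕ) (θ : Param d) : ℝ :=
  ∫ τ, M.trajReward γ τ ∂(M.trajLaw π θ H)

/-- The PGT estimator with baselines `b_j`:
`g(τ|θ) = ∑_h ∑_{j ≥ h} (γ^j r(s_j, a_j) - b_j) ∇_θ log π_θ(a_h|s_h)`. -/
def pgt (γ : ℝ) {H : ℕ} (b : Fin H → ℝ) (τ : Trajectory S A H) (θ : Param d) : Param d :=
  ∑ h : Fin H, ∑ j ∈ Finset.Ici h,
    (γ ^ (j : ℕ) * M.reward (τ j).1 (τ j).2 - b j) • π.score θ (τ h).1 (τ h).2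

end MDP

/-! The algorithm. -/

namespace ISMBPG

/-- Input of the algorithm: a sampler `law θ = p(·|θ)` over samples `τ : Z`, the stochastic gradient
`grad τ θ = g(τ|θ)`, the importance weight `weight τ θ' θ = w(τ|θ',θ)`, the initial point
and the hyperparameters. -/
structure Input (d : ℕ) (Z : Type*) [MeasurableSpace Z] where
  law : Param d → Measure Z
  grad : Z → Param d → Param d
  weight : Z → Param d → Param d → ℝ
  θ₁ : Param d
  k : ℝ
  m : ℝ
  c : ℝ

/-- Memory at the end of iteration `t`: `θ_t`, `u_t`, `∑_{i ≤ t} G_i^2`, `θ_{t+1}`, `β_{t+1}`. -/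
structure Memory (d : ℕ) where
  θ : Param d
  u : Param d
  sumSq : ℝ
  θNext : Param d
  βNext : ℝ

namespace Input

variable {d : ℕ} {Z : Type*} [MeasurableSpace Z] (a : Input d Z)

/-- The common end of every iteration, from `θ_t`, `u_t` and `s = ∑_{i ≤ t} G_i^2`:
`η_t = k / (m + s)^{1/3}`, `θ_{t+1} = θ_t + η_t u_t`, `β_{t+1} = c η_t^2`. -/
def finish (θ u : Param d) (s : ℝ) : Memory d :=
  let η := a.k / (a.m + s) ^ (1 / 3 : ℝ)
  { θ := θ, u := u, sumSq := s, θNext := θ + η • u, βNext := a.c * η ^ 2 }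

/-- The first iteration, with the sample `τ`. -/
def firstStep (τ : Z) : Memory d :=
  a.finish a.θ₁ (a.grad τ a.θ₁) (‖a.grad τ a.θ₁‖ ^ 2)

/-- A later iteration `t`, with the memory of iteration `t - 1` and the sample `τ = τ_t`. -/
def nextStep (x : Memory d) (τ : Z) : Memory d :=
  a.finish x.θNext
    (x.βNext • a.grad τ x.θNext +
      (1 - x.βNext) • (x.u + a.grad τ x.θNext - a.weight τ x.θ x.θNext • a.grad τ x.θ))
    (x.sumSq + ‖a.grad τ x.θNext‖ ^ 2)

/-- Memory at the end of iteration `n + 1`, given the samples `τ_1, …, τ_{n+1}`. -/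
def memory : (n : ℕ) → (Fin (n + 1) → Z) → Memory d
  | 0, τ => a.firstStep (τ 0)
  | n + 1, τ => a.nextStep (memory n (Fin.init τ)) (τ (Fin.last (n + 1)))

/-- The iterate `θ_{n+1}`, given the samples `τ_1, …, τ_n`. -/
def iterate : (n : ℕ) → (Fin n → Z) → Param d
  | 0, _ => a.θ₁
  | n + 1, τ => (a.memory n τ).θNext

/-- Joint law of the samples `τ_1, …, τ_T` drawn in `T` iterations (one per iteration):
given `τ_1, …, τ_n`, the sample `τ_{n+1}` has law `p(·|θ_{n+1})`. -/
def runLaw : (T : ℕ) → Measure (Fin T → Z)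
  | 0 => Measure.dirac Fin.elim0
  | n + 1 => (runLaw n).bind fun τ =>
      (a.law (a.iterate n τ)).map fun z => Fin.snoc (α := fun _ => Z) τ z

/-- The iterate `θ_{i+1}`, `0 ≤ i < T`, as a function of all the samples of a run of `T` iterations
(it only uses the first `i` of them). -/
def iterateOfRun {T : ℕ} (τ : Fin T → Z) (i : Fin T) : Param d :=
  a.iterate i fun j => τ (Fin.castLE i.isLt.le j)

/-- Joint law of the samples of a run and of an independent uniformly distributed index. -/
def outputLaw (T : ℕ) : Measure ((Fin T → Z) × Fin T) :=
  (a.runLaw T).prod (uniformOn Set.univ)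

end Input

end ISMBPG

/-- The numerical constants of the problem: reward bound `R`, discount factor `γ`, horizon `H`,
bounds `Mg`, `Mh` for the gradient and the Hessian of `log π_θ`, variance bounds `σ^2` and `W` for
the stochastic gradient and the importance weights, and the step size parameter `k`. -/
structure Constants where
  R : ℝ
  γ : ℝ
  H : ℕ
  Mg : ℝ
  Mh : ℝ
  σ : ℝ
  W : ℝ
  k : ℝ

namespace Constants

variable (p : Constants)

/-- `G = Mg R / (1-γ)^2`. -/
def G : ℝ := p.Mg * p.R / (1 - p.γ) ^ 2

/-- `L = max (Mh R / (1-γ)^2) (√((H^2 Mg^4 R^2 + Mh^2 R^2) / (1-γ)^4))`. -/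
def L : ℝ :=
  max (p.Mh * p.R / (1 - p.γ) ^ 2)
    (Real.sqrt (((p.H : ℝ) ^ 2 * p.Mg ^ 4 * p.R ^ 2 + p.Mh ^ 2 * p.R ^ 2) / (1 - p.γ) ^ 4))

/-- `C_w = √(H (2 H Mg^2 + Mh) (W + 1))`. -/
def Cw : ℝ := Real.sqrt ((p.H : ℝ) * (2 * (p.H : ℝ) * p.Mg ^ 2 + p.Mh) * (p.W + 1))

/-- `B^2 = L^2 + 2 G^2 C_w^2`. -/
def Bsq : ℝ := p.L ^ 2 + 2 * p.G ^ 2 * p.Cw ^ 2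

/-- `c = G^2 / (3 k^3 L) + 104 B^2`. -/
def c : ℝ := p.G ^ 2 / (3 * p.k ^ 3 * p.L) + 104 * p.Bsq

/-- `m = max {2 G^2, (2 L k)^3, (c k / (2 L))^3}`. -/
def m : ℝ := max (2 * p.G ^ 2) (max ((2 * p.L * p.k) ^ 3) ((p.c * p.k / (2 * p.L)) ^ 3))

/-- `Ω = (1/k) (16 (J^* - J(θ_1)) + m^{1/3} σ^2 / (8 B^2 k) + c^2 k^3 ln(T+2) / (4 B^2))`,
where `gap = J^* - J(θ_1)`. -/
def Omega (gap : ℝ) (T : ℕ) : ℝ :=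
  1 / p.k * (16 * gap + p.m ^ (1 / 3 : ℝ) / (8 * p.Bsq * p.k) * p.σ ^ 2 +
    p.c ^ 2 * p.k ^ 3 / (4 * p.Bsq) * Real.log ((T : ℝ) + 2))

end Constants

/-- IS-MBPG for the policy `π` in the decision process `M`: trajectories of horizon `H`, the PGT
estimator, importance weights, and the hyperparameters `k`, `m`, `c` determined by `p`. -/
def isMBPG {d : ℕ} {S A : Type*} [MeasurableSpace S] [MeasurableSpace A]
    (p : Constants) (M : MDP S A) (π : Policy d S A) (b : Fin p.H → ℝ) (θ₁ : Param d) :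
    ISMBPG.Input d (Trajectory S A p.H) where
  law θ := M.trajLaw π θ p.H
  grad τ θ := M.pgt π p.γ b τ θ
  weight τ θ' θ := π.weight τ θ' θ
  θ₁ := θ₁
  k := p.k
  m := p.m
  c := p.c

end

/-!
IS-MBPG converges because its momentum term keeps the error of the search direction small at the
scale of the step, and this survives the random step sizes.

*The oracle.* The laws of the trajectory under two parameters are mutually absolutely continuous,
with the importance weight as likelihood ratio (`MDP.trajLaw_eq_withDensity`). Bounded scores allow
differentiation under the integral. Applied to each reward under the law of the trajectory stopped
at its own time, this shows that the PGT estimator is unbiased (`MDP.hasGradientAt_J`).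
Since `|log w| ≤ H Mg ‖θ' - θ‖` and the logarithmic mean is at most the arithmetic one,
`|w - 1| ≤ H Mg ‖θ' - θ‖ (w + 1) / 2`. Hence `E|w - 1|` and `E(w - 1)²` are controlled by
`‖θ' - θ‖` and `‖θ' - θ‖²`. The first bound makes `∇J` Lipschitz with constant `2L`
(`MDP.norm_gradient_J_sub_le`), the second one bounds the mean square of the correction
`g(·|θ) - w g(·|θ')` by `2 B² ‖θ' - θ‖²` (`MDP.integral_norm_pgt_sub_weight_smul_sq_le`).
`ISMBPG.Input.IsOracle` collects these facts; the rest of the analysis uses nothing else about the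
decision process.

*The potential.* Write `e = u - ∇J(θ)` for the error, `η` for the step size and `s = ∑ G_i²`. The
new error is `(1 - β) e` plus a centred noise (`IsOracle.error_sq_le`), so that the potential
`‖e‖² (1/η - q η) / (128 B²) + (J^* - J(θ)) + c² k³ (Λ - ln (G² + s)) / (64 B²)`, with
`q = G² / (3 k³ L)`, decreases in conditional expectation by at least `η ‖∇J(θ)‖² / 16`
(`IsOracle.lyapunov_step`).
Three facts about the step sizes make this work: `1/η_{t+1} - q η_{t+1} ≤ 1/η_t`, so that the
momentum `c η² = q η² + 104 B² η²` outweighs the growth of `1/η`; `2 L η ≤ 1`, which turns the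
descent lemma into a gain of `η (‖∇J‖² - ‖e‖²) / 2`; and
`η_t³ G_{t+1}² ≤ k³ (ln (G² + s_{t+1}) - ln (G² + s_t))`, which makes the noise telescope.
Summing over `T + 1` samples bounds `E ∑ η_t ‖∇J(θ_t)‖²` by `k Ω`.

*The rate.* Let `X = (∑ ‖∇J(θ_t)‖²)^{1/2}`. Step sizes decrease, so `X² ≤ (1/η_T) ∑ η_t ‖∇J(θ_t)‖²`,
and `k/η_T` is the cube root of `m + ∑ G_t²`, which is at most `m` plus twice the noise plus `2 X²`.
Cauchy–Schwarz and Jensen give an inequality for `E X` that bounds itself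
(`le_of_sq_le_self_bounding`), whence the stated bound. As `|J| ≤ H R`, `Ω = O(ln T)` uniformly, the
bound is `O(√(ln T) / T^{1/3})`, and inverting this rate gives the sample complexity.
-/

noncomputable section

/-! ### Sequentially sampled finite sequences -/

theorem measurable_snoc {Z : Type*} [MeasurableSpace Z] (n : ℕ) :
    Measurable fun x : (Fin n → Z) × Z => (Fin.snoc (α := fun _ => Z) x.1 x.2 : Fin (n + 1) → Z) := by
  refine measurable_pi_iff.2 fun i => ?_
  induction i using Fin.lastCases with
  | last => simpa using measurable_snd
  | cast i => simpa using (measurable_pi_apply i).fun_comp measurable_fst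

theorem measurable_restrict_castLE {Z : Type*} [MeasurableSpace Z] {n N : ℕ} (h : n ≤ N) :
    Measurable fun (τ : Fin N → Z) (j : Fin n) => τ (Fin.castLE h j) :=
  measurable_pi_iff.2 fun _ => measurable_pi_apply _

theorem measurable_finInit {Z : Type*} [MeasurableSpace Z] (n : ℕ) :
    Measurable fun τ : Fin (n + 1) → Z => (Fin.init τ : Fin n → Z) :=
  measurable_pi_iff.2 fun _ => measurable_pi_apply _

/-- If each `μ (n + 1)` extends `μ n` by one more sample from a probability kernel, then
`μ n` is the law of the first `n` coordinates under `μ N`. -/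
theorem map_castLE_of_sequential {Z : Type*} [MeasurableSpace Z]
    (μ : ∀ n, Measure (Fin n → Z)) (κ : ∀ n, (Fin n → Z) → Measure Z)
    (hκ : ∀ n τ, IsProbabilityMeasure (κ n τ))
    (hμ : ∀ n (f : (Fin (n + 1) → Z) → ENNReal), Measurable f →
      ∫⁻ τ, f τ ∂(μ (n + 1)) =
        ∫⁻ τ, ∫⁻ z, f (Fin.snoc (α := fun _ => Z) τ z) ∂(κ n τ) ∂(μ n))
    {n N : ℕ} (h : n ≤ N) :
    (μ N).map (fun τ (j : Fin n) => τ (Fin.castLE h j)) = μ n := by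
  induction N, h using Nat.le_induction with
  | base => exact Measure.map_id
  | succ N h ih =>
    refine Measure.ext_of_lintegral _ fun f hf => ?_
    rw [lintegral_map hf (measurable_restrict_castLE _), hμ _ _
      (hf.fun_comp (measurable_restrict_castLE _))]
    have key : ∀ (τ : Fin N → Z) (z : Z), (fun j : Fin n =>
        (Fin.snoc (α := fun _ => Z) τ z : Fin (N + 1) → Z)
          (Fin.castLE (Nat.le_succ_of_le h) j)) = fun j => τ (Fin.castLE h j) := by
      intro τ z
      ext j
      have : Fin.castLE (Nat.le_succ_of_le h) j = (Fin.castLE h j).castSucc := rfl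
      rw [this, Fin.snoc_castSucc]
    simp only [key, lintegral_const, measure_univ, mul_one]
    rw [← ih, lintegral_map hf (measurable_restrict_castLE _)]

/-! ### Measurability and mass of the trajectory law -/

namespace Policy

variable {d : ℕ} {S A : Type*} [MeasurableSpace S] [MeasurableSpace A] (π : Policy d S A)

theorem measurable_ofReal_density (θ : Param d) :
    Measurable (Function.uncurry fun s a => ENNReal.ofReal (π.density θ s a)) :=
  (π.measurable_density θ).ennreal_ofReal

theorem lintegral_kernel (θ : Param d) (s : S) {f : A → ENNReal} (hf : Measurable f) :
    ∫⁻ a, f a ∂(π.kernel θ s) = ∫⁻ a, ENNReal.ofReal (π.density θ s a) * f a ∂π.ref := by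
  rw [kernel, Kernel.lintegral_withDensity _ (π.measurable_ofReal_density θ) _ hf]
  rfl

instance (θ : Param d) : IsMarkovKernel (π.kernel θ) := by
  refine ⟨fun s => ⟨?_⟩⟩
  have := π.lintegral_kernel θ s (f := fun _ => 1) measurable_const
  simpa [π.lintegral_density θ s] using this

theorem weight_self {H : ℕ} (τ : Trajectory S A H) (θ : Param d) : π.weight τ θ θ = 1 :=
  Finset.prod_eq_one fun _ _ => div_self (π.density_pos _ _ _).ne'

theorem weight_pos {H : ℕ} (τ : Trajectory S A H) (θ' θ : Param d) : 0 < π.weight τ θ' θ :=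
  Finset.prod_pos fun _ _ => div_pos (π.density_pos _ _ _) (π.density_pos _ _ _)

theorem measurable_weight {H : ℕ} (θ' θ : Param d) :
    Measurable fun τ : Trajectory S A H => π.weight τ θ' θ :=
  Finset.measurable_fun_prod _ fun h _ => Measurable.div
    ((π.measurable_density θ').comp (measurable_pi_apply h))
    ((π.measurable_density θ).comp (measurable_pi_apply h))

/-- The log-likelihood of the actions along a trajectory. -/
def logLik {H : ℕ} (θ : Param d) (τ : Trajectory S A H) : ℝ :=
  ∑ h, Real.log (π.density θ (τ h).1 (τ h).2)

theorem weight_eq_exp {H : ℕ} (τ : Trajectory S A H) (θ' θ : Param d) :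
    π.weight τ θ' θ = Real.exp (π.logLik θ' τ - π.logLik θ τ) := by
  rw [weight, logLik, logLik, ← Finset.sum_sub_distrib, Real.exp_sum]
  refine Finset.prod_congr rfl fun h _ => ?_
  rw [Real.exp_sub, Real.exp_log (π.density_pos _ _ _), Real.exp_log (π.density_pos _ _ _)]

end Policy

namespace MDP

variable {d : ℕ} {S A : Type*} [MeasurableSpace S] [MeasurableSpace A]
  (M : MDP S A) (π : Policy d S A)

instance (n : ℕ) : IsMarkovKernel (M.stateKernel (A := A) n) := by
  cases n <;> (unfold stateKernel; infer_instance)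

instance (θ : Param d) (n : ℕ) : IsMarkovKernel (M.pairKernel π θ n) := by
  unfold pairKernel; infer_instance

instance isProbabilityMeasure_trajLaw (θ : Param d) (n : ℕ) :
    IsProbabilityMeasure (M.trajLaw π θ n) := by
  induction n with
  | zero => unfold trajLaw; infer_instance
  | succ n ih =>
    unfold trajLaw
    exact Measure.isProbabilityMeasure_map (measurable_snoc n).aemeasurable

theorem lintegral_trajLaw_succ (θ : Param d) (n : ℕ) {f : Trajectory S A (n + 1) → ENNReal}
    (hf : Measurable f) :
    ∫⁻ τ, f τ ∂(M.trajLaw π θ (n + 1)) =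
      ∫⁻ τ, ∫⁻ z, f (Fin.snoc (α := fun _ => S × A) τ z) ∂(M.pairKernel π θ n τ)
        ∂(M.trajLaw π θ n) := by
  rw [trajLaw, lintegral_map hf (measurable_snoc n),
    Measure.lintegral_compProd (hf.fun_comp (measurable_snoc n))]

theorem lintegral_pairKernel (θ : Param d) (n : ℕ) (τ : Trajectory S A n) {f : S × A → ENNReal}
    (hf : Measurable f) :
    ∫⁻ z, f z ∂(M.pairKernel π θ n τ) =
      ∫⁻ s, ∫⁻ a, ENNReal.ofReal (π.density θ s a) * f (s, a) ∂π.ref ∂(M.stateKernel n τ) := by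
  rw [pairKernel, Kernel.lintegral_compProd _ _ _ hf]
  refine lintegral_congr fun s => ?_
  rw [Kernel.comap_apply, π.lintegral_kernel θ s (hf.fun_comp measurable_prodMk_left)]

/-- Change of measure between two parameters: the importance weight is the likelihood ratio. -/
theorem trajLaw_eq_withDensity (θ' θ : Param d) (n : ℕ) :
    M.trajLaw π θ' n =
      (M.trajLaw π θ n).withDensity fun τ => ENNReal.ofReal (π.weight τ θ' θ) := by
  induction n with
  | zero =>
    have : (fun τ : Trajectory S A 0 => ENNReal.ofReal (π.weight τ θ' θ)) = fun _ => 1 := by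
      ext τ; simp [Policy.weight]
    rw [this, withDensity_const, one_smul]; rfl
  | succ n ih =>
    refine Measure.ext_of_lintegral _ fun f hf => ?_
    have hw : ∀ n, Measurable fun τ : Trajectory S A n => ENNReal.ofReal (π.weight τ θ' θ) :=
      fun n => (π.measurable_weight θ' θ).ennreal_ofReal
    rw [lintegral_withDensity_eq_lintegral_mul _ (hw _) hf, lintegral_trajLaw_succ _ _ _ _ hf,
      lintegral_trajLaw_succ _ _ _ _ ((hw _).mul hf), ih,
      lintegral_withDensity_eq_lintegral_mul _ (hw _)]
    · refine lintegral_congr fun τ => ?_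
      have hs : Measurable fun z : S × A => f (Fin.snoc (α := fun _ => S × A) τ z) :=
        hf.comp ((measurable_snoc n).comp measurable_prodMk_left)
      have hs' : Measurable fun z : S × A => ENNReal.ofReal
          (π.weight (Fin.snoc (α := fun _ => S × A) τ z : Trajectory S A (n + 1)) θ' θ) :=
        (hw _).comp ((measurable_snoc n).comp measurable_prodMk_left)
      have hm := hs'.fun_mul hs
      simp only [Pi.mul_apply]
      rw [lintegral_pairKernel _ _ _ _ _ hs, lintegral_pairKernel _ _ _ _ _ hm,
        ← lintegral_const_mul]
      · refine lintegral_congr fun s => ?_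
        have h1 : Measurable fun a => ENNReal.ofReal (π.density θ' s a) *
            f (Fin.snoc (α := fun _ => S × A) τ (s, a)) :=
          ((π.measurable_ofReal_density θ').comp measurable_prodMk_left).mul
            (hs.comp measurable_prodMk_left)
        rw [← lintegral_const_mul _ h1]
        refine lintegral_congr fun a => ?_
        rw [← mul_assoc, ← mul_assoc, ← ENNReal.ofReal_mul (π.weight_pos _ _ _).le,
          ← ENNReal.ofReal_mul (π.density_pos _ _ _).le]
        congr 2
        have hp := (π.density_pos θ s a).ne'
        have : π.weight (Fin.snoc (α := fun _ => S × A) τ (s, a) : Trajectory S A (n + 1)) θ' θ =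
            π.weight τ θ' θ * (π.density θ' s a / π.density θ s a) := by
          simp [Policy.weight, Fin.prod_univ_castSucc, mul_div_mul_comm]
        rw [this]
        field_simp
      · exact Measurable.lintegral_prod_right' (f := fun z : S × A =>
          ENNReal.ofReal (π.density θ' z.1 z.2) * f (Fin.snoc (α := fun _ => S × A) τ z))
          ((π.measurable_ofReal_density θ').mul hs)
    · exact Measurable.lintegral_kernel_prod_right' (κ := M.pairKernel π θ' n)
        (hf.comp (measurable_snoc n))

theorem map_trajLaw_castLE (θ : Param d) {n N : ℕ} (h : n ≤ N) :
    (M.trajLaw π θ N).map (fun τ (j : Fin n) => τ (Fin.castLE h j)) = M.trajLaw π θ n :=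
  map_castLE_of_sequential (M.trajLaw π θ) (fun n τ => M.pairKernel π θ n τ)
    (fun _ _ => inferInstance) (fun n _ hf => M.lintegral_trajLaw_succ π θ n hf) h

theorem integral_trajLaw_eq {E : Type*} [NormedAddCommGroup E] [NormedSpace ℝ E]
    (θ' θ : Param d) (n : ℕ) (f : Trajectory S A n → E) :
    ∫ τ, f τ ∂(M.trajLaw π θ' n) = ∫ τ, π.weight τ θ' θ • f τ ∂(M.trajLaw π θ n) := by
  rw [trajLaw_eq_withDensity M π θ' θ, integral_withDensity_eq_integral_toReal_smul
    (π.measurable_weight θ' θ).ennreal_ofReal (by simp)]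
  simp [ENNReal.toReal_ofReal (π.weight_pos _ _ _).le]

theorem integrable_weight (θ' θ : Param d) (n : ℕ) :
    Integrable (fun τ => π.weight τ θ' θ) (M.trajLaw π θ n) := by
  refine ⟨(π.measurable_weight θ' θ).aestronglyMeasurable, ?_⟩
  rw [hasFiniteIntegral_iff_ofReal (ae_of_all _ fun τ => (π.weight_pos τ θ' θ).le),
    ← setLIntegral_univ, ← withDensity_apply _ MeasurableSet.univ,
    ← trajLaw_eq_withDensity M π θ' θ]
  simp

theorem integral_weight (θ' θ : Param d) (n : ℕ) :
    ∫ τ, π.weight τ θ' θ ∂(M.trajLaw π θ n) = 1 := by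
  have := M.integral_trajLaw_eq π θ' θ n (fun _ => (1 : ℝ))
  simpa using this.symm

end MDP

/-! ### Scores and the log-likelihood -/

namespace Policy

variable {d : ℕ} {S A : Type*} [MeasurableSpace S] [MeasurableSpace A] {π : Policy d S A}
  {Mg Mh : ℝ}

theorem BoundedScore.hasFDerivAt_log (hB : π.BoundedScore Mg Mh) (θ : Param d) (s : S) (a : A) :
    HasFDerivAt (fun θ => Real.log (π.density θ s a))
      (InnerProductSpace.toDual ℝ (Param d) (π.score θ s a)) θ :=
  ((hB s a).1 θ).hasGradientAt.hasFDerivAt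

theorem BoundedScore.norm_score_sub_le (hB : π.BoundedScore Mg Mh) (θ' θ : Param d)
    (s : S) (a : A) : ‖π.score θ' s a - π.score θ s a‖ ≤ Mh * ‖θ' - θ‖ :=
  convex_univ.norm_image_sub_le_of_norm_fderiv_le (fun x _ => (hB s a).2.1 x)
    (fun x _ => ((hB s a).2.2 x).2) (Set.mem_univ θ) (Set.mem_univ θ')

/-- The gradient of `logLik`. -/
def scoreSum {H : ℕ} (π : Policy d S A) (θ : Param d) (τ : Trajectory S A H) : Param d :=
  ∑ h, π.score θ (τ h).1 (τ h).2

theorem BoundedScore.hasFDerivAt_logLik (hB : π.BoundedScore Mg Mh) {H : ℕ} (θ : Param d)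
    (τ : Trajectory S A H) :
    HasFDerivAt (fun θ => π.logLik θ τ)
      (InnerProductSpace.toDual ℝ (Param d) (π.scoreSum θ τ)) θ := by
  have := HasFDerivAt.fun_sum (u := Finset.univ) fun (h : Fin H) _ =>
    hB.hasFDerivAt_log θ (τ h).1 (τ h).2
  simpa [logLik, scoreSum, map_sum] using this

theorem BoundedScore.norm_scoreSum_le (hB : π.BoundedScore Mg Mh) {H : ℕ} (θ : Param d)
    (τ : Trajectory S A H) : ‖π.scoreSum θ τ‖ ≤ H * Mg := by
  refine (norm_sum_le_of_le _ fun h _ => ((hB (τ h).1 (τ h).2).2.2 θ).1).trans ?_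
  simp

theorem BoundedScore.abs_logLik_sub_le (hB : π.BoundedScore Mg Mh) {H : ℕ} (θ' θ : Param d)
    (τ : Trajectory S A H) : |π.logLik θ' τ - π.logLik θ τ| ≤ H * Mg * ‖θ' - θ‖ := by
  refine convex_univ.norm_image_sub_le_of_norm_hasFDerivWithin_le
    (fun x _ => (hB.hasFDerivAt_logLik x τ).hasFDerivWithinAt) (fun x _ => ?_)
    (Set.mem_univ θ) (Set.mem_univ θ')
  rw [LinearIsometryEquiv.norm_map]
  exact hB.norm_scoreSum_le x τ

/-- The directional derivatives of `log π_θ` are limits of difference quotients, which are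
measurable in the state-action pair. -/
theorem BoundedScore.measurable_score_fixed (hB : π.BoundedScore Mg Mh) (θ : Param d) :
    Measurable fun z : S × A => π.score θ z.1 z.2 := by
  have hlog : ∀ θ, Measurable fun z : S × A => Real.log (π.density θ z.1 z.2) :=
    fun θ => (π.measurable_density θ).log
  have hv : ∀ v : Param d, Measurable fun z : S × A => inner ℝ (π.score θ z.1 z.2) v := by
    intro v
    refine measurable_of_tendsto_metrizable
      (f := fun (n : ℕ) (z : S × A) => (n : ℝ) • (Real.log (π.density (θ + (n : ℝ)⁻¹ • v) z.1 z.2)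
        - Real.log (π.density θ z.1 z.2))) (fun n => ?_) ?_
    · exact ((hlog _).sub (hlog _)).const_smul (n : ℝ)
    · refine tendsto_pi_nhds.2 fun z => ?_
      exact ((hB.hasFDerivAt_log θ z.1 z.2).lim_real v).comp tendsto_natCast_atTop_atTop
  have : (fun z : S × A => π.score θ z.1 z.2) = fun z => ∑ i,
      (inner ℝ (π.score θ z.1 z.2) (EuclideanSpace.basisFun (Fin d) ℝ i)) •
        EuclideanSpace.basisFun (Fin d) ℝ i := by
    funext z
    conv_lhs => rw [← (EuclideanSpace.basisFun (Fin d) ℝ).sum_repr' (π.score θ z.1 z.2)]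
    simp_rw [real_inner_comm]
  rw [this]
  exact Finset.measurable_fun_sum _ fun i _ => (hv _).smul_const _

theorem BoundedScore.measurable_score (hB : π.BoundedScore Mg Mh) :
    Measurable fun x : Param d × (S × A) => π.score x.1 x.2.1 x.2.2 :=
  measurable_uncurry_of_continuous_of_measurable (u := fun θ (z : S × A) => π.score θ z.1 z.2)
    (fun z => (hB z.1 z.2).2.1.continuous) hB.measurable_score_fixed

theorem BoundedScore.measurable_density (hB : π.BoundedScore Mg Mh) :
    Measurable fun x : Param d × (S × A) => π.density x.1 x.2.1 x.2.2 := by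
  have : Measurable fun x : Param d × (S × A) => Real.log (π.density x.1 x.2.1 x.2.2) :=
    measurable_uncurry_of_continuous_of_measurable
      (u := fun θ (z : S × A) => Real.log (π.density θ z.1 z.2))
      (fun z => (hB z.1 z.2).1.continuous) fun θ => (π.measurable_density θ).log
  simpa [Real.exp_log (π.density_pos _ _ _)] using this.exp

theorem BoundedScore.measurable_weight (hB : π.BoundedScore Mg Mh) (H : ℕ) :
    Measurable fun x : Trajectory S A H × Param d × Param d => π.weight x.1 x.2.1 x.2.2 := by
  have h1 : ∀ h : Fin H, Measurable fun x : Trajectory S A H × Param d × Param d => x.1 h :=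
    fun h => (measurable_pi_apply h).comp measurable_fst
  exact Finset.measurable_fun_prod _ fun h _ => Measurable.div
    (hB.measurable_density.fun_comp ((measurable_fst.comp measurable_snd).prodMk (h1 h)))
    (hB.measurable_density.fun_comp ((measurable_snd.comp measurable_snd).prodMk (h1 h)))

theorem BoundedScore.measurable_scoreSum (hB : π.BoundedScore Mg Mh) (H : ℕ) (θ : Param d) :
    Measurable fun τ : Trajectory S A H => π.scoreSum θ τ :=
  Finset.measurable_fun_sum _ fun h _ =>
    (hB.measurable_score_fixed θ).fun_comp (measurable_pi_apply h)

end Policy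

/-! ### The importance weights are close to one -/

theorem Real.exp_sub_one_le_of_nonneg {x : ℝ} (hx : 0 ≤ x) :
    Real.exp x - 1 ≤ x * (Real.exp x + 1) / 2 := by
  have hd : ∀ y : ℝ, HasDerivAt (fun y => y * (Real.exp y + 1) / 2 - (Real.exp y - 1))
      ((1 * (Real.exp y + 1) + y * Real.exp y) / 2 - Real.exp y) y := fun y =>
    (((hasDerivAt_id' y).mul ((Real.hasDerivAt_exp y).add_const 1)).div_const 2).sub
      ((Real.hasDerivAt_exp y).sub_const 1)
  have hmono : Monotone fun y => y * (Real.exp y + 1) / 2 - (Real.exp y - 1) := by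
    refine monotone_of_deriv_nonneg (fun y => (hd y).differentiableAt) fun y => ?_
    rw [(hd y).deriv]
    have h1 : Real.exp y * (1 - y) ≤ Real.exp y * Real.exp (-y) :=
      mul_le_mul_of_nonneg_left (Real.one_sub_le_exp_neg y) (Real.exp_pos y).le
    rw [← Real.exp_add, add_neg_cancel, Real.exp_zero] at h1
    linarith
  have := hmono hx
  simp only [zero_mul, zero_div, Real.exp_zero, sub_self] at this
  linarith

/-- The arithmetic mean dominates the logarithmic mean: `|w - 1| ≤ |log w| (w + 1) / 2` for
`w = exp x`. -/
theorem Real.abs_exp_sub_one_le_mean (x : ℝ) :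
    |Real.exp x - 1| ≤ |x| * (Real.exp x + 1) / 2 := by
  rcases le_total 0 x with hx | hx
  · rw [abs_of_nonneg hx, abs_of_nonneg (by linarith [Real.one_le_exp hx])]
    exact Real.exp_sub_one_le_of_nonneg hx
  · rw [abs_of_nonpos hx, abs_of_nonpos (by linarith [Real.exp_le_one_iff.2 hx])]
    have h := mul_le_mul_of_nonneg_left
      (Real.exp_sub_one_le_of_nonneg (x := -x) (by linarith)) (Real.exp_pos x).le
    have h1 : Real.exp x * Real.exp (-x) = 1 := by rw [← Real.exp_add]; simp
    nlinarith [h, h1]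

namespace MDP

variable {d : ℕ} {S A : Type*} [MeasurableSpace S] [MeasurableSpace A]
  {M : MDP S A} {π : Policy d S A} {Mg Mh : ℝ}

theorem abs_weight_sub_one_le (hB : π.BoundedScore Mg Mh) {H : ℕ} (τ : Trajectory S A H)
    (θ' θ : Param d) :
    |π.weight τ θ' θ - 1| ≤ H * Mg * ‖θ' - θ‖ * (π.weight τ θ' θ + 1) / 2 := by
  rw [π.weight_eq_exp]
  refine (Real.abs_exp_sub_one_le_mean _).trans ?_
  have := hB.abs_logLik_sub_le θ' θ τ
  gcongr

theorem integral_abs_weight_sub_one_le (hB : π.BoundedScore Mg Mh) (H : ℕ) (θ' θ : Param d) :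
    ∫ τ, |π.weight τ θ' θ - 1| ∂(M.trajLaw π θ H) ≤ H * Mg * ‖θ' - θ‖ := by
  have hw := M.integrable_weight π θ' θ H
  calc ∫ τ, |π.weight τ θ' θ - 1| ∂(M.trajLaw π θ H)
      ≤ ∫ τ, H * Mg * ‖θ' - θ‖ * (π.weight τ θ' θ + 1) / 2 ∂(M.trajLaw π θ H) :=
        integral_mono (hw.sub (integrable_const _)).abs
          (((hw.add (integrable_const _)).const_mul _).div_const _)
          fun τ => abs_weight_sub_one_le hB τ θ' θ
    _ = H * Mg * ‖θ' - θ‖ := by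
        rw [integral_div, integral_const_mul, integral_add hw (integrable_const _),
          M.integral_weight]
        simp
        ring

section Variance

variable {W : ℝ}

theorem memLp_weight {H : ℕ} {θ' θ : Param d}
    (hV : evariance (fun τ => π.weight τ θ' θ) (M.trajLaw π θ H) ≤ ENNReal.ofReal W) :
    MemLp (fun τ => π.weight τ θ' θ) 2 (M.trajLaw π θ H) :=
  (evariance_lt_top_iff_memLp (π.measurable_weight θ' θ).aestronglyMeasurable).1
    (hV.trans_lt ENNReal.ofReal_lt_top)

theorem integral_weight_sq_le (hW : 0 ≤ W) {H : ℕ} {θ' θ : Param d}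
    (hV : evariance (fun τ => π.weight τ θ' θ) (M.trajLaw π θ H) ≤ ENNReal.ofReal W) :
    ∫ τ, π.weight τ θ' θ ^ 2 ∂(M.trajLaw π θ H) ≤ W + 1 := by
  have h := variance_eq_sub (memLp_weight hV)
  have h2 : variance (fun τ => π.weight τ θ' θ) (M.trajLaw π θ H) ≤ W :=
    ENNReal.toReal_le_of_le_ofReal hW hV
  rw [M.integral_weight, h] at *
  simp only [Pi.pow_apply] at h2
  linarith

theorem integral_weight_sub_one_sq_le (hB : π.BoundedScore Mg Mh) (hW : 0 ≤ W) {H : ℕ}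
    {θ' θ : Param d}
    (hV : evariance (fun τ => π.weight τ θ' θ) (M.trajLaw π θ H) ≤ ENNReal.ofReal W) :
    ∫ τ, (π.weight τ θ' θ - 1) ^ 2 ∂(M.trajLaw π θ H) ≤
      (H * Mg * ‖θ' - θ‖) ^ 2 * (W + 1) := by
  have hm := memLp_weight hV
  have hi : Integrable (fun τ => π.weight τ θ' θ ^ 2) (M.trajLaw π θ H) := hm.integrable_sq
  have hb := integral_weight_sq_le hW hV
  calc ∫ τ, (π.weight τ θ' θ - 1) ^ 2 ∂(M.trajLaw π θ H)
      ≤ ∫ τ, (H * Mg * ‖θ' - θ‖) ^ 2 * ((π.weight τ θ' θ ^ 2 + 1) / 2) ∂(M.trajLaw π θ H) := by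
        refine integral_mono (hm.sub (memLp_const 1)).integrable_sq
          (((hi.add (integrable_const _)).div_const _).const_mul _) fun τ => ?_
        have h1 := abs_weight_sub_one_le hB τ θ' θ
        have h2 := pow_le_pow_left₀ (abs_nonneg _) h1 2
        rw [sq_abs] at h2
        refine h2.trans ?_
        have h3 := mul_nonneg (sq_nonneg (H * Mg * ‖θ' - θ‖))
          (sq_nonneg (π.weight τ θ' θ - 1))
        nlinarith
    _ = (H * Mg * ‖θ' - θ‖) ^ 2 *
          (((∫ τ, π.weight τ θ' θ ^ 2 ∂(M.trajLaw π θ H)) + 1) / 2) := by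
        rw [integral_const_mul, integral_div, integral_add hi (integrable_const _)]
        simp
    _ ≤ _ := by
        gcongr
        linarith

end Variance

/-! ### The policy gradient theorem -/

/-- Score-function identity, from differentiation under the integral sign. -/
theorem hasGradientAt_integral_trajLaw (hB : π.BoundedScore Mg Mh) {n : ℕ}
    {F : Trajectory S A n → ℝ} (hF : Measurable F) {K : ℝ} (hK : ∀ τ, |F τ| ≤ K) (θ : Param d) :
    HasGradientAt (fun θ' => ∫ τ, F τ ∂(M.trajLaw π θ' n))
      (∫ τ, F τ • π.scoreSum θ τ ∂(M.trajLaw π θ n)) θ := by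
  rw [hasGradientAt_iff_hasFDerivAt]
  have hFi : ∀ θ, Integrable F (M.trajLaw π θ n) := fun θ =>
    Integrable.of_bound hF.aestronglyMeasurable K (ae_of_all _ hK)
  have hSi : Integrable (fun τ => F τ • π.scoreSum θ τ) (M.trajLaw π θ n) := by
    refine Integrable.of_bound (hF.smul (hB.measurable_scoreSum n θ)).aestronglyMeasurable
      (K * (n * Mg)) (ae_of_all _ fun τ => ?_)
    rw [norm_smul]
    exact mul_le_mul (hK τ) (hB.norm_scoreSum_le θ τ) (norm_nonneg _) ((abs_nonneg _).trans (hK τ))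
  have hdual : Measurable fun τ : Trajectory S A n =>
      InnerProductSpace.toDual ℝ (Param d) (F τ • π.scoreSum θ τ) :=
    (InnerProductSpace.toDual ℝ (Param d)).continuous.measurable.fun_comp
      (hF.smul (hB.measurable_scoreSum n θ))
  have hint : (InnerProductSpace.toDual ℝ (Param d))
      (∫ τ, F τ • π.scoreSum θ τ ∂(M.trajLaw π θ n)) =
      ∫ τ, (F τ * π.weight τ θ θ) • (InnerProductSpace.toDual ℝ (Param d)) (π.scoreSum θ τ)
        ∂(M.trajLaw π θ n) := by
    ext y
    have h1 : Integrable (fun τ => InnerProductSpace.toDual ℝ (Param d)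
        (F τ • π.scoreSum θ τ)) (M.trajLaw π θ n) := by
      refine hSi.norm.mono hdual.aestronglyMeasurable (ae_of_all _ fun τ => ?_)
      rw [LinearIsometryEquiv.norm_map, norm_norm]
    have h2 : (fun τ => (F τ * π.weight τ θ θ) •
        (InnerProductSpace.toDual ℝ (Param d)) (π.scoreSum θ τ)) =
        fun τ => InnerProductSpace.toDual ℝ (Param d) (F τ • π.scoreSum θ τ) := by
      funext τ
      simp [π.weight_self]
    rw [h2, ContinuousLinearMap.integral_apply h1, InnerProductSpace.toDual_apply_apply,
      real_inner_comm, ← integral_inner hSi]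
    refine integral_congr_ae (ae_of_all _ fun τ => ?_)
    simp only [InnerProductSpace.toDual_apply_apply]
    rw [real_inner_comm]
  have hcongr : (fun θ' => ∫ τ, F τ ∂(M.trajLaw π θ' n)) =
      fun θ' => ∫ τ, F τ * π.weight τ θ' θ ∂(M.trajLaw π θ n) := by
    funext θ'
    rw [M.integral_trajLaw_eq π θ' θ]
    simp [mul_comm]
  rw [hint, hcongr]
  refine hasFDerivAt_integral_of_dominated_of_fderiv_le
    (F' := fun θ' τ => (F τ * π.weight τ θ' θ) •
      (InnerProductSpace.toDual ℝ (Param d)) (π.scoreSum θ' τ))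
    (bound := fun _ => K * Real.exp (n * Mg) * (n * Mg))
    (Metric.ball_mem_nhds θ one_pos) ?_ ?_ ?_ ?_ ?_ ?_
  · exact Filter.Eventually.of_forall fun θ' =>
      (hF.mul (π.measurable_weight θ' θ)).aestronglyMeasurable
  · simpa [π.weight_self] using hFi θ
  · simpa [π.weight_self] using hdual.aestronglyMeasurable
  · refine ae_of_all _ fun τ θ' hθ' => ?_
    have hn : 0 ≤ n * Mg := (norm_nonneg _).trans (hB.norm_scoreSum_le θ τ)
    have hw : π.weight τ θ' θ ≤ Real.exp (n * Mg) := by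
      rw [π.weight_eq_exp]
      refine Real.exp_le_exp.2 ((le_abs_self _).trans ((hB.abs_logLik_sub_le θ' θ τ).trans ?_))
      rw [mem_ball_iff_norm] at hθ'
      exact mul_le_of_le_one_right hn hθ'.le
    have hK0 : 0 ≤ K := (abs_nonneg _).trans (hK τ)
    rw [norm_smul, LinearIsometryEquiv.norm_map, norm_mul, Real.norm_eq_abs, Real.norm_eq_abs,
      abs_of_pos (π.weight_pos _ _ _)]
    exact mul_le_mul (mul_le_mul (hK τ) hw (π.weight_pos _ _ _).le hK0) (hB.norm_scoreSum_le θ' τ)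
      (norm_nonneg _) (by positivity)
  · exact integrable_const _
  · refine ae_of_all _ fun τ θ' _ => ?_
    have h := (((hB.hasFDerivAt_logLik θ' τ).sub_const (π.logLik θ τ)).exp).const_mul (F τ)
    simp only [← π.weight_eq_exp] at h
    rwa [smul_smul] at h

variable {R γ : ℝ} {H : ℕ}

theorem measurable_reward_at (M : MDP S A) (j : Fin H) :
    Measurable fun τ : Trajectory S A H => M.reward (τ j).1 (τ j).2 :=
  M.measurable_reward.fun_comp (measurable_pi_apply j)

theorem measurable_pgt (hB : π.BoundedScore Mg Mh) (b : Fin H → ℝ) :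
    Measurable (Function.uncurry fun (τ : Trajectory S A H) (θ : Param d) =>
      M.pgt π γ b τ θ) := by
  have h1 : ∀ h : Fin H, Measurable fun x : Trajectory S A H × Param d => x.1 h :=
    fun h => (measurable_pi_apply h).comp measurable_fst
  simp only [Function.uncurry_def, pgt]
  refine Finset.measurable_fun_sum _ fun h _ => Finset.measurable_fun_sum _ fun j _ => ?_
  exact ((((M.measurable_reward_at j).comp measurable_fst).const_mul (γ ^ (j : ℕ))).sub_const
    (b j)).smul
    (hB.measurable_score.fun_comp (measurable_snd.prodMk (h1 h)))

/-- Discounted sums over pairs `h ≤ j` are bounded by `(1-γ)⁻²`. -/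
theorem norm_sum_Ici_smul_le (hγ : 0 < γ ∧ γ < 1) (hR : 0 ≤ R) {E : Type*}
    [NormedAddCommGroup E] [NormedSpace ℝ E] {V : ℝ} (hV : 0 ≤ V) {c : Fin H → ℝ} {v : Fin H → E}
    (hc : ∀ j, |c j| ≤ γ ^ (j : ℕ) * R) (hv : ∀ h, ‖v h‖ ≤ V) :
    ‖∑ h : Fin H, ∑ j ∈ Finset.Ici h, c j • v h‖ ≤ V * R / (1 - γ) ^ 2 := by
  have h1 : 0 < 1 - γ := by linarith [hγ.2]
  have hin : ∀ h : Fin H, ∑ j ∈ Finset.Ici h, γ ^ (j : ℕ) ≤ γ ^ (h : ℕ) / (1 - γ) := by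
    intro h
    have : ∑ j ∈ Finset.Ici h, γ ^ (j : ℕ) = ∑ j ∈ Finset.Ico (h : ℕ) H, γ ^ j := by
      rw [← Fin.map_valEmbedding_Ici, Finset.sum_map]
      rfl
    rw [this]
    exact geom_sum_Ico_le_of_lt_one hγ.1.le hγ.2
  have hout : ∑ h : Fin H, γ ^ (h : ℕ) ≤ 1 / (1 - γ) := by
    rw [Fin.sum_univ_eq_sum_range (fun i => γ ^ i) H, Finset.range_eq_Ico]
    simpa using geom_sum_Ico_le_of_lt_one (m := 0) (n := H) hγ.1.le hγ.2
  calc ‖∑ h : Fin H, ∑ j ∈ Finset.Ici h, c j • v h‖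
      ≤ ∑ h : Fin H, ∑ j ∈ Finset.Ici h, γ ^ (j : ℕ) * R * V := by
        refine norm_sum_le_of_le _ fun h _ => norm_sum_le_of_le _ fun j _ => ?_
        rw [norm_smul]
        exact mul_le_mul (hc j) (hv h) (norm_nonneg _) ((abs_nonneg _).trans (hc j))
    _ = R * V * ∑ h : Fin H, ∑ j ∈ Finset.Ici h, γ ^ (j : ℕ) := by
        simp only [Finset.mul_sum]
        refine Finset.sum_congr rfl fun h _ => Finset.sum_congr rfl fun j _ => by ring
    _ ≤ R * V * ∑ h : Fin H, γ ^ (h : ℕ) / (1 - γ) := by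
        gcongr
        exact hin _
    _ ≤ R * V * (1 / (1 - γ) / (1 - γ)) := by
        rw [← Finset.sum_div]
        gcongr
    _ = V * R / (1 - γ) ^ 2 := by field_simp

theorem norm_pgt_le (hB : π.BoundedScore Mg Mh) (hγ : 0 < γ ∧ γ < 1) (hR : 0 ≤ R)
    (hMg : 0 ≤ Mg) {b : Fin H → ℝ}
    (hb : ∀ (j : Fin H) s a, |γ ^ (j : ℕ) * M.reward s a - b j| ≤ γ ^ (j : ℕ) * R)
    (τ : Trajectory S A H) (θ : Param d) : ‖M.pgt π γ b τ θ‖ ≤ Mg * R / (1 - γ) ^ 2 :=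
  norm_sum_Ici_smul_le hγ hR hMg (fun j => hb j _ _) fun _ => ((hB _ _).2.2 θ).1

theorem norm_pgt_sub_le (hB : π.BoundedScore Mg Mh) (hγ : 0 < γ ∧ γ < 1) (hR : 0 ≤ R)
    (hMh : 0 ≤ Mh) {b : Fin H → ℝ}
    (hb : ∀ (j : Fin H) s a, |γ ^ (j : ℕ) * M.reward s a - b j| ≤ γ ^ (j : ℕ) * R)
    (τ : Trajectory S A H) (θ' θ : Param d) :
    ‖M.pgt π γ b τ θ' - M.pgt π γ b τ θ‖ ≤ Mh * R / (1 - γ) ^ 2 * ‖θ' - θ‖ := by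
  have := norm_sum_Ici_smul_le (H := H) (v := fun h => π.score θ' (τ h).1 (τ h).2 -
    π.score θ (τ h).1 (τ h).2) hγ hR (mul_nonneg hMh (norm_nonneg (θ' - θ)))
    (fun j => hb j (τ j).1 (τ j).2) fun h => hB.norm_score_sub_le θ' θ _ _
  simp only [smul_sub, Finset.sum_sub_distrib] at this
  refine this.trans (le_of_eq ?_)
  ring

theorem integrable_pgt (hB : π.BoundedScore Mg Mh) (hγ : 0 < γ ∧ γ < 1) (hR : 0 ≤ R)
    (hMg : 0 ≤ Mg) {b : Fin H → ℝ}
    (hb : ∀ (j : Fin H) s a, |γ ^ (j : ℕ) * M.reward s a - b j| ≤ γ ^ (j : ℕ) * R)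
    (θ' θ : Param d) : Integrable (fun τ => M.pgt π γ b τ θ') (M.trajLaw π θ H) :=
  Integrable.of_bound ((measurable_pgt hB b).fun_comp (measurable_id.prodMk
    measurable_const)).aestronglyMeasurable _ (ae_of_all _ fun τ => norm_pgt_le hB hγ hR hMg hb τ θ')

/-- The PGT estimator is unbiased. Each reward is integrated under the law of the trajectory
stopped at its own time, so that only earlier scores appear in its gradient; the baselines are
constants and drop out for the same reason. -/
theorem hasGradientAt_J (hB : π.BoundedScore Mg Mh) {b : Fin H → ℝ}
    (hb : ∀ (j : Fin H) s a, |γ ^ (j : ℕ) * M.reward s a - b j| ≤ γ ^ (j : ℕ) * R)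
    (θ : Param d) :
    HasGradientAt (M.J π γ H) (∫ τ, M.pgt π γ b τ θ ∂(M.trajLaw π θ H)) θ := by
  set c : Fin H → S × A → ℝ := fun j z => γ ^ (j : ℕ) * M.reward z.1 z.2 - b j with hc
  have hcm : ∀ j, Measurable (c j) := fun j => (M.measurable_reward.const_mul _).sub_const _
  have hle : ∀ j : Fin H, (j : ℕ) + 1 ≤ H := fun j => j.isLt
  -- the marginal form of the objective
  have hJ : M.J π γ H = fun θ => ∑ j : Fin H,
      ((∫ τ, c j (τ (Fin.last _)) ∂(M.trajLaw π θ ((j : ℕ) + 1))) + b j) := by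
    funext θ
    have hint : ∀ j : Fin H, Integrable
        (fun τ : Trajectory S A H => c j (τ j)) (M.trajLaw π θ H) := fun j =>
      Integrable.of_bound ((hcm j).fun_comp (measurable_pi_apply j)).aestronglyMeasurable _
        (ae_of_all _ fun τ => hb j _ _)
    have h1 : ∀ j : Fin H, ∫ τ, c j (τ (Fin.last _)) ∂(M.trajLaw π θ ((j : ℕ) + 1)) =
        ∫ τ, c j (τ j) ∂(M.trajLaw π θ H) := by
      intro j
      rw [← M.map_trajLaw_castLE π θ (hle j), integral_map
        (measurable_restrict_castLE _).aemeasurable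
        ((hcm j).fun_comp (measurable_pi_apply _)).aestronglyMeasurable]
      rfl
    simp_rw [h1]
    rw [Finset.sum_add_distrib, ← integral_finsetSum _ fun j _ => hint j]
    have h2 : ∀ τ : Trajectory S A H, M.trajReward γ τ = ∑ j, c j (τ j) + ∑ j, b j := by
      intro τ
      rw [← Finset.sum_add_distrib]
      exact Finset.sum_congr rfl fun j _ => by simp [hc]
    rw [J]
    simp_rw [h2]
    rw [integral_add (integrable_finsetSum _ fun j _ => hint j) (integrable_const _)]
    simp
  have hterm : ∀ j : Fin H, HasGradientAt
      (fun θ => (∫ τ, c j (τ (Fin.last _)) ∂(M.trajLaw π θ ((j : ℕ) + 1))) + b j)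
      (∫ τ, c j (τ j) • ∑ h ∈ Finset.Iic j, π.score θ (τ h).1 (τ h).2 ∂(M.trajLaw π θ H)) θ := by
    intro j
    have h := hasGradientAt_integral_trajLaw (M := M) hB (n := (j : ℕ) + 1)
      (F := fun τ => c j (τ (Fin.last _))) ((hcm j).fun_comp (measurable_pi_apply _))
      (fun τ => hb j _ _) θ
    rw [← M.map_trajLaw_castLE π θ (hle j), integral_map
        (measurable_restrict_castLE _).aemeasurable
        (((hcm j).fun_comp (measurable_pi_apply _)).fun_smul
          (hB.measurable_scoreSum _ θ)).aestronglyMeasurable] at h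
    have he : ∀ τ : Trajectory S A H,
        π.scoreSum θ (fun i : Fin ((j : ℕ) + 1) => τ (Fin.castLE (hle j) i)) =
          ∑ h ∈ Finset.Iic j, π.score θ (τ h).1 (τ h).2 := by
      intro τ
      refine Finset.sum_nbij (fun i => Fin.castLE (hle j) i) ?_ ?_ ?_ ?_
      · intro i _
        exact Finset.mem_Iic.2 (Fin.le_def.2 (Nat.le_of_lt_succ i.isLt))
      · intro i _ i' _ h
        exact Fin.castLE_injective _ h
      · intro i hi
        have := Fin.le_def.1 (Finset.mem_Iic.1 (Finset.mem_coe.1 hi))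
        exact ⟨⟨i, Nat.lt_succ_of_le this⟩, Finset.mem_coe.2 (Finset.mem_univ _), rfl⟩
      · intro i _
        rfl
    simp_rw [he] at h
    exact HasFDerivAt.add_const (b j) h
  have hsum : ∫ τ, M.pgt π γ b τ θ ∂(M.trajLaw π θ H) = ∑ j : Fin H,
      ∫ τ, c j (τ j) • ∑ h ∈ Finset.Iic j, π.score θ (τ h).1 (τ h).2 ∂(M.trajLaw π θ H) := by
    rw [← integral_finsetSum]
    · refine integral_congr_ae (ae_of_all _ fun τ => ?_)
      simp only [pgt, Finset.smul_sum]
      exact Finset.sum_comm' (by simp)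
    · intro j _
      refine Integrable.of_bound (((hcm j).fun_comp (measurable_pi_apply j)).smul
        (Finset.measurable_fun_sum _ fun h _ =>
          (hB.measurable_score_fixed θ).fun_comp (measurable_pi_apply h))).aestronglyMeasurable
        (γ ^ (j : ℕ) * R * ∑ h ∈ Finset.Iic j, Mg) (ae_of_all _ fun τ => ?_)
      rw [norm_smul]
      exact mul_le_mul (hb j _ _) (norm_sum_le_of_le _ fun h _ => ((hB _ _).2.2 θ).1)
        (norm_nonneg _) ((abs_nonneg _).trans (hb j (τ j).1 (τ j).2))
  rw [hJ, hsum, hasGradientAt_iff_hasFDerivAt, map_sum]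
  exact HasFDerivAt.fun_sum fun j _ => (hterm j).hasFDerivAt

theorem gradient_J (hB : π.BoundedScore Mg Mh) {b : Fin H → ℝ}
    (hb : ∀ (j : Fin H) s a, |γ ^ (j : ℕ) * M.reward s a - b j| ≤ γ ^ (j : ℕ) * R)
    (θ : Param d) :
    gradient (M.J π γ H) θ = ∫ τ, M.pgt π γ b τ θ ∂(M.trajLaw π θ H) :=
  (hasGradientAt_J hB hb θ).gradient

theorem abs_J_le (hγ : 0 < γ ∧ γ < 1) (hr : ∀ s a, |M.reward s a| ≤ R)
    (θ : Param d) : |M.J π γ H θ| ≤ H * R := by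
  have h : ∀ τ : Trajectory S A H, ‖M.trajReward γ τ‖ ≤ H * R := by
    intro τ
    refine (norm_sum_le_of_le _ (n := fun _ => R) fun h _ => ?_).trans (by simp)
    rw [norm_mul, norm_pow, Real.norm_of_nonneg hγ.1.le]
    exact (mul_le_of_le_one_left (norm_nonneg _) (pow_le_one₀ hγ.1.le hγ.2.le)).trans (hr _ _)
  simpa [J] using norm_integral_le_of_norm_le_const (μ := M.trajLaw π θ H) (ae_of_all _ h)

/-- Second-order smoothness of `J`, by comparing `∇J(θ') = E_θ[w g(·|θ')]` with
`∇J(θ) = E_θ[g(·|θ)]`. -/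
theorem norm_gradient_J_sub_le (hB : π.BoundedScore Mg Mh) (hγ : 0 < γ ∧ γ < 1) (hR : 0 ≤ R)
    (hMg : 0 ≤ Mg) (hMh : 0 ≤ Mh) {b : Fin H → ℝ}
    (hb : ∀ (j : Fin H) s a, |γ ^ (j : ℕ) * M.reward s a - b j| ≤ γ ^ (j : ℕ) * R)
    (θ' θ : Param d) :
    ‖gradient (M.J π γ H) θ' - gradient (M.J π γ H) θ‖ ≤
      (Mg * R / (1 - γ) ^ 2 * (H * Mg) + Mh * R / (1 - γ) ^ 2) * ‖θ' - θ‖ := by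
  have hw := M.integrable_weight π θ' θ H
  have hgi := integrable_pgt (M := M) hB hγ hR hMg hb
  have hG : 0 ≤ Mg * R / (1 - γ) ^ 2 := by positivity
  have hwg : Integrable (fun τ => π.weight τ θ' θ • M.pgt π γ b τ θ') (M.trajLaw π θ H) :=
    hw.smul_of_top_left (memLp_top_of_bound (hgi θ' θ).aestronglyMeasurable _
      (ae_of_all _ fun τ => norm_pgt_le hB hγ hR hMg hb τ θ'))
  rw [gradient_J hB hb, gradient_J hB hb, M.integral_trajLaw_eq π θ' θ,
    ← integral_sub hwg (hgi θ θ)]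
  have hi : Integrable (fun τ => |π.weight τ θ' θ - 1|) (M.trajLaw π θ H) :=
    (hw.sub (integrable_const (1 : ℝ))).abs
  calc _ ≤ ∫ τ, (Mg * R / (1 - γ) ^ 2 * |π.weight τ θ' θ - 1| +
        Mh * R / (1 - γ) ^ 2 * ‖θ' - θ‖) ∂(M.trajLaw π θ H) := by
        refine norm_integral_le_of_norm_le ((hi.const_mul _).add (integrable_const _))
          (ae_of_all _ fun τ => ?_)
        have h1 : π.weight τ θ' θ • M.pgt π γ b τ θ' - M.pgt π γ b τ θ =
            (π.weight τ θ' θ - 1) • M.pgt π γ b τ θ' +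
              (M.pgt π γ b τ θ' - M.pgt π γ b τ θ) := by
          rw [sub_smul, one_smul]; abel
        rw [h1]
        refine (norm_add_le _ _).trans (add_le_add ?_ (norm_pgt_sub_le hB hγ hR hMh hb τ θ' θ))
        rw [norm_smul, mul_comm, Real.norm_eq_abs]
        gcongr
        exact norm_pgt_le hB hγ hR hMg hb τ θ'
    _ = Mg * R / (1 - γ) ^ 2 * (∫ τ, |π.weight τ θ' θ - 1| ∂(M.trajLaw π θ H)) +
        Mh * R / (1 - γ) ^ 2 * ‖θ' - θ‖ := by
        rw [integral_add (hi.const_mul _) (integrable_const _), integral_const_mul]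
        simp
    _ ≤ Mg * R / (1 - γ) ^ 2 * (H * Mg * ‖θ' - θ‖) + Mh * R / (1 - γ) ^ 2 * ‖θ' - θ‖ := by
        gcongr
        exact integral_abs_weight_sub_one_le hB H θ' θ
    _ = _ := by ring

/-- Mean-square size of the variance-reduced correction. -/
theorem integral_norm_pgt_sub_weight_smul_sq_le (hB : π.BoundedScore Mg Mh) (hγ : 0 < γ ∧ γ < 1)
    (hR : 0 ≤ R) (hMg : 0 ≤ Mg) (hMh : 0 ≤ Mh) {W : ℝ} (hW : 0 ≤ W) {b : Fin H → ℝ}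
    (hb : ∀ (j : Fin H) s a, |γ ^ (j : ℕ) * M.reward s a - b j| ≤ γ ^ (j : ℕ) * R)
    {θ' θ : Param d}
    (hV : evariance (fun τ => π.weight τ θ' θ) (M.trajLaw π θ H) ≤ ENNReal.ofReal W) :
    ∫ τ, ‖M.pgt π γ b τ θ - π.weight τ θ' θ • M.pgt π γ b τ θ'‖ ^ 2 ∂(M.trajLaw π θ H) ≤
      2 * ((Mh * R / (1 - γ) ^ 2) ^ 2 + (Mg * R / (1 - γ) ^ 2) ^ 2 * ((H * Mg) ^ 2 * (W + 1))) *
        ‖θ' - θ‖ ^ 2 := by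
  have hi : Integrable (fun τ => (π.weight τ θ' θ - 1) ^ 2) (M.trajLaw π θ H) :=
    ((memLp_weight hV).sub (memLp_const 1)).integrable_sq
  calc _ ≤ ∫ τ, (2 * (Mh * R / (1 - γ) ^ 2 * ‖θ' - θ‖) ^ 2 +
        2 * (Mg * R / (1 - γ) ^ 2) ^ 2 * (π.weight τ θ' θ - 1) ^ 2) ∂(M.trajLaw π θ H) := by
        refine integral_mono_of_nonneg (ae_of_all _ fun τ => by positivity)
          ((integrable_const _).add (hi.const_mul _)) (ae_of_all _ fun τ => ?_)
        have h1 : M.pgt π γ b τ θ - π.weight τ θ' θ • M.pgt π γ b τ θ' =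
            -((π.weight τ θ' θ - 1) • M.pgt π γ b τ θ' +
              (M.pgt π γ b τ θ' - M.pgt π γ b τ θ)) := by
          rw [sub_smul, one_smul]; abel
        have h2 : ‖(π.weight τ θ' θ - 1) • M.pgt π γ b τ θ'‖ ≤
            |π.weight τ θ' θ - 1| * (Mg * R / (1 - γ) ^ 2) := by
          rw [norm_smul, Real.norm_eq_abs]
          gcongr
          exact norm_pgt_le hB hγ hR hMg hb τ θ'
        have h3 := (norm_add_le _ _).trans
          (add_le_add h2 (norm_pgt_sub_le hB hγ hR hMh hb τ θ' θ))
        dsimp only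
        rw [h1, norm_neg]
        refine (pow_le_pow_left₀ (norm_nonneg _) h3 2).trans ?_
        refine (add_sq_le).trans (le_of_eq ?_)
        rw [mul_pow, sq_abs]
        ring
    _ = 2 * (Mh * R / (1 - γ) ^ 2 * ‖θ' - θ‖) ^ 2 + 2 * (Mg * R / (1 - γ) ^ 2) ^ 2 *
        ∫ τ, (π.weight τ θ' θ - 1) ^ 2 ∂(M.trajLaw π θ H) := by
        rw [integral_add (integrable_const _) (hi.const_mul _), integral_const, probReal_univ,
          one_smul, integral_const_mul]
    _ ≤ 2 * (Mh * R / (1 - γ) ^ 2 * ‖θ' - θ‖) ^ 2 + 2 * (Mg * R / (1 - γ) ^ 2) ^ 2 *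
        ((H * Mg * ‖θ' - θ‖) ^ 2 * (W + 1)) := by
        gcongr
        exact integral_weight_sub_one_sq_le hB hW hV
    _ = _ := by ring

/-- The trajectory laws form a kernel: all have measurable densities with respect to the law at the
parameter `0`. -/
theorem measurable_trajLaw (hB : π.BoundedScore Mg Mh) (H : ℕ) :
    Measurable fun θ => M.trajLaw π θ H := by
  have hf : Measurable (Function.uncurry fun (θ : Param d) (τ : Trajectory S A H) =>
      ENNReal.ofReal (π.weight τ θ 0)) :=
    ((hB.measurable_weight H).fun_comp (measurable_snd.prodMk
      (measurable_fst.prodMk measurable_const))).ennreal_ofReal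
  have := ((Kernel.const (Param d) (M.trajLaw π 0 H)).withDensity
    fun θ τ => ENNReal.ofReal (π.weight τ θ 0)).measurable
  convert this using 2 with θ
  rw [Kernel.withDensity_apply _ hf, Kernel.const_apply]
  exact M.trajLaw_eq_withDensity π θ 0 H

end MDP

/-! ### Runs of the algorithm driven by an abstract stochastic oracle -/

namespace ISMBPG

namespace Input

variable {d : ℕ} {Z : Type*} [MeasurableSpace Z]

/-- The properties of the sampler, stochastic gradient and importance weight that the convergence
analysis uses: `J` has a `2L`-Lipschitz gradient, `grad` is an unbiased estimator of it which is
bounded by `G` and has variance at most `σ²`, `weight` corrects for sampling at another parameter,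
and the mean square of a corrected difference of gradients is at most `2 Bsq ‖θ' - θ‖²`. -/
structure IsOracle (a : Input d Z) (J : Param d → ℝ) (G L Bsq σ : ℝ) : Prop where
  prob : ∀ θ, IsProbabilityMeasure (a.law θ)
  measurable_law : Measurable a.law
  measurable_grad : Measurable (Function.uncurry a.grad)
  measurable_weight : Measurable fun x : Z × Param d × Param d => a.weight x.1 x.2.1 x.2.2
  norm_grad_le : ∀ z θ, ‖a.grad z θ‖ ≤ G
  differentiable : Differentiable ℝ J
  norm_gradient_sub_le : ∀ θ' θ, ‖gradient J θ' - gradient J θ‖ ≤ 2 * L * ‖θ' - θ‖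
  integral_grad : ∀ θ, ∫ z, a.grad z θ ∂(a.law θ) = gradient J θ
  memLp_weight : ∀ θ' θ, MemLp (fun z => a.weight z θ' θ) 2 (a.law θ)
  integral_weight_smul_grad :
    ∀ θ' θ, ∫ z, a.weight z θ' θ • a.grad z θ' ∂(a.law θ) = gradient J θ'
  integral_correction_sq_le : ∀ θ' θ,
    ∫ z, ‖a.grad z θ - a.weight z θ' θ • a.grad z θ'‖ ^ 2 ∂(a.law θ) ≤ 2 * Bsq * ‖θ' - θ‖ ^ 2
  variance_le : ∀ θ, ∫ z, ‖a.grad z θ - gradient J θ‖ ^ 2 ∂(a.law θ) ≤ σ ^ 2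

/-- The step size `k / (m + s)^{1/3}` as a function of `s = ∑ G_i²`. -/
def stepSize (a : Input d Z) (s : ℝ) : ℝ := a.k / (a.m + s) ^ (1 / 3 : ℝ)

variable {a : Input d Z} {J : Param d → ℝ} {G L Bsq σ : ℝ}

theorem memory_θ (n : ℕ) (τ : Fin (n + 1) → Z) :
    (a.memory n τ).θ = a.iterate n (Fin.init τ) := by
  cases n <;> rfl

theorem memory_θNext (n : ℕ) (τ : Fin (n + 1) → Z) :
    (a.memory n τ).θNext =
      (a.memory n τ).θ + a.stepSize (a.memory n τ).sumSq • (a.memory n τ).u := by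
  cases n <;> rfl

theorem memory_βNext (n : ℕ) (τ : Fin (n + 1) → Z) :
    (a.memory n τ).βNext = a.c * a.stepSize (a.memory n τ).sumSq ^ 2 := by
  cases n <;> rfl

theorem memory_snoc (n : ℕ) (τ : Fin (n + 1) → Z) (z : Z) :
    a.memory (n + 1) (Fin.snoc (α := fun _ => Z) τ z) = a.nextStep (a.memory n τ) z := by
  rw [memory, Fin.init_snoc, Fin.snoc_last]

theorem sumSq_succ (n : ℕ) (τ : Fin (n + 2) → Z) :
    (a.memory (n + 1) τ).sumSq = (a.memory n (Fin.init τ)).sumSq +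
      ‖a.grad (τ (Fin.last _)) (a.memory n (Fin.init τ)).θNext‖ ^ 2 := rfl

theorem sumSq_nonneg (n : ℕ) (τ : Fin (n + 1) → Z) : 0 ≤ (a.memory n τ).sumSq := by
  induction n with
  | zero => exact sq_nonneg _
  | succ n ih => exact add_nonneg (ih _) (sq_nonneg _)

theorem sumSq_eq_sum (n : ℕ) (τ : Fin (n + 1) → Z) :
    (a.memory n τ).sumSq = ∑ i, ‖a.grad (τ i) (a.iterateOfRun τ i)‖ ^ 2 := by
  induction n with
  | zero => rw [Fin.sum_univ_one]; rfl
  | succ n ih =>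
    rw [Fin.sum_univ_castSucc, sumSq_succ, ih]
    rfl

theorem sumSq_castLE_le {n N : ℕ} (h : n ≤ N) (τ : Fin (N + 1) → Z) :
    (a.memory n fun j => τ (Fin.castLE (Nat.succ_le_succ h) j)).sumSq ≤
      (a.memory N τ).sumSq := by
  induction N, h using Nat.le_induction with
  | base => exact le_rfl
  | succ N h ih =>
    rw [sumSq_succ]
    exact (ih (Fin.init τ)).trans (le_add_of_nonneg_right (sq_nonneg _))

namespace IsOracle

variable (h : a.IsOracle J G L Bsq σ)
include h

theorem continuous_gradient : Continuous (gradient J) := by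
  have : LipschitzWith (2 * L).toNNReal (gradient J) := LipschitzWith.of_dist_le_mul fun x y => by
    rw [dist_eq_norm, dist_eq_norm]
    exact (h.norm_gradient_sub_le x y).trans (by gcongr; exact Real.le_coe_toNNReal _)
  exact this.continuous

theorem sumSq_le (n : ℕ) (τ : Fin (n + 1) → Z) : (a.memory n τ).sumSq ≤ (n + 1) * G ^ 2 := by
  have hg : ∀ z θ, ‖a.grad z θ‖ ^ 2 ≤ G ^ 2 := fun z θ =>
    pow_le_pow_left₀ (norm_nonneg _) (h.norm_grad_le z θ) 2
  rw [sumSq_eq_sum]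
  refine (Finset.sum_le_sum fun i _ => hg _ _).trans ?_
  simp

theorem norm_gradient_le (θ : Param d) : ‖gradient J θ‖ ≤ G := by
  have := h.prob θ
  rw [← h.integral_grad]
  simpa using norm_integral_le_of_norm_le_const (μ := a.law θ)
    (ae_of_all _ fun z => h.norm_grad_le z θ)

theorem measurable_grad_fixed (θ : Param d) : Measurable fun z => a.grad z θ :=
  h.measurable_grad.fun_comp measurable_prodMk_right

theorem integrable_grad_sq (θ' θ : Param d) :
    Integrable (fun z => ‖a.grad z θ'‖ ^ 2) (a.law θ) := by
  have := h.prob θ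
  refine Integrable.of_bound ((h.measurable_grad_fixed θ').norm.pow_const 2).aestronglyMeasurable
    (G ^ 2) (ae_of_all _ fun z => ?_)
  rw [norm_pow, norm_norm]
  exact pow_le_pow_left₀ (norm_nonneg _) (h.norm_grad_le z θ') 2

theorem measurable_memory (n : ℕ) :
    Measurable (fun τ => (a.memory n τ).θ) ∧ Measurable (fun τ => (a.memory n τ).u) ∧
    Measurable (fun τ => (a.memory n τ).sumSq) ∧ Measurable (fun τ => (a.memory n τ).θNext) ∧
    Measurable (fun τ => (a.memory n τ).βNext) := by
  have hstep : ∀ {s : (Fin (n + 1) → Z) → ℝ}, Measurable s →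
      Measurable fun τ => a.stepSize (s τ) := fun hs =>
    ((hs.const_add a.m).pow_const (1 / 3 : ℝ)).const_div a.k
  suffices hs : Measurable (fun τ => (a.memory n τ).θ) ∧ Measurable (fun τ => (a.memory n τ).u) ∧
      Measurable (fun τ => (a.memory n τ).sumSq) by
    refine ⟨hs.1, hs.2.1, hs.2.2, ?_, ?_⟩
    · simp only [memory_θNext]
      exact hs.1.add ((hstep hs.2.2).smul hs.2.1)
    · simp only [memory_βNext]
      exact ((hstep hs.2.2).pow_const 2).const_mul _
  clear hstep
  induction n with
  | zero =>
    have hg : Measurable fun τ : Fin 1 → Z => a.grad (τ 0) a.θ₁ :=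
      (h.measurable_grad_fixed _).fun_comp (measurable_pi_apply 0)
    exact ⟨measurable_const, hg, hg.norm.pow_const 2⟩
  | succ n ih =>
    have hstep : Measurable fun τ => a.stepSize (a.memory n τ).sumSq :=
      ((ih.2.2.const_add a.m).pow_const (1 / 3 : ℝ)).const_div a.k
    have hθ' : Measurable fun τ => (a.memory n τ).θNext := by
      simp only [memory_θNext]
      exact ih.1.add (hstep.smul ih.2.1)
    have hβ' : Measurable fun τ => (a.memory n τ).βNext := by
      simp only [memory_βNext]
      exact (hstep.pow_const 2).const_mul _
    have hi := measurable_finInit (Z := Z) (n + 1)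
    have hl : Measurable fun τ : Fin (n + 2) → Z => τ (Fin.last _) := measurable_pi_apply _
    have hg' : Measurable fun τ : Fin (n + 2) → Z =>
        a.grad (τ (Fin.last _)) (a.memory n (Fin.init τ)).θNext :=
      h.measurable_grad.fun_comp (hl.prodMk (hθ'.fun_comp hi))
    have hg : Measurable fun τ : Fin (n + 2) → Z =>
        a.grad (τ (Fin.last _)) (a.memory n (Fin.init τ)).θ :=
      h.measurable_grad.fun_comp (hl.prodMk (ih.1.fun_comp hi))
    have hw : Measurable fun τ : Fin (n + 2) → Z => a.weight (τ (Fin.last _))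
        (a.memory n (Fin.init τ)).θ (a.memory n (Fin.init τ)).θNext :=
      h.measurable_weight.fun_comp
        (hl.prodMk ((ih.1.fun_comp hi).prodMk (hθ'.fun_comp hi)))
    refine ⟨hθ'.fun_comp hi, ?_, (ih.2.2.fun_comp hi).add (hg'.norm.pow_const 2)⟩
    exact ((hβ'.fun_comp hi).smul hg').add (((hβ'.fun_comp hi).const_sub 1).smul
      (((ih.2.1.fun_comp hi).add hg').sub (hw.smul hg)))

theorem measurable_iterate (n : ℕ) : Measurable (a.iterate n) := by
  cases n with
  | zero => exact measurable_const
  | succ n => exact (h.measurable_memory n).2.2.2.1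

theorem measurable_iterateOfRun {T : ℕ} (i : Fin T) :
    Measurable fun τ => a.iterateOfRun (T := T) τ i :=
  (h.measurable_iterate i).fun_comp (measurable_restrict_castLE _)

theorem lintegral_runLaw_succ (n : ℕ) {f : (Fin (n + 1) → Z) → ENNReal} (hf : Measurable f) :
    ∫⁻ τ, f τ ∂(a.runLaw (n + 1)) =
      ∫⁻ τ, ∫⁻ z, f (Fin.snoc (α := fun _ => Z) τ z) ∂(a.law (a.iterate n τ)) ∂(a.runLaw n) := by
  have := h.prob
  let κ : Kernel (Fin n → Z) Z := ⟨fun τ => a.law (a.iterate n τ),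
    h.measurable_law.fun_comp (h.measurable_iterate n)⟩
  have : IsMarkovKernel κ := ⟨fun τ => h.prob _⟩
  have hsn : ∀ τ : Fin n → Z, Measurable fun z =>
      (Fin.snoc (α := fun _ => Z) τ z : Fin (n + 1) → Z) := fun τ =>
    (measurable_snoc n).fun_comp measurable_prodMk_left
  have hκ : (fun τ => (a.law (a.iterate n τ)).map
      fun z => (Fin.snoc (α := fun _ => Z) τ z : Fin (n + 1) → Z)) =
      ((Kernel.id ×ₖ κ).map fun x => (Fin.snoc (α := fun _ => Z) x.1 x.2 : Fin (n + 1) → Z)) := by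
    funext τ
    rw [Kernel.map_apply _ (measurable_snoc n), Kernel.prod_apply, Kernel.id_apply,
      Measure.dirac_prod, Measure.map_map (measurable_snoc n) measurable_prodMk_left]
    rfl
  rw [runLaw, Measure.lintegral_bind _ hf.aemeasurable]
  · exact lintegral_congr fun τ => lintegral_map hf (hsn τ)
  · rw [hκ]
    exact (Kernel.measurable _).aemeasurable

theorem isProbabilityMeasure_runLaw (n : ℕ) : IsProbabilityMeasure (a.runLaw n) := by
  have := h.prob
  induction n with
  | zero => unfold runLaw; infer_instance
  | succ n ih =>
    have := h.lintegral_runLaw_succ n (f := fun _ => 1) measurable_const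
    exact ⟨by simpa using this⟩

theorem map_runLaw_castLE {n N : ℕ} (hn : n ≤ N) :
    (a.runLaw N).map (fun τ (j : Fin n) => τ (Fin.castLE hn j)) = a.runLaw n :=
  map_castLE_of_sequential a.runLaw (fun n τ => a.law (a.iterate n τ)) (fun _ _ => h.prob _)
    (fun n _ hf => h.lintegral_runLaw_succ n hf) hn

end IsOracle

end Input

end ISMBPG

/-! ### Step sizes -/

namespace ISMBPG

namespace Input

variable {d : ℕ} {Z : Type*} [MeasurableSpace Z]

/-- The relations between the hyperparameters and the constants `G`, `L`, `Bsq`. -/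
structure IsTuned (a : Input d Z) (G L Bsq : ℝ) : Prop where
  G_pos : 0 < G
  L_pos : 0 < L
  Bsq_pos : 0 < Bsq
  k_pos : 0 < a.k
  c_eq : a.c = G ^ 2 / (3 * a.k ^ 3 * L) + 104 * Bsq
  two_mul_sq_le : 2 * G ^ 2 ≤ a.m
  cube_le : (2 * L * a.k) ^ 3 ≤ a.m
  cube_le' : (a.c * a.k / (2 * L)) ^ 3 ≤ a.m

variable {a : Input d Z} {J : Param d → ℝ} {G L Bsq σ : ℝ}

namespace IsTuned

variable (ht : a.IsTuned G L Bsq)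
include ht

theorem c_pos : 0 < a.c := by
  have := ht.G_pos; have := ht.L_pos; have := ht.Bsq_pos; have := ht.k_pos
  rw [ht.c_eq]; positivity

theorem m_pos : 0 < a.m := by
  have := ht.G_pos
  exact lt_of_lt_of_le (by positivity) ht.two_mul_sq_le

theorem cubeRoot_pos {s : ℝ} (hs : 0 ≤ s) : 0 < (a.m + s) ^ (1 / 3 : ℝ) :=
  Real.rpow_pos_of_pos (by linarith [ht.m_pos]) _

theorem cubeRoot_pow {s : ℝ} (hs : 0 ≤ s) : ((a.m + s) ^ (1 / 3 : ℝ)) ^ 3 = a.m + s := by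
  rw [← Real.rpow_natCast, ← Real.rpow_mul (by linarith [ht.m_pos])]
  norm_num

theorem le_cubeRoot {s : ℝ} (hs : 0 ≤ s) : 2 * L * a.k ≤ (a.m + s) ^ (1 / 3 : ℝ) :=
  le_of_pow_le_pow_left₀ three_ne_zero (ht.cubeRoot_pos hs).le
    (by rw [ht.cubeRoot_pow hs]; linarith [ht.cube_le])

theorem le_cubeRoot' {s : ℝ} (hs : 0 ≤ s) : a.c * a.k / (2 * L) ≤ (a.m + s) ^ (1 / 3 : ℝ) :=
  le_of_pow_le_pow_left₀ three_ne_zero (ht.cubeRoot_pos hs).le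
    (by rw [ht.cubeRoot_pow hs]; linarith [ht.cube_le'])

theorem stepSize_pos {s : ℝ} (hs : 0 ≤ s) : 0 < a.stepSize s :=
  div_pos ht.k_pos (ht.cubeRoot_pos hs)

theorem two_mul_stepSize_le {s : ℝ} (hs : 0 ≤ s) : 2 * L * a.stepSize s ≤ 1 := by
  rw [stepSize, ← mul_div_assoc, div_le_one (ht.cubeRoot_pos hs)]
  exact ht.le_cubeRoot hs

theorem momentum_le_one {s : ℝ} (hs : 0 ≤ s) : a.c * a.stepSize s ^ 2 ≤ 1 := by
  have h1 := ht.le_cubeRoot hs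
  have h2 := ht.le_cubeRoot' hs
  have hL := ht.L_pos
  have hk := ht.k_pos
  have hc := ht.c_pos
  have h3 := mul_le_mul h1 h2 (by positivity) (ht.cubeRoot_pos hs).le
  have h4 : 2 * L * a.k * (a.c * a.k / (2 * L)) = a.c * a.k ^ 2 := by field_simp
  rw [stepSize, div_pow, ← mul_div_assoc, div_le_one (pow_pos (ht.cubeRoot_pos hs) 2)]
  nlinarith

theorem stepSize_pow_three {s : ℝ} (hs : 0 ≤ s) : a.stepSize s ^ 3 = a.k ^ 3 / (a.m + s) := by
  rw [stepSize, div_pow, ht.cubeRoot_pow hs]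

theorem stepSize_anti {s s' : ℝ} (hs : 0 ≤ s) (hss : s ≤ s') : a.stepSize s' ≤ a.stepSize s :=
  div_le_div_of_nonneg_left ht.k_pos.le (ht.cubeRoot_pos hs)
    (Real.rpow_le_rpow (by linarith [ht.m_pos]) (by linarith) (by norm_num))

/-- The inverse step size grows slowly enough for the growth to be absorbed by the momentum. -/
theorem inv_stepSize_sub_le {s x : ℝ} (hs : 0 ≤ s) (hx : 0 ≤ x) (hxG : x ≤ G ^ 2) :
    1 / a.stepSize (s + x) - G ^ 2 / (3 * a.k ^ 3 * L) * a.stepSize (s + x) ≤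
      1 / a.stepSize s := by
  have hsx : 0 ≤ s + x := add_nonneg hs hx
  have hk := ht.k_pos
  have hL := ht.L_pos
  have hy := ht.cubeRoot_pos hs
  have hy' := ht.cubeRoot_pos hsx
  have hyk := ht.le_cubeRoot hs
  have hyk' := ht.le_cubeRoot hsx
  have hy3 := ht.cubeRoot_pow hs
  have hy3' := ht.cubeRoot_pow hsx
  have hle : (a.m + s) ^ (1 / 3 : ℝ) ≤ (a.m + (s + x)) ^ (1 / 3 : ℝ) :=
    Real.rpow_le_rpow (by linarith [ht.m_pos]) (by linarith) (by norm_num)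
  simp only [stepSize]
  generalize (a.m + s) ^ (1 / 3 : ℝ) = y at *
  generalize (a.m + (s + x)) ^ (1 / 3 : ℝ) = y' at *
  -- with `y = (m + s)^{1/3}`, `y' = (m + s + x)^{1/3}`: `(y' - y) (y'² + y' y + y²) = x ≤ G²`
  have hcub : y' ^ 3 - y ^ 3 = (y' - y) * (y' ^ 2 + y' * y + y ^ 2) := by ring
  have hbig : 3 * L * a.k * y' ≤ y' ^ 2 + y' * y + y ^ 2 := by
    have h1 := mul_le_mul_of_nonneg_left hyk hy'.le
    have h2 := mul_le_mul_of_nonneg_left hyk' hy'.le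
    have h3 : 0 ≤ L * a.k * y' := by positivity
    nlinarith [sq_nonneg y]
  have hmain : (y' - y) * (3 * L * a.k * y') ≤ G ^ 2 := by
    have := mul_le_mul_of_nonneg_left hbig (sub_nonneg.2 hle)
    linarith
  have hdiv : (y' - y) ≤ G ^ 2 / (3 * L * a.k * y') := (le_div_iff₀ (by positivity)).2 hmain
  have e1 : 1 / (a.k / y') = y' / a.k := by field_simp
  have e2 : 1 / (a.k / y) = y / a.k := by field_simp
  have e3 : G ^ 2 / (3 * a.k ^ 3 * L) * (a.k / y') = G ^ 2 / (3 * L * a.k * y') / a.k := by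
    field_simp
  rw [e1, e2, e3, ← sub_div, div_le_div_iff_of_pos_right hk]
  linarith

/-- The terms `η_t³ G_{t+1}²` are bounded by the increments of a logarithm. -/
theorem stepSize_pow_three_mul_le {s x : ℝ} (hs : 0 ≤ s) (hx : 0 ≤ x) (hxG : x ≤ G ^ 2) :
    a.stepSize s ^ 3 * x ≤ a.k ^ 3 * (Real.log (G ^ 2 + (s + x)) - Real.log (G ^ 2 + s)) := by
  have hk := ht.k_pos
  have hG : 0 < G ^ 2 := pow_pos ht.G_pos 2
  have h1 : 0 < G ^ 2 + s := by linarith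
  have h2 : 0 < G ^ 2 + (s + x) := by linarith
  rw [ht.stepSize_pow_three hs, ← Real.log_div h2.ne' h1.ne', div_mul_eq_mul_div, mul_div_assoc]
  refine mul_le_mul_of_nonneg_left ?_ (by positivity)
  have h3 := Real.one_sub_inv_le_log_of_pos (div_pos h2 h1)
  refine le_trans ?_ h3
  rw [inv_div, one_sub_div h2.ne']
  have : G ^ 2 + (s + x) - (G ^ 2 + s) = x := by ring
  rw [this]
  exact div_le_div_of_nonneg_left hx h2 (by linarith [ht.two_mul_sq_le])

end IsTuned

end Input

end ISMBPG

/-! ### Descent -/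

theorem descent_of_lipschitz_gradient {E : Type*} [NormedAddCommGroup E] [InnerProductSpace ℝ E]
    [CompleteSpace E] {J : E → ℝ} (hJ : Differentiable ℝ J) {K : ℝ}
    (hL : ∀ x y, ‖gradient J x - gradient J y‖ ≤ K * ‖x - y‖) (x v : E) :
    J x + inner ℝ (gradient J x) v - K / 2 * ‖v‖ ^ 2 ≤ J (x + v) := by
  have hd : ∀ t : ℝ, HasDerivAt
      (fun t : ℝ => J (x + t • v) - t * inner ℝ (gradient J x) v + K / 2 * ‖v‖ ^ 2 * t ^ 2)
      (inner ℝ (gradient J (x + t • v)) v - 1 * inner ℝ (gradient J x) v +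
        K / 2 * ‖v‖ ^ 2 * (2 * t)) t := by
    intro t
    have h1 : HasDerivAt (fun t : ℝ => x + t • v) v t := by
      simpa using ((hasDerivAt_id t).smul_const v).const_add x
    have h2 : HasDerivAt (fun t : ℝ => J (x + t • v)) (inner ℝ (gradient J (x + t • v)) v) t := by
      have := (hJ (x + t • v)).hasGradientAt.hasFDerivAt.comp_hasDerivAt t h1
      rwa [InnerProductSpace.toDual_apply_apply] at this
    have h3 : HasDerivAt (fun t : ℝ => t ^ 2) (2 * t) t := by
      simpa using hasDerivAt_pow 2 t
    exact (h2.sub ((hasDerivAt_id' t).mul_const _)).add (h3.const_mul _)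
  have hmono : MonotoneOn
      (fun t : ℝ => J (x + t • v) - t * inner ℝ (gradient J x) v + K / 2 * ‖v‖ ^ 2 * t ^ 2)
      (Set.Ici 0) := by
    refine monotoneOn_of_deriv_nonneg (convex_Ici 0)
      (fun t _ => (hd t).continuousAt.continuousWithinAt)
      (fun t _ => (hd t).differentiableAt.differentiableWithinAt) fun t ht => ?_
    rw [interior_Ici] at ht
    have ht : 0 < t := ht
    rw [(hd t).deriv, one_mul, ← inner_sub_left]
    have h1 := (abs_le.1 (abs_real_inner_le_norm
      (gradient J (x + t • v) - gradient J x) v)).1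
    have h2 := mul_le_mul_of_nonneg_right (hL (x + t • v) x) (norm_nonneg v)
    have h3 : ‖x + t • v - x‖ = t * ‖v‖ := by
      rw [add_sub_cancel_left, norm_smul, Real.norm_of_nonneg ht.le]
    rw [h3] at h2
    linarith
  have := hmono (Set.mem_Ici.2 le_rfl) (Set.mem_Ici.2 zero_le_one) zero_le_one
  simp only [zero_smul, one_smul, add_zero, zero_mul, one_mul, sub_zero, one_pow, mul_one,
    ne_eq, OfNat.ofNat_ne_zero, not_false_eq_true, zero_pow, mul_zero] at this
  linarith

/-! ### Evolution of the estimation error -/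

/-- Bias-variance decomposition around a constant. -/
theorem integral_norm_add_sq_of_integral_eq_zero {Ω E : Type*} [MeasurableSpace Ω]
    [NormedAddCommGroup E] [InnerProductSpace ℝ E] [CompleteSpace E] {μ : Measure Ω}
    [IsProbabilityMeasure μ] {X : Ω → E} (hX : MemLp X 2 μ) (h0 : ∫ z, X z ∂μ = 0) (e : E) :
    ∫ z, ‖e + X z‖ ^ 2 ∂μ = ‖e‖ ^ 2 + ∫ z, ‖X z‖ ^ 2 ∂μ := by
  have hXi : Integrable X μ := hX.integrable one_le_two
  have h1 : Integrable (fun z => inner ℝ e (X z)) μ := hXi.const_inner e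
  simp_rw [norm_add_sq_real]
  have h2 : Integrable (fun z => ‖e‖ ^ 2 + 2 * inner ℝ e (X z)) μ :=
    (integrable_const _).add (h1.const_mul _)
  rw [integral_add h2 hX.integrable_norm_pow',
    integral_add (integrable_const _) (h1.const_mul _), integral_const_mul, integral_inner hXi, h0]
  simp

theorem integral_norm_sub_integral_sq_le {Ω E : Type*} [MeasurableSpace Ω]
    [NormedAddCommGroup E] [InnerProductSpace ℝ E] [CompleteSpace E] {μ : Measure Ω}
    [IsProbabilityMeasure μ] {X : Ω → E} (hX : MemLp X 2 μ) :
    ∫ z, ‖X z - ∫ z, X z ∂μ‖ ^ 2 ∂μ ≤ ∫ z, ‖X z‖ ^ 2 ∂μ := by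
  have h := integral_norm_add_sq_of_integral_eq_zero (hX.sub (memLp_const (∫ z, X z ∂μ)))
    (by simp [integral_sub (hX.integrable one_le_two) (integrable_const _)]) (∫ z, X z ∂μ)
  simp only [Pi.sub_apply, add_sub_cancel] at h
  rw [h]
  exact le_add_of_nonneg_left (sq_nonneg _)

/-- Mean square of `(1 - β) e` plus a combination of two centred variables. -/
theorem integral_norm_sq_convex_comb_le {Ω E : Type*} [MeasurableSpace Ω]
    [NormedAddCommGroup E] [InnerProductSpace ℝ E] [CompleteSpace E] {μ : Measure Ω}
    [IsProbabilityMeasure μ] {X Y : Ω → E} (hX : MemLp X 2 μ) (hY : MemLp Y 2 μ) {β : ℝ}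
    (hβ : 0 ≤ β) (hβ' : β ≤ 1) (e : E) :
    Integrable (fun z => ‖(1 - β) • e + (β • (X z - ∫ z, X z ∂μ) +
      (1 - β) • (Y z - ∫ z, Y z ∂μ))‖ ^ 2) μ ∧
    ∫ z, ‖(1 - β) • e + (β • (X z - ∫ z, X z ∂μ) + (1 - β) • (Y z - ∫ z, Y z ∂μ))‖ ^ 2 ∂μ ≤
      (1 - β) * ‖e‖ ^ 2 + 2 * β ^ 2 * ∫ z, ‖X z‖ ^ 2 ∂μ + 2 * ∫ z, ‖Y z‖ ^ 2 ∂μ := by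
  have hX₁ : MemLp (fun z => X z - ∫ z, X z ∂μ) 2 μ := hX.sub (memLp_const _)
  have hY₁ : MemLp (fun z => Y z - ∫ z, Y z ∂μ) 2 μ := hY.sub (memLp_const _)
  have hvX := integral_norm_sub_integral_sq_le hX
  have hvY := integral_norm_sub_integral_sq_le hY
  have hX0 : ∫ z, (X z - ∫ z, X z ∂μ) ∂μ = 0 := by
    rw [integral_sub (hX.integrable one_le_two) (integrable_const _)]; simp
  have hY0 : ∫ z, (Y z - ∫ z, Y z ∂μ) ∂μ = 0 := by
    rw [integral_sub (hY.integrable one_le_two) (integrable_const _)]; simp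
  generalize ∫ z, X z ∂μ = x₀ at *
  generalize ∫ z, Y z ∂μ = y₀ at *
  have hS : MemLp (fun z => β • (X z - x₀) + (1 - β) • (Y z - y₀)) 2 μ :=
    (hX₁.const_smul β).add (hY₁.const_smul (1 - β))
  have hS0 : ∫ z, (β • (X z - x₀) + (1 - β) • (Y z - y₀)) ∂μ = 0 := by
    have h1 : Integrable (fun z => β • (X z - x₀)) μ :=
      (hX₁.integrable one_le_two).smul β
    have h2 : Integrable (fun z => (1 - β) • (Y z - y₀)) μ :=
      (hY₁.integrable one_le_two).smul (1 - β)
    rw [integral_add h1 h2, integral_smul, integral_smul, hX0, hY0, smul_zero, smul_zero, add_zero]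
  refine ⟨((memLp_const ((1 - β) • e)).add hS).integrable_norm_pow', ?_⟩
  rw [integral_norm_add_sq_of_integral_eq_zero hS hS0]
  have hXn : Integrable (fun z => ‖X z - x₀‖ ^ 2) μ := hX₁.integrable_norm_pow'
  have hYn : Integrable (fun z => ‖Y z - y₀‖ ^ 2) μ := hY₁.integrable_norm_pow'
  have hSle : ∫ z, ‖β • (X z - x₀) + (1 - β) • (Y z - y₀)‖ ^ 2 ∂μ ≤
      2 * β ^ 2 * ∫ z, ‖X z - x₀‖ ^ 2 ∂μ + 2 * (1 - β) ^ 2 * ∫ z, ‖Y z - y₀‖ ^ 2 ∂μ := by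
    rw [← integral_const_mul, ← integral_const_mul, ← integral_add (hXn.const_mul _)
      (hYn.const_mul _)]
    refine integral_mono hS.integrable_norm_pow' ((hXn.const_mul _).add (hYn.const_mul _))
      fun z => ?_
    refine (pow_le_pow_left₀ (norm_nonneg _) (norm_add_le _ _) 2).trans
      (add_sq_le.trans (le_of_eq ?_))
    rw [norm_smul, norm_smul, mul_pow, mul_pow, Real.norm_eq_abs, Real.norm_eq_abs, sq_abs, sq_abs]
    ring
  rw [norm_smul, mul_pow, Real.norm_eq_abs, sq_abs]
  have hb1 : (1 - β) ^ 2 ≤ 1 - β := by nlinarith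
  have hb2 : (1 - β) ^ 2 ≤ 1 := by nlinarith
  have i1 := mul_le_mul_of_nonneg_right hb1 (sq_nonneg ‖e‖)
  have i2 := mul_le_mul_of_nonneg_left hvX (by positivity : 0 ≤ 2 * β ^ 2)
  have i3 : 0 ≤ ∫ z, ‖Y z - y₀‖ ^ 2 ∂μ := integral_nonneg fun z => sq_nonneg _
  have i4 := mul_le_mul_of_nonneg_right hb2 i3
  linarith

namespace ISMBPG

namespace Input

variable {d : ℕ} {Z : Type*} [MeasurableSpace Z] {a : Input d Z} {J : Param d → ℝ}
  {G L Bsq σ : ℝ}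

theorem IsOracle.memLp_grad (h : a.IsOracle J G L Bsq σ) (θ' θ : Param d) :
    MemLp (fun z => a.grad z θ') 2 (a.law θ) := by
  have := h.prob θ
  exact MemLp.of_bound (h.measurable_grad_fixed θ').aestronglyMeasurable G
    (ae_of_all _ fun z => h.norm_grad_le z θ')

theorem IsOracle.memLp_weight_smul_grad (h : a.IsOracle J G L Bsq σ) (θ' θ : Param d) :
    MemLp (fun z => a.weight z θ' θ • a.grad z θ') 2 (a.law θ) := by
  have := h.prob θ
  refine ((h.memLp_weight θ' θ).norm.const_mul G).mono
    ((h.memLp_weight θ' θ).aestronglyMeasurable.smul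
      (h.measurable_grad_fixed θ').aestronglyMeasurable) (ae_of_all _ fun z => ?_)
  have hG : 0 ≤ G := (norm_nonneg _).trans (h.norm_grad_le z θ')
  rw [norm_smul, norm_mul, norm_norm, mul_comm, Real.norm_of_nonneg hG]
  gcongr
  exact h.norm_grad_le z θ'

/-- The new error is the contracted old error plus a centred term made of a stochastic gradient
with weight `β` and a correction with weight `1 - β`. -/
theorem IsOracle.error_sq_le (h : a.IsOracle J G L Bsq σ) (x : Memory d)
    (hβ : 0 ≤ x.βNext) (hβ' : x.βNext ≤ 1) :
    Integrable (fun z => ‖(a.nextStep x z).u - gradient J x.θNext‖ ^ 2) (a.law x.θNext) ∧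
    ∫ z, ‖(a.nextStep x z).u - gradient J x.θNext‖ ^ 2 ∂(a.law x.θNext) ≤
      (1 - x.βNext) * ‖x.u - gradient J x.θ‖ ^ 2 +
        2 * x.βNext ^ 2 * ∫ z, ‖a.grad z x.θNext‖ ^ 2 ∂(a.law x.θNext) +
        4 * Bsq * ‖x.θNext - x.θ‖ ^ 2 := by
  have := h.prob x.θNext
  have hg := h.memLp_grad x.θNext x.θNext
  have hwg := h.memLp_weight_smul_grad x.θ x.θNext
  have hY : MemLp (fun z => a.grad z x.θNext - a.weight z x.θ x.θNext • a.grad z x.θ) 2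
      (a.law x.θNext) := hg.sub hwg
  have hYi : ∫ z, (a.grad z x.θNext - a.weight z x.θ x.θNext • a.grad z x.θ) ∂(a.law x.θNext) =
      gradient J x.θNext - gradient J x.θ := by
    rw [integral_sub (hg.integrable one_le_two) (hwg.integrable one_le_two), h.integral_grad,
      h.integral_weight_smul_grad]
  obtain ⟨hi, hle⟩ := integral_norm_sq_convex_comb_le hg hY hβ hβ' (x.u - gradient J x.θ)
  rw [hYi, h.integral_grad] at hi hle
  have hdec : ∀ z, (a.nextStep x z).u - gradient J x.θNext =
      (1 - x.βNext) • (x.u - gradient J x.θ) +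
        (x.βNext • (a.grad z x.θNext - gradient J x.θNext) +
        (1 - x.βNext) • ((a.grad z x.θNext - a.weight z x.θ x.θNext • a.grad z x.θ) -
          (gradient J x.θNext - gradient J x.θ))) := by
    intro z
    simp only [nextStep, finish]
    module
  simp_rw [hdec]
  refine ⟨hi, hle.trans ?_⟩
  have := h.integral_correction_sq_le x.θ x.θNext
  rw [norm_sub_rev x.θNext x.θ]
  linarith

end Input

end ISMBPG

/-! ### The Lyapunov function -/

namespace ISMBPG

namespace Input

variable {d : ℕ} {Z : Type*} [MeasurableSpace Z]

/-- The potential that decreases in expectation along a run: the weighted squared estimation error,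
the optimality gap, and a logarithm of `∑ G_i²` that pays for the noise of the next samples.
The weight of the error is a lower bound for the inverse of the previous step size that can be
read off the current memory. `Jsup` and `Λ` are upper bounds that make it nonnegative. -/
def lyapunov (a : Input d Z) (J : Param d → ℝ) (G L Bsq Jsup Λ : ℝ) (x : Memory d) : ℝ :=
  1 / (128 * Bsq) * ‖x.u - gradient J x.θ‖ ^ 2 *
      (1 / a.stepSize x.sumSq - G ^ 2 / (3 * a.k ^ 3 * L) * a.stepSize x.sumSq) +
    (Jsup - J x.θ) + a.c ^ 2 * a.k ^ 3 / (64 * Bsq) * (Λ - Real.log (G ^ 2 + x.sumSq))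

variable {a : Input d Z} {J : Param d → ℝ} {G L Bsq σ Jsup Λ : ℝ}

theorem IsTuned.lyapunov_nonneg (ht : a.IsTuned G L Bsq) (hJ : ∀ θ, J θ ≤ Jsup) {x : Memory d}
    (hx : 0 ≤ x.sumSq) (hΛ : Real.log (G ^ 2 + x.sumSq) ≤ Λ) :
    0 ≤ lyapunov a J G L Bsq Jsup Λ x := by
  have hB := ht.Bsq_pos
  have hk := ht.k_pos
  have hη := ht.stepSize_pos hx
  have h1 : G ^ 2 / (3 * a.k ^ 3 * L) * a.stepSize x.sumSq ≤ 1 / a.stepSize x.sumSq := by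
    rw [le_div_iff₀ hη]
    have h2 := ht.momentum_le_one hx
    rw [ht.c_eq] at h2
    nlinarith [sq_nonneg (a.stepSize x.sumSq)]
  have h3 := hJ x.θ
  refine add_nonneg (add_nonneg (mul_nonneg (by positivity) (by linarith)) (by linarith))
    (mul_nonneg (by positivity) (by linarith))

theorem IsOracle.lyapunov_step (h : a.IsOracle J G L Bsq σ) (ht : a.IsTuned G L Bsq)
    (hJ : ∀ θ, J θ ≤ Jsup) {x : Memory d} (hx : 0 ≤ x.sumSq)
    (hθ : x.θNext = x.θ + a.stepSize x.sumSq • x.u) (hβ : x.βNext = a.c * a.stepSize x.sumSq ^ 2)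
    (hΛ : Real.log (G ^ 2 + (x.sumSq + G ^ 2)) ≤ Λ) :
    ∫⁻ z, ENNReal.ofReal (lyapunov a J G L Bsq Jsup Λ (a.nextStep x z)) ∂(a.law x.θNext) +
      ENNReal.ofReal (a.stepSize x.sumSq / 16 * ‖gradient J x.θ‖ ^ 2) ≤
    ENNReal.ofReal (lyapunov a J G L Bsq Jsup Λ x) := by
  have := h.prob x.θNext
  have hB := ht.Bsq_pos
  have hL := ht.L_pos
  have hk := ht.k_pos
  have hc := ht.c_pos
  have hG := ht.G_pos
  have hβ0 : 0 ≤ x.βNext := by rw [hβ]; positivity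
  have hβ1 : x.βNext ≤ 1 := by rw [hβ]; exact ht.momentum_le_one hx
  obtain ⟨hei, hele⟩ := h.error_sq_le x hβ0 hβ1
  have hη := ht.stepSize_pos hx
  have hηL := ht.two_mul_stepSize_le hx
  have hgi := h.integrable_grad_sq x.θNext x.θNext
  have hg : ∀ z, ‖a.grad z x.θNext‖ ^ 2 ≤ G ^ 2 := fun z =>
    pow_le_pow_left₀ (norm_nonneg _) (h.norm_grad_le z _) 2
  set η := a.stepSize x.sumSq with hηdef
  -- an upper bound for the new potential whose expectation is explicit
  set F : Z → ℝ := fun z => 1 / (128 * Bsq * η) *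
      ‖(a.nextStep x z).u - gradient J x.θNext‖ ^ 2 - a.c ^ 2 * η ^ 3 / (64 * Bsq) *
      ‖a.grad z x.θNext‖ ^ 2 + ((Jsup - J x.θNext) +
      a.c ^ 2 * a.k ^ 3 / (64 * Bsq) * (Λ - Real.log (G ^ 2 + x.sumSq))) with hF
  have hlog : ∀ z, Real.log (G ^ 2 + (x.sumSq + ‖a.grad z x.θNext‖ ^ 2)) ≤ Λ := fun z =>
    (Real.log_le_log (by positivity) (by linarith [hg z])).trans hΛ
  have hnonneg : ∀ z, 0 ≤ lyapunov a J G L Bsq Jsup Λ (a.nextStep x z) := fun z =>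
    ht.lyapunov_nonneg hJ (add_nonneg hx (sq_nonneg _)) (hlog z)
  have hle : ∀ z, lyapunov a J G L Bsq Jsup Λ (a.nextStep x z) ≤ F z := by
    intro z
    have h1 := ht.inv_stepSize_sub_le hx (sq_nonneg ‖a.grad z x.θNext‖) (hg z)
    have h2 := ht.stepSize_pow_three_mul_le hx (sq_nonneg ‖a.grad z x.θNext‖) (hg z)
    have h3 := mul_le_mul_of_nonneg_left h1
      (by positivity : 0 ≤ 1 / (128 * Bsq) * ‖(a.nextStep x z).u - gradient J x.θNext‖ ^ 2)
    have h4 := mul_le_mul_of_nonneg_left h2 (by positivity : 0 ≤ a.c ^ 2 / (64 * Bsq))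
    have e1 : 1 / (128 * Bsq) * ‖(a.nextStep x z).u - gradient J x.θNext‖ ^ 2 * (1 / η) =
        1 / (128 * Bsq * η) * ‖(a.nextStep x z).u - gradient J x.θNext‖ ^ 2 := by
      field_simp
    rw [← hηdef] at h3 h4
    rw [e1] at h3
    have e2 : (a.nextStep x z).θ = x.θNext := rfl
    have e3 : (a.nextStep x z).sumSq = x.sumSq + ‖a.grad z x.θNext‖ ^ 2 := rfl
    simp only [lyapunov, hF, e2, e3]
    have e4 : ∀ y : ℝ, a.c ^ 2 / (64 * Bsq) * (a.k ^ 3 * y) =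
        a.c ^ 2 * a.k ^ 3 / (64 * Bsq) * y := fun y => by ring
    have e5 : a.c ^ 2 / (64 * Bsq) * (η ^ 3 * ‖a.grad z x.θNext‖ ^ 2) =
        a.c ^ 2 * η ^ 3 / (64 * Bsq) * ‖a.grad z x.θNext‖ ^ 2 := by ring
    rw [e4, e5] at h4
    linarith
  have hFi : Integrable F (a.law x.θNext) :=
    ((hei.const_mul _).sub (hgi.const_mul _)).add (integrable_const _)
  have hmain : ∫ z, F z ∂(a.law x.θNext) + η / 16 * ‖gradient J x.θ‖ ^ 2 ≤
      lyapunov a J G L Bsq Jsup Λ x := by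
    have hint : ∫ z, F z ∂(a.law x.θNext) = 1 / (128 * Bsq * η) *
        (∫ z, ‖(a.nextStep x z).u - gradient J x.θNext‖ ^ 2 ∂(a.law x.θNext)) -
        a.c ^ 2 * η ^ 3 / (64 * Bsq) * (∫ z, ‖a.grad z x.θNext‖ ^ 2 ∂(a.law x.θNext)) +
        ((Jsup - J x.θNext) +
          a.c ^ 2 * a.k ^ 3 / (64 * Bsq) * (Λ - Real.log (G ^ 2 + x.sumSq))) := by
      have i1 : Integrable (fun z => 1 / (128 * Bsq * η) *
          ‖(a.nextStep x z).u - gradient J x.θNext‖ ^ 2 - a.c ^ 2 * η ^ 3 / (64 * Bsq) *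
          ‖a.grad z x.θNext‖ ^ 2) (a.law x.θNext) := (hei.const_mul _).sub (hgi.const_mul _)
      rw [hF, integral_add i1 (integrable_const _),
        integral_sub (hei.const_mul _) (hgi.const_mul _), integral_const, probReal_univ, one_smul,
        integral_const_mul, integral_const_mul]
    have hdesc := descent_of_lipschitz_gradient h.differentiable h.norm_gradient_sub_le x.θ
      (η • x.u)
    rw [← hθ, norm_smul, mul_pow, Real.norm_of_nonneg hη.le, inner_smul_right] at hdesc
    have hstep : ‖x.θNext - x.θ‖ ^ 2 = η ^ 2 * ‖x.u‖ ^ 2 := by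
      rw [hθ, add_sub_cancel_left, norm_smul, mul_pow, Real.norm_of_nonneg hη.le]
    have herr : ‖x.u - gradient J x.θ‖ ^ 2 =
        ‖x.u‖ ^ 2 - 2 * inner ℝ (gradient J x.θ) x.u + ‖gradient J x.θ‖ ^ 2 := by
      rw [norm_sub_sq_real, real_inner_comm]
    have hu : ‖x.u‖ ^ 2 ≤ 2 * ‖x.u - gradient J x.θ‖ ^ 2 + 2 * ‖gradient J x.θ‖ ^ 2 := by
      have := pow_le_pow_left₀ (norm_nonneg _)
        (norm_add_le (x.u - gradient J x.θ) (gradient J x.θ)) 2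
      rw [sub_add_cancel] at this
      exact (this.trans add_sq_le).trans (le_of_eq (by ring))
    rw [hint]
    have hA := mul_le_mul_of_nonneg_left hele (by positivity : 0 ≤ 1 / (128 * Bsq * η))
    rw [hstep, hβ] at hA
    simp only [lyapunov]
    rw [← hηdef]
    generalize ∫ z, ‖(a.nextStep x z).u - gradient J x.θNext‖ ^ 2 ∂(a.law x.θNext) = I at *
    generalize ∫ z, ‖a.grad z x.θNext‖ ^ 2 ∂(a.law x.θNext) = Γ at *
    generalize a.c ^ 2 * a.k ^ 3 / (64 * Bsq) * (Λ - Real.log (G ^ 2 + x.sumSq)) = l at *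
    generalize inner ℝ (gradient J x.θ) x.u = p at *
    have hE0 : 0 ≤ ‖x.u - gradient J x.θ‖ ^ 2 := sq_nonneg _
    have hU0 : 0 ≤ ‖x.u‖ ^ 2 := sq_nonneg _
    have hN0 : 0 ≤ ‖gradient J x.θ‖ ^ 2 := sq_nonneg _
    generalize ‖x.u - gradient J x.θ‖ ^ 2 = E at *
    generalize ‖x.u‖ ^ 2 = U at *
    generalize ‖gradient J x.θ‖ ^ 2 = N at *
    have e1 : 1 / (128 * Bsq * η) * ((1 - a.c * η ^ 2) * E + 2 * (a.c * η ^ 2) ^ 2 * Γ +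
        4 * Bsq * (η ^ 2 * U)) =
        1 / (128 * Bsq) * E * (1 / η) - a.c / (128 * Bsq) * (η * E) +
          a.c ^ 2 * η ^ 3 / (64 * Bsq) * Γ + η * U / 32 := by
      field_simp
      ring
    have e2 : a.c / (128 * Bsq) =
        1 / (128 * Bsq) * (G ^ 2 / (3 * a.k ^ 3 * L)) + 13 / 16 := by
      rw [ht.c_eq]
      field_simp
      ring
    rw [e1, e2] at hA
    have hηU : η * U ≤ 2 * (η * E) + 2 * (η * N) := by
      have := mul_le_mul_of_nonneg_left hu hη.le
      linarith
    have hηU' : 2 * L * η * (η * U) ≤ 1 * (η * U) :=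
      mul_le_mul_of_nonneg_right hηL (by positivity)
    have hηp : 2 * (η * p) = η * U + η * N - η * E := by
      rw [herr]; ring
    have hηE : 0 ≤ η * E := by positivity
    have hηN : 0 ≤ η * N := by positivity
    linarith
  calc _ ≤ ENNReal.ofReal (∫ z, F z ∂(a.law x.θNext)) +
        ENNReal.ofReal (η / 16 * ‖gradient J x.θ‖ ^ 2) := by
        gcongr
        rw [ofReal_integral_eq_lintegral_ofReal hFi
          (ae_of_all _ fun z => (hnonneg z).trans (hle z))]
        exact lintegral_mono fun z => ENNReal.ofReal_le_ofReal (hle z)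
    _ = ENNReal.ofReal (∫ z, F z ∂(a.law x.θNext) + η / 16 * ‖gradient J x.θ‖ ^ 2) :=
        (ENNReal.ofReal_add (integral_nonneg fun z => (hnonneg z).trans (hle z))
          (by positivity)).symm
    _ ≤ _ := ENNReal.ofReal_le_ofReal hmain

theorem IsOracle.measurable_lyapunov (h : a.IsOracle J G L Bsq σ) (n : ℕ) :
    Measurable fun τ => lyapunov a J G L Bsq Jsup Λ (a.memory n τ) := by
  obtain ⟨hθ, hu, hs, -, -⟩ := h.measurable_memory n
  have hη : Measurable fun τ => a.stepSize (a.memory n τ).sumSq :=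
    ((hs.const_add a.m).pow_const (1 / 3 : ℝ)).const_div a.k
  have hgr := h.continuous_gradient.measurable.fun_comp hθ
  have hJ := h.differentiable.continuous.measurable.fun_comp hθ
  exact ((((hu.sub hgr).norm.pow_const 2).const_mul _).mul
    ((hη.const_div 1).sub (hη.const_mul _))).add (hJ.const_sub _) |>.add
    (((hs.const_add _).log.const_sub _).const_mul _)

theorem IsOracle.measurable_dissipation (h : a.IsOracle J G L Bsq σ) (n : ℕ) :
    Measurable fun τ => a.stepSize (a.memory n τ).sumSq * ‖gradient J (a.memory n τ).θ‖ ^ 2 := by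
  obtain ⟨hθ, -, hs, -, -⟩ := h.measurable_memory n
  exact (((hs.const_add a.m).pow_const (1 / 3 : ℝ)).const_div a.k).mul
    ((h.continuous_gradient.measurable.fun_comp hθ).norm.pow_const 2)

theorem IsOracle.lintegral_lyapunov_zero_le (h : a.IsOracle J G L Bsq σ)
    (ht : a.IsTuned G L Bsq) (hJ : ∀ θ, J θ ≤ Jsup) (hΛ : Real.log (G ^ 2) ≤ Λ) :
    ∫⁻ τ, ENNReal.ofReal (lyapunov a J G L Bsq Jsup Λ (a.memory 0 τ)) ∂(a.runLaw 1) ≤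
      ENNReal.ofReal (1 / (128 * Bsq) * (a.m ^ (1 / 3 : ℝ) / a.k) * σ ^ 2 + (Jsup - J a.θ₁) +
        a.c ^ 2 * a.k ^ 3 / (64 * Bsq) * (Λ - Real.log (G ^ 2))) := by
  have := h.prob a.θ₁
  have hB := ht.Bsq_pos
  have hk := ht.k_pos
  have hm := ht.m_pos
  have hG := ht.G_pos
  have hei : Integrable (fun z => ‖a.grad z a.θ₁ - gradient J a.θ₁‖ ^ 2) (a.law a.θ₁) :=
    ((h.memLp_grad a.θ₁ a.θ₁).sub (memLp_const _)).integrable_norm_pow'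
  have hJ1 : 0 ≤ Jsup - J a.θ₁ := sub_nonneg.2 (hJ _)
  have hl : 0 ≤ Λ - Real.log (G ^ 2) := sub_nonneg.2 hΛ
  have hle : ∀ z, lyapunov a J G L Bsq Jsup Λ (a.firstStep z) ≤
      1 / (128 * Bsq) * (a.m ^ (1 / 3 : ℝ) / a.k) * ‖a.grad z a.θ₁ - gradient J a.θ₁‖ ^ 2 +
      ((Jsup - J a.θ₁) + a.c ^ 2 * a.k ^ 3 / (64 * Bsq) * (Λ - Real.log (G ^ 2))) := by
    intro z
    have h1 := ht.inv_stepSize_sub_le le_rfl (sq_nonneg ‖a.grad z a.θ₁‖)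
      (pow_le_pow_left₀ (norm_nonneg _) (h.norm_grad_le z a.θ₁) 2)
    rw [zero_add] at h1
    have h2 : 1 / a.stepSize 0 = a.m ^ (1 / 3 : ℝ) / a.k := by
      rw [stepSize, add_zero, one_div_div]
    have h3 := mul_le_mul_of_nonneg_left (h1.trans_eq h2)
      (by positivity : 0 ≤ 1 / (128 * Bsq) * ‖a.grad z a.θ₁ - gradient J a.θ₁‖ ^ 2)
    have h4 : Real.log (G ^ 2) ≤ Real.log (G ^ 2 + ‖a.grad z a.θ₁‖ ^ 2) :=
      Real.log_le_log (by positivity) (by linarith [sq_nonneg ‖a.grad z a.θ₁‖])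
    have h5 := mul_le_mul_of_nonneg_left h4
      (by positivity : 0 ≤ a.c ^ 2 * a.k ^ 3 / (64 * Bsq))
    simp only [lyapunov, firstStep, finish]
    linarith
  have hmeas : Measurable fun τ : Fin 1 → Z =>
      ENNReal.ofReal (lyapunov a J G L Bsq Jsup Λ (a.memory 0 τ)) :=
    (h.measurable_lyapunov 0).ennreal_ofReal
  rw [h.lintegral_runLaw_succ 0 hmeas]
  have hdirac : a.runLaw 0 = Measure.dirac Fin.elim0 := rfl
  have hlast : ∀ (τ : Fin 0 → Z) z, a.memory 0 (Fin.snoc (α := fun _ => Z) τ z) =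
      a.firstStep z := fun τ z => rfl
  have hit : ∀ τ : Fin 0 → Z, a.iterate 0 τ = a.θ₁ := fun _ => rfl
  simp only [hlast, hit]
  rw [hdirac, lintegral_const, measure_univ, mul_one]
  refine (lintegral_mono fun z => ENNReal.ofReal_le_ofReal (hle z)).trans ?_
  have hbi : Integrable (fun z => 1 / (128 * Bsq) * (a.m ^ (1 / 3 : ℝ) / a.k) *
      ‖a.grad z a.θ₁ - gradient J a.θ₁‖ ^ 2 + ((Jsup - J a.θ₁) +
      a.c ^ 2 * a.k ^ 3 / (64 * Bsq) * (Λ - Real.log (G ^ 2)))) (a.law a.θ₁) :=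
    (hei.const_mul _).add (integrable_const _)
  rw [← ofReal_integral_eq_lintegral_ofReal hbi (ae_of_all _ fun z => by positivity)]
  refine ENNReal.ofReal_le_ofReal ?_
  rw [integral_add (hei.const_mul _) (integrable_const _), integral_const_mul, integral_const,
    probReal_univ, one_smul, add_assoc]
  gcongr
  exact h.variance_le _

/-- Telescoping the potential along a run. -/
theorem IsOracle.sum_lintegral_dissipation_le (h : a.IsOracle J G L Bsq σ)
    (ht : a.IsTuned G L Bsq) (hJ : ∀ θ, J θ ≤ Jsup) (N : ℕ)
    (hΛ : Real.log ((N + 3) * G ^ 2) ≤ Λ) :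
    ∑ n ∈ Finset.range (N + 1), ∫⁻ τ, ENNReal.ofReal
        (a.stepSize (a.memory n τ).sumSq / 16 * ‖gradient J (a.memory n τ).θ‖ ^ 2)
        ∂(a.runLaw (n + 1)) +
      ∫⁻ τ, ENNReal.ofReal (lyapunov a J G L Bsq Jsup Λ (a.memory (N + 1) τ))
        ∂(a.runLaw (N + 2)) ≤
    ∫⁻ τ, ENNReal.ofReal (lyapunov a J G L Bsq Jsup Λ (a.memory 0 τ)) ∂(a.runLaw 1) := by
  have hG := ht.G_pos
  have hstep : ∀ n : ℕ, Real.log ((n + 3) * G ^ 2) ≤ Λ →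
      ∫⁻ τ, ENNReal.ofReal
        (a.stepSize (a.memory n τ).sumSq / 16 * ‖gradient J (a.memory n τ).θ‖ ^ 2)
        ∂(a.runLaw (n + 1)) +
      ∫⁻ τ, ENNReal.ofReal (lyapunov a J G L Bsq Jsup Λ (a.memory (n + 1) τ))
        ∂(a.runLaw (n + 2)) ≤
      ∫⁻ τ, ENNReal.ofReal (lyapunov a J G L Bsq Jsup Λ (a.memory n τ)) ∂(a.runLaw (n + 1)) := by
    intro n hn
    have hd : Measurable fun τ => ENNReal.ofReal
        (a.stepSize (a.memory n τ).sumSq / 16 * ‖gradient J (a.memory n τ).θ‖ ^ 2) := by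
      simp_rw [div_mul_eq_mul_div]
      exact ((h.measurable_dissipation n).div_const _).ennreal_ofReal
    rw [h.lintegral_runLaw_succ (n + 1) (h.measurable_lyapunov (n + 1)).ennreal_ofReal,
      ← lintegral_add_left hd]
    refine lintegral_mono fun τ => ?_
    simp only [memory_snoc]
    refine (add_comm _ _).trans_le (h.lyapunov_step ht hJ (sumSq_nonneg n τ) (memory_θNext n τ) (memory_βNext n τ)
      (le_trans (Real.log_le_log ?_ ?_) hn))
    · have := sumSq_nonneg (a := a) n τ
      positivity
    · have := h.sumSq_le n τ
      linarith
  induction N with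
  | zero => simpa using hstep 0 hΛ
  | succ N ih =>
    have hN : Real.log ((N + 3) * G ^ 2) ≤ Λ :=
      (Real.log_le_log (by positivity) (by push_cast; gcongr; linarith)).trans hΛ
    rw [Finset.sum_range_succ, add_assoc]
    exact (add_le_add_right (hstep (N + 1) (by exact_mod_cast hΛ)) _).trans (ih hN)

end Input

end ISMBPG

/-! ### From the weighted sum of squared gradients to the convergence rate -/

theorem integral_rpow_le_rpow_integral {Ω : Type*} [MeasurableSpace Ω] {P : Measure Ω}
    [IsProbabilityMeasure P] {f : Ω → ℝ} (hf : Measurable f) {K : ℝ} (h0 : ∀ ω, 0 ≤ f ω)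
    (hK : ∀ ω, f ω ≤ K) {p : ℝ} (hp0 : 0 ≤ p) (hp1 : p ≤ 1) :
    ∫ ω, f ω ^ p ∂P ≤ (∫ ω, f ω ∂P) ^ p := by
  refine ConcaveOn.le_map_integral (g := fun x : ℝ => x ^ p) (s := Set.Ici 0)
    (Real.concaveOn_rpow hp0 hp1)
    (Real.continuous_rpow_const hp0).continuousOn isClosed_Ici (ae_of_all _ h0) ?_ ?_
  · exact Integrable.of_bound hf.aestronglyMeasurable K
      (ae_of_all _ fun ω => by rw [Real.norm_of_nonneg (h0 ω)]; exact hK ω)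
  · refine Integrable.of_bound (hf.pow_const p).aestronglyMeasurable (K ^ p)
      (ae_of_all _ fun ω => ?_)
    rw [Function.comp_apply, Real.norm_of_nonneg (Real.rpow_nonneg (h0 ω) _)]
    exact Real.rpow_le_rpow (h0 ω) (hK ω) hp0

/-- Solving the self-bounding inequality for `x`: either the terms `M² + 2^{1/3} v²` or the term
`2^{1/3} x^{2/3}` make up at least half of the bracket. -/
theorem le_of_sq_le_self_bounding {x O M v : ℝ} (hx : 0 ≤ x) (hO : 0 ≤ O) (hM : 0 ≤ M)
    (hv : 0 ≤ v)
    (h : x ^ 2 ≤ O * (M ^ 2 + 2 ^ (1 / 3 : ℝ) * v ^ 2 + 2 ^ (1 / 3 : ℝ) * x ^ (2 / 3 : ℝ))) :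
    x ≤ Real.sqrt (2 * O) * M + 2 * O ^ (3 / 4 : ℝ) + 2 * Real.sqrt O * v := by
  have hr3 : ((2 : ℝ) ^ (1 / 3 : ℝ)) ^ 3 = 2 := by
    rw [← Real.rpow_natCast, ← Real.rpow_mul (by norm_num)]; norm_num
  have hr0 : 0 < (2 : ℝ) ^ (1 / 3 : ℝ) := Real.rpow_pos_of_pos two_pos _
  generalize (2 : ℝ) ^ (1 / 3 : ℝ) = r at *
  have hr2 : r ≤ 2 := by
    by_contra! hcon
    nlinarith [mul_pos hr0 hr0, sq_nonneg (r - 2)]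
  have hs1 : Real.sqrt (2 * O) ^ 2 = 2 * O := Real.sq_sqrt (by positivity)
  have hs2 : Real.sqrt O ^ 2 = O := Real.sq_sqrt hO
  have hO4 : (O ^ (3 / 4 : ℝ)) ^ 4 = O ^ 3 := by
    rw [← Real.rpow_natCast, ← Real.rpow_mul hO, ← Real.rpow_natCast]; norm_num
  have hO40 : 0 ≤ O ^ (3 / 4 : ℝ) := Real.rpow_nonneg hO _
  generalize O ^ (3 / 4 : ℝ) = o at *
  have hp1 : 0 ≤ Real.sqrt (2 * O) * M := by positivity
  have hp2 : 0 ≤ 2 * Real.sqrt O * v := by positivity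
  rcases le_total (r * x ^ (2 / 3 : ℝ)) (M ^ 2 + r * v ^ 2) with hc | hc
  · -- the noise terms dominate
    have h1 : x ^ 2 ≤ 2 * O * M ^ 2 + 4 * O * v ^ 2 := by
      have i1 := mul_le_mul_of_nonneg_left hc hO
      have i2 := mul_le_mul_of_nonneg_right hr2 (by positivity : 0 ≤ 2 * (O * v ^ 2))
      nlinarith
    have h2 : x ^ 2 ≤ (Real.sqrt (2 * O) * M + 2 * Real.sqrt O * v) ^ 2 := by
      have e : (Real.sqrt (2 * O) * M + 2 * Real.sqrt O * v) ^ 2 =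
          Real.sqrt (2 * O) ^ 2 * M ^ 2 + 4 * Real.sqrt O ^ 2 * v ^ 2 +
            2 * (Real.sqrt (2 * O) * M) * (2 * Real.sqrt O * v) := by ring
      rw [e, hs1, hs2]
      have := mul_nonneg hp1 hp2
      linarith
    have h3 := le_of_pow_le_pow_left₀ two_ne_zero (add_nonneg hp1 hp2) h2
    linarith
  · -- the gradients dominate
    have hz : 0 ≤ x ^ (1 / 3 : ℝ) := Real.rpow_nonneg hx _
    have e1 : x = (x ^ (1 / 3 : ℝ)) ^ 3 := by
      rw [← Real.rpow_natCast, ← Real.rpow_mul hx]; norm_num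
    have e2 : x ^ (2 / 3 : ℝ) = (x ^ (1 / 3 : ℝ)) ^ 2 := by
      rw [← Real.rpow_natCast, ← Real.rpow_mul hx]; norm_num
    rw [e2] at h hc
    generalize x ^ (1 / 3 : ℝ) = z at *
    have h1 : x ^ 2 ≤ 2 * O * (r * z ^ 2) := by
      have := mul_le_mul_of_nonneg_left hc hO
      linarith
    have h2 : x ≤ 2 * o := by
      rcases hz.eq_or_lt with hz0 | hz0
      · rw [e1, ← hz0]; simpa using hO40
      have h4 : z ^ 4 ≤ 2 * r * O := by
        refine le_of_mul_le_mul_right ?_ (pow_pos hz0 2)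
        rw [e1] at h1
        nlinarith
      have h12 := pow_le_pow_left₀ (by positivity) h4 3
      refine le_of_pow_le_pow_left₀ four_ne_zero (by positivity) ?_
      have e3 : x ^ 4 = (z ^ 4) ^ 3 := by rw [e1]; ring
      have e4 : (2 * r * O) ^ 3 = 8 * r ^ 3 * O ^ 3 := by ring
      have e5 : (2 * o) ^ 4 = 16 * o ^ 4 := by ring
      rw [e3, e5, hO4]
      rw [e4, hr3] at h12
      linarith
    linarith

/-- If `X² ≤ D y` pointwise then `(E X)² ≤ E D · E y`; here the bound on `y` involves `X` itself. -/
theorem integral_le_of_sq_le_mul {Ω : Type*} [MeasurableSpace Ω] {P : Measure Ω}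
    [IsProbabilityMeasure P] {D y X V : Ω → ℝ} {K O M v : ℝ} (hX : Measurable X)
    (hV : Measurable V) (hD : Integrable D P) (hy : Integrable y P)
    (hD0 : ∀ ω, 0 ≤ D ω) (hy0 : ∀ ω, 0 ≤ y ω) (hX0 : ∀ ω, 0 ≤ X ω) (hV0 : ∀ ω, 0 ≤ V ω)
    (hXK : ∀ ω, X ω ≤ K) (hVK : ∀ ω, V ω ≤ K)
    (hXD : ∀ ω, X ω ^ 2 ≤ D ω * y ω)
    (hyX : ∀ ω, y ω ≤ M ^ 2 + (2 * V ω) ^ (1 / 3 : ℝ) + (2 * X ω ^ 2) ^ (1 / 3 : ℝ))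
    (hM : 0 < M) (hv : 0 ≤ v) (hO : 0 < O) (hDO : ∫ ω, D ω ∂P ≤ O)
    (hVv : (∫ ω, V ω ∂P) ^ (1 / 3 : ℝ) ≤ v ^ 2) :
    ∫ ω, X ω ∂P ≤ Real.sqrt (2 * O) * M + 2 * O ^ (3 / 4 : ℝ) + 2 * Real.sqrt O * v := by
  have hXi : Integrable X P := Integrable.of_bound hX.aestronglyMeasurable K
    (ae_of_all _ fun ω => by rw [Real.norm_of_nonneg (hX0 ω)]; exact hXK ω)
  have hV3 : Integrable (fun ω => V ω ^ (1 / 3 : ℝ)) P := by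
    refine Integrable.of_bound (hV.pow_const _).aestronglyMeasurable (K ^ (1 / 3 : ℝ))
      (ae_of_all _ fun ω => ?_)
    rw [Real.norm_of_nonneg (Real.rpow_nonneg (hV0 ω) _)]
    exact Real.rpow_le_rpow (hV0 ω) (hVK ω) (by norm_num)
  have hX3 : Integrable (fun ω => X ω ^ (2 / 3 : ℝ)) P := by
    refine Integrable.of_bound (hX.pow_const _).aestronglyMeasurable (K ^ (2 / 3 : ℝ))
      (ae_of_all _ fun ω => ?_)
    rw [Real.norm_of_nonneg (Real.rpow_nonneg (hX0 ω) _)]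
    exact Real.rpow_le_rpow (hX0 ω) (hXK ω) (by norm_num)
  have hEX0 : 0 ≤ ∫ ω, X ω ∂P := integral_nonneg hX0
  have hr0 : 0 < (2 : ℝ) ^ (1 / 3 : ℝ) := Real.rpow_pos_of_pos two_pos _
  refine le_of_sq_le_self_bounding hEX0 hO.le hM.le hv ?_
  set Y := M ^ 2 + 2 ^ (1 / 3 : ℝ) * v ^ 2 + 2 ^ (1 / 3 : ℝ) * (∫ ω, X ω ∂P) ^ (2 / 3 : ℝ) with hY
  have hY0 : 0 < Y := by
    have := Real.rpow_nonneg hEX0 (2 / 3)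
    positivity
  have hEy : ∫ ω, y ω ∂P ≤ Y := by
    calc ∫ ω, y ω ∂P ≤ ∫ ω, (M ^ 2 + 2 ^ (1 / 3 : ℝ) * V ω ^ (1 / 3 : ℝ) +
          2 ^ (1 / 3 : ℝ) * X ω ^ (2 / 3 : ℝ)) ∂P := by
          refine integral_mono hy (((integrable_const _).add (hV3.const_mul _)).add
            (hX3.const_mul _)) fun ω => (hyX ω).trans (le_of_eq ?_)
          rw [Real.mul_rpow two_pos.le (hV0 ω), Real.mul_rpow two_pos.le (sq_nonneg _),
            ← Real.rpow_natCast, ← Real.rpow_natCast (X ω), ← Real.rpow_mul (hX0 ω)]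
          norm_num
      _ = M ^ 2 + 2 ^ (1 / 3 : ℝ) * (∫ ω, V ω ^ (1 / 3 : ℝ) ∂P) +
          2 ^ (1 / 3 : ℝ) * ∫ ω, X ω ^ (2 / 3 : ℝ) ∂P := by
          have i1 : Integrable (fun ω => M ^ 2 + 2 ^ (1 / 3 : ℝ) * V ω ^ (1 / 3 : ℝ)) P :=
            (integrable_const _).add (hV3.const_mul _)
          rw [integral_add i1 (hX3.const_mul _), integral_add (integrable_const _)
            (hV3.const_mul _), integral_const, probReal_univ, one_smul, integral_const_mul,
            integral_const_mul]
      _ ≤ Y := by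
          rw [hY]
          gcongr
          · exact (integral_rpow_le_rpow_integral hV hV0 hVK (by norm_num) (by norm_num)).trans hVv
          · exact integral_rpow_le_rpow_integral hX hX0 hXK (by norm_num) (by norm_num)
  -- Cauchy–Schwarz, in the form `2 X ≤ l D + y / l` with the optimal constant `l = √(Y / O)`
  set l := Real.sqrt (Y / O) with hl
  have hl0 : 0 < l := Real.sqrt_pos.2 (div_pos hY0 hO)
  have hl2 : l ^ 2 = Y / O := Real.sq_sqrt (div_pos hY0 hO).le
  have hpt : ∀ ω, 2 * X ω ≤ l * D ω + y ω / l := by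
    intro ω
    have h0 : 0 ≤ l * D ω + y ω / l :=
      add_nonneg (mul_nonneg hl0.le (hD0 ω)) (div_nonneg (hy0 ω) hl0.le)
    refine le_of_pow_le_pow_left₀ two_ne_zero h0 ?_
    have e : (l * D ω + y ω / l) ^ 2 = (l * D ω - y ω / l) ^ 2 + 4 * (D ω * y ω) := by
      field_simp
      ring
    rw [e]
    have := hXD ω
    nlinarith [sq_nonneg (l * D ω - y ω / l)]
  have hE : 2 * ∫ ω, X ω ∂P ≤ l * O + Y / l := by
    have := integral_mono (hXi.const_mul 2) ((hD.const_mul l).add (hy.div_const l)) hpt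
    rw [integral_const_mul] at this
    refine this.trans ?_
    rw [integral_add' (hD.const_mul l) (hy.div_const l), integral_const_mul, integral_div]
    gcongr
  have e1 : Y / l = l * O := by
    rw [div_eq_iff hl0.ne']
    have : l * O * l = l ^ 2 * O := by ring
    rw [this, hl2]
    field_simp
  rw [e1] at hE
  have h2 : ∫ ω, X ω ∂P ≤ l * O := by linarith
  calc (∫ ω, X ω ∂P) ^ 2 ≤ (l * O) ^ 2 := pow_le_pow_left₀ hEX0 h2 2
    _ = O * Y := by
      rw [mul_pow, hl2]
      field_simp

namespace ISMBPG

namespace Input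

variable {d : ℕ} {Z : Type*} [MeasurableSpace Z] {a : Input d Z} {J : Param d → ℝ}
  {G L Bsq σ Jsup : ℝ}

/-- The memory at the end of iteration `i + 1` of a run. -/
def memoryOfRun (a : Input d Z) {T : ℕ} (τ : Fin T → Z) (i : Fin T) : Memory d :=
  a.memory i fun j => τ (Fin.castLE i.isLt j)

theorem memoryOfRun_θ {T : ℕ} (τ : Fin T → Z) (i : Fin T) :
    (a.memoryOfRun τ i).θ = a.iterateOfRun τ i :=
  memory_θ _ _

variable (h : a.IsOracle J G L Bsq σ) (ht : a.IsTuned G L Bsq)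
include h

theorem IsOracle.measurable_gradient_iterateOfRun {T : ℕ} (i : Fin T) :
    Measurable fun τ => gradient J (a.iterateOfRun (T := T) τ i) :=
  h.continuous_gradient.measurable.fun_comp (h.measurable_iterateOfRun i)

theorem IsOracle.integral_noise_le {T : ℕ} (i : Fin T) :
    ∫ τ, ‖a.grad (τ i) (a.iterateOfRun τ i) - gradient J (a.iterateOfRun τ i)‖ ^ 2
      ∂(a.runLaw T) ≤ σ ^ 2 := by
  have hm : Measurable fun τ : Fin ((i : ℕ) + 1) → Z =>
      ‖a.grad (τ (Fin.last _)) (a.iterate i (Fin.init τ)) -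
        gradient J (a.iterate i (Fin.init τ))‖ ^ 2 := by
    have hi := (h.measurable_iterate i).fun_comp (measurable_finInit (Z := Z) (i : ℕ))
    exact ((h.measurable_grad.fun_comp ((measurable_pi_apply (Fin.last _)).prodMk hi)).sub
      (h.continuous_gradient.measurable.fun_comp hi)).norm.pow_const 2
  have hle : (i : ℕ) + 1 ≤ T := i.isLt
  have e : ∫ τ, ‖a.grad (τ i) (a.iterateOfRun τ i) - gradient J (a.iterateOfRun τ i)‖ ^ 2
      ∂(a.runLaw T) = ∫ τ, ‖a.grad (τ (Fin.last _)) (a.iterate i (Fin.init τ)) -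
        gradient J (a.iterate i (Fin.init τ))‖ ^ 2 ∂(a.runLaw ((i : ℕ) + 1)) := by
    rw [← h.map_runLaw_castLE hle, integral_map (measurable_restrict_castLE _).aemeasurable
      hm.aestronglyMeasurable]
    rfl
  rw [e, integral_eq_lintegral_of_nonneg_ae (ae_of_all _ fun τ => sq_nonneg _)
    hm.aestronglyMeasurable, h.lintegral_runLaw_succ _ hm.ennreal_ofReal]
  refine ENNReal.toReal_le_of_le_ofReal (sq_nonneg _) ?_
  have := h.isProbabilityMeasure_runLaw i
  refine (lintegral_mono (g := fun _ => ENNReal.ofReal (σ ^ 2)) fun τ => ?_).trans (by simp)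
  have := h.prob (a.iterate i τ)
  simp only [Fin.snoc_last, Fin.init_snoc]
  have hint : Integrable (fun z => ‖a.grad z (a.iterate i τ) - gradient J (a.iterate i τ)‖ ^ 2)
      (a.law (a.iterate i τ)) :=
    ((h.memLp_grad _ _).sub (memLp_const _)).integrable_norm_pow'
  rw [← ofReal_integral_eq_lintegral_ofReal hint (ae_of_all _ fun z => sq_nonneg _)]
  exact ENNReal.ofReal_le_ofReal (h.variance_le _)

include ht

theorem IsOracle.integrable_dissipation (n : ℕ) :
    Integrable (fun τ => a.stepSize (a.memory n τ).sumSq * ‖gradient J (a.memory n τ).θ‖ ^ 2)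
      (a.runLaw (n + 1)) := by
  have := h.isProbabilityMeasure_runLaw (n + 1)
  refine Integrable.of_bound (h.measurable_dissipation n).aestronglyMeasurable
    (1 / (2 * L) * G ^ 2) (ae_of_all _ fun τ => ?_)
  have hL := ht.L_pos
  have hs := sumSq_nonneg (a := a) n τ
  have hη := ht.stepSize_pos hs
  rw [norm_mul, norm_pow, norm_norm, Real.norm_of_nonneg hη.le]
  refine mul_le_mul ?_ (pow_le_pow_left₀ (norm_nonneg _) (h.norm_gradient_le _) 2) (sq_nonneg _)
    (by positivity)
  rw [le_div_iff₀ (by positivity), mul_comm]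
  exact ht.two_mul_stepSize_le hs

/-- The terms of the dissipation depend on the first samples of a run only. -/
theorem IsOracle.map_integrable_dissipation {T : ℕ} (i : Fin T) :
    Integrable (fun τ => a.stepSize (a.memoryOfRun τ i).sumSq *
      ‖gradient J (a.iterateOfRun τ i)‖ ^ 2) (a.runLaw T) ∧
    ∫ τ, a.stepSize (a.memoryOfRun τ i).sumSq * ‖gradient J (a.iterateOfRun τ i)‖ ^ 2
      ∂(a.runLaw T) =
    ∫ τ, a.stepSize (a.memory i τ).sumSq * ‖gradient J (a.memory i τ).θ‖ ^ 2
      ∂(a.runLaw ((i : ℕ) + 1)) := by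
  have hle : (i : ℕ) + 1 ≤ T := i.isLt
  have hi := h.integrable_dissipation ht i
  simp only [← memoryOfRun_θ]
  constructor
  · rw [← h.map_runLaw_castLE hle] at hi
    exact hi.comp_measurable (measurable_restrict_castLE _)
  · conv_rhs => rw [← h.map_runLaw_castLE hle]
    rw [integral_map (measurable_restrict_castLE _).aemeasurable
      (h.measurable_dissipation i).aestronglyMeasurable]
    rfl

theorem IsOracle.sum_integral_dissipation_le (hJ : ∀ θ, J θ ≤ Jsup) (N : ℕ) :
    ∑ i : Fin (N + 1), ∫ τ, a.stepSize (a.memoryOfRun τ i).sumSq *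
        ‖gradient J (a.iterateOfRun τ i)‖ ^ 2 ∂(a.runLaw (N + 1)) ≤
      16 * (Jsup - J a.θ₁) + a.m ^ (1 / 3 : ℝ) / (8 * Bsq * a.k) * σ ^ 2 +
        a.c ^ 2 * a.k ^ 3 / (4 * Bsq) * Real.log (((N + 1 : ℕ) : ℝ) + 2) := by
  have hB := ht.Bsq_pos
  have hk := ht.k_pos
  have hm := ht.m_pos
  have hG := ht.G_pos
  have hJ1 : 0 ≤ Jsup - J a.θ₁ := sub_nonneg.2 (hJ _)
  have hN0 : (0 : ℝ) ≤ N := Nat.cast_nonneg N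
  have hlogN : 0 ≤ Real.log ((N : ℝ) + 3) := Real.log_nonneg (by linarith)
  have hlog : Real.log ((N + 3) * G ^ 2) - Real.log (G ^ 2) = Real.log ((N : ℝ) + 3) := by
    rw [Real.log_mul (by positivity) (by positivity)]; ring
  have h1 := h.sum_lintegral_dissipation_le ht hJ N (Λ := Real.log ((N + 3) * G ^ 2)) le_rfl
  have h2 := h.lintegral_lyapunov_zero_le ht hJ (Λ := Real.log ((N + 3) * G ^ 2))
    (by linarith)
  have h3 := (le_self_add.trans h1).trans h2
  rw [hlog] at h3
  have h4 : ∀ n : ℕ, ∫⁻ τ, ENNReal.ofReal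
        (a.stepSize (a.memory n τ).sumSq / 16 * ‖gradient J (a.memory n τ).θ‖ ^ 2)
        ∂(a.runLaw (n + 1)) = ENNReal.ofReal ((∫ τ, a.stepSize (a.memory n τ).sumSq *
          ‖gradient J (a.memory n τ).θ‖ ^ 2 ∂(a.runLaw (n + 1))) / 16) := by
    intro n
    simp_rw [div_mul_eq_mul_div]
    rw [← ofReal_integral_eq_lintegral_ofReal ((h.integrable_dissipation ht n).div_const _)
      (ae_of_all _ fun τ => ?_), integral_div]
    have := (ht.stepSize_pos (sumSq_nonneg (a := a) n τ)).le
    positivity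
  have hnn : ∀ n : ℕ, 0 ≤ (∫ τ, a.stepSize (a.memory n τ).sumSq *
          ‖gradient J (a.memory n τ).θ‖ ^ 2 ∂(a.runLaw (n + 1))) / 16 := fun n =>
    div_nonneg (integral_nonneg fun τ =>
      mul_nonneg (ht.stepSize_pos (sumSq_nonneg (a := a) n τ)).le (sq_nonneg _)) (by norm_num)
  simp_rw [h4] at h3
  rw [← ENNReal.ofReal_sum_of_nonneg fun n _ => hnn n, ENNReal.ofReal_le_ofReal_iff
    (by positivity), ← Finset.sum_div] at h3
  simp_rw [fun i => (h.map_integrable_dissipation ht (T := N + 1) i).2]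
  rw [Fin.sum_univ_eq_sum_range (fun n => ∫ τ, a.stepSize (a.memory n τ).sumSq *
          ‖gradient J (a.memory n τ).θ‖ ^ 2 ∂(a.runLaw (n + 1)))]
  rw [div_le_iff₀ (by norm_num)] at h3
  refine h3.trans (le_of_eq ?_)
  have : ((N + 1 : ℕ) : ℝ) + 2 = (N : ℝ) + 3 := by push_cast; ring
  rw [this]
  field_simp
  ring

/-- The averaged convergence bound. -/
theorem IsOracle.average_le (hJ : ∀ θ, J θ ≤ Jsup) (hσ : 0 ≤ σ) {T : ℕ} (hT : 1 ≤ T) {O : ℝ}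
    (hO : 0 < O) (hOeq : 16 * (Jsup - J a.θ₁) + a.m ^ (1 / 3 : ℝ) / (8 * Bsq * a.k) * σ ^ 2 +
        a.c ^ 2 * a.k ^ 3 / (4 * Bsq) * Real.log ((T : ℝ) + 2) ≤ a.k * O) :
    1 / (T : ℝ) * ∑ i : Fin T, ∫ τ, ‖gradient J (a.iterateOfRun τ i)‖ ∂(a.runLaw T) ≤
      (Real.sqrt (2 * O) * a.m ^ (1 / 6 : ℝ) + 2 * O ^ (3 / 4 : ℝ)) / Real.sqrt T +
        2 * Real.sqrt O * σ ^ (1 / 3 : ℝ) / (T : ℝ) ^ (1 / 3 : ℝ) := by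
  obtain ⟨N, rfl⟩ : ∃ N, T = N + 1 := ⟨T - 1, by omega⟩
  have hk := ht.k_pos
  have hm := ht.m_pos
  have hT0 : (0 : ℝ) < ((N + 1 : ℕ) : ℝ) := by positivity
  have := h.isProbabilityMeasure_runLaw (N + 1)
  have hdis := (h.sum_integral_dissipation_le ht hJ N).trans hOeq
  set P := a.runLaw (N + 1)
  set S : (Fin (N + 1) → Z) → ℝ := fun τ => ∑ i, ‖gradient J (a.iterateOfRun τ i)‖ ^ 2 with hS
  have hS0 : ∀ τ, 0 ≤ S τ := fun τ => Finset.sum_nonneg fun i _ => sq_nonneg _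
  have hSm : Measurable S := Finset.measurable_fun_sum _ fun i _ =>
    (h.measurable_gradient_iterateOfRun i).norm.pow_const 2
  set V : (Fin (N + 1) → Z) → ℝ := fun τ => ∑ i, ‖a.grad (τ i) (a.iterateOfRun τ i) -
    gradient J (a.iterateOfRun τ i)‖ ^ 2 with hV
  have hV0 : ∀ τ, 0 ≤ V τ := fun τ => Finset.sum_nonneg fun i _ => sq_nonneg _
  have hnoise : ∀ i : Fin (N + 1), Measurable fun τ => ‖a.grad (τ i) (a.iterateOfRun τ i) -
      gradient J (a.iterateOfRun τ i)‖ ^ 2 := fun i =>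
    ((h.measurable_grad.fun_comp ((measurable_pi_apply i).prodMk
      (h.measurable_iterateOfRun i))).sub (h.measurable_gradient_iterateOfRun i)).norm.pow_const 2
  have hVm : Measurable V := Finset.measurable_fun_sum _ fun i _ => hnoise i
  have hnoiseK : ∀ (τ : Fin (N + 1) → Z) i, ‖a.grad (τ i) (a.iterateOfRun τ i) -
      gradient J (a.iterateOfRun τ i)‖ ^ 2 ≤ (G + G) ^ 2 := fun τ i =>
    pow_le_pow_left₀ (norm_nonneg _) ((norm_sub_le _ _).trans
      (add_le_add (h.norm_grad_le _ _) (h.norm_gradient_le _))) 2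
  have hVK : ∀ τ, V τ ≤ ((N + 1 : ℕ) : ℝ) * (G + G) ^ 2 := fun τ =>
    (Finset.sum_le_sum fun i _ => hnoiseK τ i).trans (by simp)
  have hSK : ∀ τ, S τ ≤ ((N + 1 : ℕ) : ℝ) * G ^ 2 := fun τ =>
    (Finset.sum_le_sum fun i _ =>
      pow_le_pow_left₀ (norm_nonneg _) (h.norm_gradient_le _) 2).trans (by simp)
  have hVint : ∫ τ, V τ ∂P ≤ ((N + 1 : ℕ) : ℝ) * σ ^ 2 := by
    have hni : ∀ i ∈ Finset.univ, Integrable (fun τ => ‖a.grad (τ i) (a.iterateOfRun τ i) -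
        gradient J (a.iterateOfRun τ i)‖ ^ 2) P := fun i _ =>
      Integrable.of_bound (hnoise i).aestronglyMeasurable ((G + G) ^ 2)
        (ae_of_all _ fun τ => by rw [Real.norm_of_nonneg (sq_nonneg _)]; exact hnoiseK τ i)
    rw [hV, integral_finsetSum _ hni]
    exact (Finset.sum_le_sum fun i _ => h.integral_noise_le i).trans (by simp)
  set D : (Fin (N + 1) → Z) → ℝ := fun τ => (∑ i, a.stepSize (a.memoryOfRun τ i).sumSq *
    ‖gradient J (a.iterateOfRun τ i)‖ ^ 2) / a.k with hD
  have hDi : Integrable D P :=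
    (integrable_finsetSum _ fun i _ => (h.map_integrable_dissipation ht i).1).div_const _
  have hD0 : ∀ τ, 0 ≤ D τ := fun τ => div_nonneg (Finset.sum_nonneg fun i _ =>
    mul_nonneg (ht.stepSize_pos (sumSq_nonneg _ _)).le (sq_nonneg _)) hk.le
  have hDO : ∫ τ, D τ ∂P ≤ O := by
    rw [hD, integral_div, integral_finsetSum _ fun i _ => (h.map_integrable_dissipation ht i).1,
      div_le_iff₀ hk, mul_comm O]
    exact hdis
  set y : (Fin (N + 1) → Z) → ℝ := fun τ => (a.m + (a.memory N τ).sumSq) ^ (1 / 3 : ℝ) with hy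
  have hy0 : ∀ τ, 0 < y τ := fun τ => ht.cubeRoot_pos (sumSq_nonneg N τ)
  have hyi : Integrable y P := by
    refine Integrable.of_bound
      (((h.measurable_memory N).2.2.1.const_add a.m).pow_const _).aestronglyMeasurable
      ((a.m + (N + 1) * G ^ 2) ^ (1 / 3 : ℝ)) (ae_of_all _ fun τ => ?_)
    rw [Real.norm_of_nonneg (hy0 τ).le]
    have h1 := h.sumSq_le N τ
    exact Real.rpow_le_rpow (by linarith [sumSq_nonneg (a := a) N τ]) (by linarith) (by norm_num)
  have hXsq : ∀ τ, Real.sqrt (S τ) ^ 2 = S τ := fun τ => Real.sq_sqrt (hS0 τ)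
  -- `1 / η_T = y / k` and the step sizes decrease along the run
  have hXD : ∀ τ, Real.sqrt (S τ) ^ 2 ≤ D τ * y τ := by
    intro τ
    rw [hXsq]
    have h1 : a.k / y τ * S τ ≤ a.k * D τ := by
      have e : a.k * D τ = ∑ i, a.stepSize (a.memoryOfRun τ i).sumSq *
          ‖gradient J (a.iterateOfRun τ i)‖ ^ 2 := by
        rw [hD]; field_simp
      rw [e, hS, Finset.mul_sum]
      refine Finset.sum_le_sum fun i _ => mul_le_mul_of_nonneg_right ?_ (sq_nonneg _)
      exact ht.stepSize_anti (sumSq_nonneg _ _) (sumSq_castLE_le (Nat.le_of_lt_succ i.isLt) τ)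
    have hy' := hy0 τ
    rw [div_mul_eq_mul_div, div_le_iff₀ hy'] at h1
    exact le_of_mul_le_mul_left (by linarith) hk
  have hm6 : (a.m ^ (1 / 6 : ℝ)) ^ 2 = a.m ^ (1 / 3 : ℝ) := by
    rw [← Real.rpow_natCast, ← Real.rpow_mul hm.le]; norm_num
  have hyX : ∀ τ, y τ ≤ (a.m ^ (1 / 6 : ℝ)) ^ 2 + (2 * V τ) ^ (1 / 3 : ℝ) +
      (2 * Real.sqrt (S τ) ^ 2) ^ (1 / 3 : ℝ) := by
    intro τ
    rw [hm6, hXsq]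
    have h1 : (a.memory N τ).sumSq ≤ 2 * V τ + 2 * S τ := by
      rw [sumSq_eq_sum, hV, hS, Finset.mul_sum, Finset.mul_sum, ← Finset.sum_add_distrib]
      refine Finset.sum_le_sum fun i _ => ?_
      have := pow_le_pow_left₀ (norm_nonneg _) (norm_add_le (a.grad (τ i) (a.iterateOfRun τ i) -
        gradient J (a.iterateOfRun τ i)) (gradient J (a.iterateOfRun τ i))) 2
      rw [sub_add_cancel] at this
      exact (this.trans add_sq_le).trans (le_of_eq (by ring))
    have hVτ := hV0 τ
    have hSτ := hS0 τ
    calc y τ ≤ (a.m + 2 * V τ + 2 * S τ) ^ (1 / 3 : ℝ) :=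
          Real.rpow_le_rpow (by linarith [sumSq_nonneg (a := a) N τ]) (by linarith) (by norm_num)
      _ ≤ (a.m + 2 * V τ) ^ (1 / 3 : ℝ) + (2 * S τ) ^ (1 / 3 : ℝ) :=
          Real.rpow_add_le_add_rpow (by linarith) (by linarith) (by norm_num) (by norm_num)
      _ ≤ _ := by
          gcongr
          exact Real.rpow_add_le_add_rpow hm.le (by linarith) (by norm_num) (by norm_num)
  set v : ℝ := σ ^ (1 / 3 : ℝ) * ((N + 1 : ℕ) : ℝ) ^ (1 / 6 : ℝ) with hv
  have hv0 : 0 ≤ v := by positivity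
  have hVv : (∫ τ, V τ ∂P) ^ (1 / 3 : ℝ) ≤ v ^ 2 := by
    refine (Real.rpow_le_rpow (integral_nonneg hV0) hVint (by norm_num)).trans (le_of_eq ?_)
    rw [hv, mul_pow, Real.mul_rpow hT0.le (sq_nonneg _), ← Real.rpow_natCast,
      ← Real.rpow_natCast, ← Real.rpow_natCast, ← Real.rpow_mul hσ, ← Real.rpow_mul hσ,
      ← Real.rpow_mul hT0.le, mul_comm]
    norm_num
  have hkey := integral_le_of_sq_le_mul (K := max (Real.sqrt (((N + 1 : ℕ) : ℝ) * G ^ 2))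
    (((N + 1 : ℕ) : ℝ) * (G + G) ^ 2)) (hSm.sqrt) hVm hDi hyi hD0 (fun τ => (hy0 τ).le)
    (fun τ => Real.sqrt_nonneg _) hV0 (fun τ => (Real.sqrt_le_sqrt (hSK τ)).trans (le_max_left _ _))
    (fun τ => (hVK τ).trans (le_max_right _ _)) hXD hyX (Real.rpow_pos_of_pos hm _) hv0 hO hDO hVv
  -- pass from the `ℓ²` norm of the gradients to their average
  have hXi : Integrable (fun τ => Real.sqrt (S τ)) P :=
    Integrable.of_bound hSm.sqrt.aestronglyMeasurable (Real.sqrt (((N + 1 : ℕ) : ℝ) * G ^ 2))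
      (ae_of_all _ fun τ => by
        rw [Real.norm_of_nonneg (Real.sqrt_nonneg _)]; exact Real.sqrt_le_sqrt (hSK τ))
  have hni : ∀ i ∈ Finset.univ,
      Integrable (fun τ : Fin (N + 1) → Z => ‖gradient J (a.iterateOfRun τ i)‖) P := fun i _ =>
    Integrable.of_bound (h.measurable_gradient_iterateOfRun i).norm.aestronglyMeasurable G
      (ae_of_all _ fun τ => by rw [norm_norm]; exact h.norm_gradient_le _)
  have hsum : ∑ i : Fin (N + 1), ∫ τ, ‖gradient J (a.iterateOfRun τ i)‖ ∂P ≤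
      Real.sqrt ((N + 1 : ℕ) : ℝ) * ∫ τ, Real.sqrt (S τ) ∂P := by
    rw [← integral_finsetSum _ hni, ← integral_const_mul]
    refine integral_mono (integrable_finsetSum _ hni) (hXi.const_mul _) fun τ => ?_
    refine le_of_pow_le_pow_left₀ two_ne_zero (by positivity) ?_
    rw [mul_pow, hXsq, Real.sq_sqrt hT0.le]
    refine sq_sum_le_card_mul_sum_sq.trans (le_of_eq ?_)
    simp [hS]
  have hsq : 0 < Real.sqrt ((N + 1 : ℕ) : ℝ) := Real.sqrt_pos.2 hT0
  have hsq2 : Real.sqrt ((N + 1 : ℕ) : ℝ) ^ 2 = ((N + 1 : ℕ) : ℝ) := Real.sq_sqrt hT0.le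
  have hpow : ((N + 1 : ℕ) : ℝ) ^ (1 / 6 : ℝ) / Real.sqrt ((N + 1 : ℕ) : ℝ) =
      1 / ((N + 1 : ℕ) : ℝ) ^ (1 / 3 : ℝ) := by
    rw [div_eq_div_iff hsq.ne' (Real.rpow_pos_of_pos hT0 _).ne', Real.sqrt_eq_rpow,
      ← Real.rpow_add hT0, one_mul]
    norm_num
  calc 1 / ((N + 1 : ℕ) : ℝ) * ∑ i : Fin (N + 1), ∫ τ, ‖gradient J (a.iterateOfRun τ i)‖ ∂P
      ≤ 1 / ((N + 1 : ℕ) : ℝ) * (Real.sqrt ((N + 1 : ℕ) : ℝ) *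
          (Real.sqrt (2 * O) * a.m ^ (1 / 6 : ℝ) + 2 * O ^ (3 / 4 : ℝ) + 2 * Real.sqrt O * v)) :=
        mul_le_mul_of_nonneg_left (hsum.trans (mul_le_mul_of_nonneg_left hkey hsq.le))
          (by positivity)
    _ = (Real.sqrt (2 * O) * a.m ^ (1 / 6 : ℝ) + 2 * O ^ (3 / 4 : ℝ)) /
          Real.sqrt ((N + 1 : ℕ) : ℝ) + 2 * Real.sqrt O * σ ^ (1 / 3 : ℝ) *
          (((N + 1 : ℕ) : ℝ) ^ (1 / 6 : ℝ) / Real.sqrt ((N + 1 : ℕ) : ℝ)) := by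
        rw [hv]
        nth_rewrite 1 [← hsq2]
        field_simp
    _ = _ := by rw [hpow]; ring

omit ht in
/-- Averaging over the output law is averaging over a uniform index. -/
theorem IsOracle.integral_outputLaw {T : ℕ} (hT : 1 ≤ T) :
    Integrable (fun x : (Fin T → Z) × Fin T => ‖gradient J (a.iterateOfRun x.1 x.2)‖)
      (a.outputLaw T) ∧
    ∫ x, ‖gradient J (a.iterateOfRun x.1 x.2)‖ ∂(a.outputLaw T) =
      1 / (T : ℝ) * ∑ i : Fin T, ∫ τ, ‖gradient J (a.iterateOfRun τ i)‖ ∂(a.runLaw T) := by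
  have : NeZero T := ⟨by omega⟩
  have := h.isProbabilityMeasure_runLaw T
  have hU : IsProbabilityMeasure (uniformOn (Set.univ : Set (Fin T))) :=
    isProbabilityMeasure_uniformOn Set.finite_univ Set.univ_nonempty
  have hm : Measurable fun x : (Fin T → Z) × Fin T => ‖gradient J (a.iterateOfRun x.1 x.2)‖ :=
    measurable_from_prod_countable_left fun i => (h.measurable_gradient_iterateOfRun i).norm
  have hint : Integrable (fun x : (Fin T → Z) × Fin T => ‖gradient J (a.iterateOfRun x.1 x.2)‖)
      ((a.runLaw T).prod (uniformOn Set.univ)) :=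
    Integrable.of_bound hm.aestronglyMeasurable G
      (ae_of_all _ fun x => by rw [norm_norm]; exact h.norm_gradient_le _)
  refine ⟨hint, ?_⟩
  rw [outputLaw, integral_prod_symm _ hint, integral_fintype (Integrable.of_finite)]
  rw [Finset.mul_sum]
  refine Finset.sum_congr rfl fun i _ => ?_
  rw [smul_eq_mul, measureReal_def, uniformOn_univ, Measure.count_singleton]
  simp

end Input

end ISMBPG

/-! ### The constants of the problem -/

namespace Constants

variable {p : Constants}

/-- The sign conditions on the constants. -/
structure Valid (p : Constants) : Prop where
  R_pos : 0 < p.R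
  γ_mem : 0 < p.γ ∧ p.γ < 1
  Mg_pos : 0 < p.Mg
  Mh_pos : 0 < p.Mh
  σ_pos : 0 < p.σ
  W_pos : 0 < p.W
  k_pos : 0 < p.k

namespace Valid

variable (hp : p.Valid)
include hp

theorem one_sub_γ_pos : 0 < 1 - p.γ := sub_pos.2 hp.γ_mem.2

theorem G_pos : 0 < p.G :=
  div_pos (mul_pos hp.Mg_pos hp.R_pos) (pow_pos hp.one_sub_γ_pos 2)

omit hp in
theorem hessian_le_L : p.Mh * p.R / (1 - p.γ) ^ 2 ≤ p.L := le_max_left _ _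

theorem L_pos : 0 < p.L :=
  (div_pos (mul_pos hp.Mh_pos hp.R_pos) (pow_pos hp.one_sub_γ_pos 2)).trans_le hessian_le_L

theorem score_sq_le_L : p.Mg * p.R / (1 - p.γ) ^ 2 * (p.H * p.Mg) ≤ p.L := by
  have h1 := hp.one_sub_γ_pos
  refine le_max_of_le_right (Real.le_sqrt_of_sq_le ?_)
  have e : (p.Mg * p.R / (1 - p.γ) ^ 2 * (p.H * p.Mg)) ^ 2 =
      ((p.H : ℝ) ^ 2 * p.Mg ^ 4 * p.R ^ 2) / (1 - p.γ) ^ 4 := by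
    field_simp
  rw [e]
  gcongr
  exact le_add_of_nonneg_right (by positivity)

/-- `J` is `2L`-smooth; with step sizes at most `1 / (2L)` this is all that the descent needs. -/
theorem smoothness_le :
    p.Mg * p.R / (1 - p.γ) ^ 2 * (p.H * p.Mg) + p.Mh * p.R / (1 - p.γ) ^ 2 ≤ 2 * p.L := by
  linarith [hp.score_sq_le_L, hessian_le_L (p := p)]

theorem Bsq_pos : 0 < p.Bsq := by
  have := hp.L_pos
  unfold Bsq
  positivity

theorem correction_le_Bsq :
    (p.Mh * p.R / (1 - p.γ) ^ 2) ^ 2 +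
      (p.Mg * p.R / (1 - p.γ) ^ 2) ^ 2 * ((p.H * p.Mg) ^ 2 * (p.W + 1)) ≤ p.Bsq := by
  have h1 := hp.one_sub_γ_pos
  have h2 := hp.R_pos
  have h3 := hp.Mg_pos
  have h4 := hp.Mh_pos
  have h5 := hp.W_pos
  have hC : p.Cw ^ 2 = (p.H : ℝ) * (2 * (p.H : ℝ) * p.Mg ^ 2 + p.Mh) * (p.W + 1) :=
    Real.sq_sqrt (by positivity)
  have i1 : (p.Mh * p.R / (1 - p.γ) ^ 2) ^ 2 ≤ p.L ^ 2 :=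
    pow_le_pow_left₀ (by positivity) hessian_le_L 2
  have i2 : (p.H * p.Mg) ^ 2 * (p.W + 1) ≤ 2 * p.Cw ^ 2 := by
    rw [hC, ← mul_assoc]
    refine mul_le_mul_of_nonneg_right ?_ (by linarith)
    have : 0 ≤ (p.H : ℝ) * p.Mh := by positivity
    nlinarith [sq_nonneg (p.H * p.Mg)]
  have i3 := mul_le_mul_of_nonneg_left i2 (sq_nonneg p.G)
  have e : p.Mg * p.R / (1 - p.γ) ^ 2 = p.G := rfl
  rw [e]
  unfold Bsq
  linarith

theorem m_pos : 0 < p.m := by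
  have := hp.G_pos
  exact lt_of_lt_of_le (by positivity) (le_max_left (2 * p.G ^ 2) _)

theorem Omega_pos {gap : ℝ} (hgap : 0 ≤ gap) {T : ℕ} : 0 < p.Omega gap T := by
  have := hp.k_pos
  have := hp.Bsq_pos
  have := hp.m_pos
  have := hp.σ_pos
  have : 0 ≤ Real.log ((T : ℝ) + 2) :=
    Real.log_nonneg (by linarith [(Nat.cast_nonneg T : (0 : ℝ) ≤ T)])
  unfold Omega
  positivity

end Valid

/-- The constant in `Ω = O(ln T)`; `|J| ≤ H R` bounds the optimality gap by `2 H R`. -/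
def omegaRate (p : Constants) : ℝ :=
  1 / p.k * (2 * (32 * (p.H * p.R) + p.m ^ (1 / 3 : ℝ) / (8 * p.Bsq * p.k) * p.σ ^ 2) +
    2 * (p.c ^ 2 * p.k ^ 3 / (4 * p.Bsq)))

theorem Valid.omegaRate_pos (hp : p.Valid) : 0 < p.omegaRate := by
  have := hp.k_pos
  have := hp.Bsq_pos
  have := hp.m_pos
  have := hp.σ_pos
  have := hp.R_pos
  unfold omegaRate
  positivity

theorem Valid.Omega_le (hp : p.Valid) {gap : ℝ} (hgap : gap ≤ 2 * (p.H * p.R)) {T : ℕ}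
    (hT : 2 ≤ T) : p.Omega gap T ≤ p.omegaRate * Real.log T := by
  have := hp.k_pos
  have := hp.Bsq_pos
  have := hp.m_pos
  have := hp.σ_pos
  have := hp.R_pos
  have hT2 : (2 : ℝ) ≤ T := by exact_mod_cast hT
  have h1 : 1 ≤ 2 * Real.log T := by
    have := Real.log_le_log two_pos hT2
    linarith [Real.log_two_gt_d9]
  have h2 : Real.log ((T : ℝ) + 2) ≤ 2 * Real.log T := by
    have e : 2 * Real.log (T : ℝ) = Real.log ((T : ℝ) ^ 2) := by rw [Real.log_pow]; norm_num
    rw [e]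
    exact Real.log_le_log (by positivity) (by nlinarith)
  have i1 := mul_le_mul_of_nonneg_left h1 (by positivity : (0 : ℝ) ≤ 32 * (p.H * p.R) +
    p.m ^ (1 / 3 : ℝ) / (8 * p.Bsq * p.k) * p.σ ^ 2)
  have i2 := mul_le_mul_of_nonneg_left h2
    (by positivity : 0 ≤ p.c ^ 2 * p.k ^ 3 / (4 * p.Bsq))
  unfold Omega omegaRate
  rw [mul_assoc (1 / p.k)]
  refine mul_le_mul_of_nonneg_left ?_ (by positivity)
  linarith

end Constants

/-! ### Sample complexity -/

/-- The term `(ln T)^{3/4} / √T` is of lower order than `√(ln T) / T^{1/3}`, because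
`(ln T)^{1/4} ≤ 2 T^{1/6}`. -/
theorem rate_le_sqrt_log_div {O A M s : ℝ} (hO : 0 ≤ O) (hA : 0 ≤ A) (hM : 0 ≤ M) (hs : 0 ≤ s)
    {T : ℝ} (hT : 1 ≤ T) (hOA : O ≤ A * Real.log T) :
    (Real.sqrt (2 * O) * M + 2 * O ^ (3 / 4 : ℝ)) / Real.sqrt T +
        2 * Real.sqrt O * s / T ^ (1 / 3 : ℝ) ≤
      (Real.sqrt (2 * A) * M + 4 * A ^ (3 / 4 : ℝ) + 2 * Real.sqrt A * s) *
        (Real.sqrt (Real.log T) / T ^ (1 / 3 : ℝ)) := by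
  have hT0 : 0 < T := by linarith
  have hl : 0 ≤ Real.log T := Real.log_nonneg hT
  have hT3 : 0 < T ^ (1 / 3 : ℝ) := Real.rpow_pos_of_pos hT0 _
  have hT3' : T ^ (1 / 3 : ℝ) ≤ Real.sqrt T := by
    rw [Real.sqrt_eq_rpow]
    exact Real.rpow_le_rpow_of_exponent_le hT (by norm_num)
  have h1 : Real.sqrt (2 * O) ≤ Real.sqrt (2 * A) * Real.sqrt (Real.log T) := by
    rw [← Real.sqrt_mul (by positivity)]
    exact Real.sqrt_le_sqrt (by linarith)
  have h2 : Real.sqrt O ≤ Real.sqrt A * Real.sqrt (Real.log T) := by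
    rw [← Real.sqrt_mul hA]
    exact Real.sqrt_le_sqrt hOA
  have h3 : O ^ (3 / 4 : ℝ) ≤ A ^ (3 / 4 : ℝ) * Real.log T ^ (3 / 4 : ℝ) := by
    rw [← Real.mul_rpow hA hl]
    exact Real.rpow_le_rpow hO hOA (by norm_num)
  have h4 : Real.log T ^ (3 / 4 : ℝ) ≤ 2 * Real.sqrt (Real.log T) * T ^ (1 / 6 : ℝ) := by
    have e1 : Real.log T ^ (3 / 4 : ℝ) = Real.sqrt (Real.log T) * Real.log T ^ (1 / 4 : ℝ) := by
      rw [Real.sqrt_eq_rpow, ← Real.rpow_add_of_nonneg hl (by norm_num) (by norm_num)]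
      norm_num
    have e2 : Real.log T ≤ 16 * T ^ (2 / 3 : ℝ) := by
      have := Real.log_le_rpow_div hT0.le (by norm_num : (0 : ℝ) < 2 / 3)
      have h0 := Real.rpow_pos_of_pos hT0 (2 / 3)
      rw [div_eq_mul_inv] at this
      norm_num at this
      linarith
    have e3 : Real.log T ^ (1 / 4 : ℝ) ≤ 2 * T ^ (1 / 6 : ℝ) := by
      refine (Real.rpow_le_rpow hl e2 (by norm_num)).trans (le_of_eq ?_)
      rw [Real.mul_rpow (by norm_num) (Real.rpow_nonneg hT0.le _), ← Real.rpow_mul hT0.le]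
      have : (16 : ℝ) ^ (1 / 4 : ℝ) = 2 := by
        rw [show (16 : ℝ) = 2 ^ (4 : ℝ) by norm_num, ← Real.rpow_mul two_pos.le]
        norm_num
      rw [this]
      norm_num
    rw [e1]
    have := mul_le_mul_of_nonneg_left e3 (Real.sqrt_nonneg (Real.log T))
    linarith
  have h5 : T ^ (1 / 6 : ℝ) / Real.sqrt T = 1 / T ^ (1 / 3 : ℝ) := by
    rw [div_eq_div_iff (Real.sqrt_pos.2 hT0).ne' hT3.ne', Real.sqrt_eq_rpow,
      ← Real.rpow_add hT0, one_mul]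
    norm_num
  rw [add_div]
  have j1 : Real.sqrt (2 * O) * M / Real.sqrt T ≤
      Real.sqrt (2 * A) * M * (Real.sqrt (Real.log T) / T ^ (1 / 3 : ℝ)) := by
    calc Real.sqrt (2 * O) * M / Real.sqrt T ≤
        (Real.sqrt (2 * A) * Real.sqrt (Real.log T)) * M / T ^ (1 / 3 : ℝ) := by gcongr
      _ = _ := by ring
  have j2 : 2 * O ^ (3 / 4 : ℝ) / Real.sqrt T ≤
      4 * A ^ (3 / 4 : ℝ) * (Real.sqrt (Real.log T) / T ^ (1 / 3 : ℝ)) := by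
    calc 2 * O ^ (3 / 4 : ℝ) / Real.sqrt T ≤ 2 * (A ^ (3 / 4 : ℝ) *
          (2 * Real.sqrt (Real.log T) * T ^ (1 / 6 : ℝ))) / Real.sqrt T := by
          gcongr
          exact h3.trans (mul_le_mul_of_nonneg_left h4 (Real.rpow_nonneg hA _))
      _ = 4 * A ^ (3 / 4 : ℝ) * Real.sqrt (Real.log T) *
          (T ^ (1 / 6 : ℝ) / Real.sqrt T) := by ring
      _ = _ := by rw [h5]; ring
  have j3 : 2 * Real.sqrt O * s / T ^ (1 / 3 : ℝ) ≤
      2 * Real.sqrt A * s * (Real.sqrt (Real.log T) / T ^ (1 / 3 : ℝ)) := by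
    calc 2 * Real.sqrt O * s / T ^ (1 / 3 : ℝ) ≤
        2 * (Real.sqrt A * Real.sqrt (Real.log T)) * s / T ^ (1 / 3 : ℝ) := by gcongr
      _ = _ := by ring
  linarith

/-- Inversion of the rate `K √(ln T) / T^{1/3}`. With `T = δ³ s Y` and `Y = ε⁻³ (ln 1/ε)^{3/2}`,
both `ln T ≤ 14 δ s^{2/3} ln (1/ε)` and `ε² T^{2/3} = δ² s^{2/3} ln (1/ε)`. -/
theorem sqrt_log_div_le_of_le {K ε T : ℝ} (hε : 0 < ε) (hε2 : ε ≤ 1 / 2)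
    (hT : (14 * K ^ 2 + 2) ^ 3 * ((1 / ε) ^ 3 * Real.log (1 / ε) ^ (3 / 2 : ℝ)) ≤ T) :
    K * (Real.sqrt (Real.log T) / T ^ (1 / 3 : ℝ)) ≤ ε := by
  set δ := 14 * K ^ 2 + 2 with hδ
  set l := Real.log (1 / ε) with hl
  have hδ0 : 0 < δ := by positivity
  have hδ1 : 1 ≤ δ := by nlinarith [sq_nonneg K]
  have hε' : 2 ≤ 1 / ε := by rw [le_div_iff₀ hε]; linarith
  have hlh : 1 / 2 ≤ l := by
    have := Real.log_le_log two_pos hε'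
    linarith [Real.log_two_gt_d9]
  have hl0 : 0 < l := by linarith
  set Y := (1 / ε) ^ 3 * l ^ (3 / 2 : ℝ) with hY
  have hY0 : 0 < Y := by positivity
  have hT0 : 0 < T := lt_of_lt_of_le (by positivity) hT
  set s := T / (δ ^ 3 * Y) with hs
  have hs1 : 1 ≤ s := by rw [hs, le_div_iff₀ (by positivity), one_mul]; exact hT
  have hs0 : 0 < s := by linarith
  have hTs : T = δ ^ 3 * s * Y := by rw [hs]; field_simp
  set q := s ^ (2 / 3 : ℝ) with hq
  have hq1 : 1 ≤ q := Real.one_le_rpow hs1 (by norm_num)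
  have hlogY : Real.log Y ≤ 9 / 2 * l := by
    rw [hY, Real.log_mul (by positivity) (by positivity), Real.log_pow, Real.log_rpow hl0, ← hl]
    have := Real.log_le_sub_one_of_pos hl0
    push_cast
    linarith
  have hlogs : Real.log s ≤ 3 / 2 * q := by
    have := Real.log_le_rpow_div hs0.le (by norm_num : (0 : ℝ) < 2 / 3)
    rw [← hq] at this
    linarith
  have hlogδ : Real.log δ ≤ δ := (Real.log_le_sub_one_of_pos hδ0).trans (by linarith)
  have hlogT : Real.log T ≤ 14 * δ * (q * l) := by
    rw [hTs, Real.log_mul (by positivity) (by positivity), Real.log_mul (by positivity)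
      (by positivity), Real.log_pow]
    push_cast
    have hql : 1 ≤ 2 * (q * l) := by nlinarith
    have i1 : 3 * δ ≤ 6 * δ * (q * l) := by nlinarith
    have i2 : 3 / 2 * q ≤ 3 * δ * (q * l) := by
      have : q * 1 ≤ q * (2 * (δ * l)) := by
        refine mul_le_mul_of_nonneg_left ?_ (by linarith)
        nlinarith
      linarith
    have i3 : 9 / 2 * l ≤ 9 / 2 * δ * (q * l) := by
      have : 1 * l ≤ δ * q * l := mul_le_mul_of_nonneg_right (by nlinarith) hl0.le
      linarith
    have i4 : 0 ≤ δ * (q * l) := by positivity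
    linarith
  have hT23 : (ε * T ^ (1 / 3 : ℝ)) ^ 2 = δ ^ 2 * (q * l) := by
    have e1 : (T ^ (1 / 3 : ℝ)) ^ 2 = T ^ (2 / 3 : ℝ) := by
      rw [← Real.rpow_natCast, ← Real.rpow_mul hT0.le]; norm_num
    have e2 : (δ ^ 3 : ℝ) ^ (2 / 3 : ℝ) = δ ^ 2 := by
      rw [← Real.rpow_natCast, ← Real.rpow_mul hδ0.le, ← Real.rpow_natCast]; norm_num
    have e3 : ((1 / ε) ^ 3 : ℝ) ^ (2 / 3 : ℝ) = (1 / ε) ^ 2 := by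
      rw [← Real.rpow_natCast, ← Real.rpow_mul (by positivity), ← Real.rpow_natCast]; norm_num
    have e4 : (l ^ (3 / 2 : ℝ)) ^ (2 / 3 : ℝ) = l := by
      rw [← Real.rpow_mul hl0.le]; norm_num
    rw [mul_pow, e1, hTs, hY, Real.mul_rpow (by positivity) (by positivity),
      Real.mul_rpow (by positivity) hs0.le, Real.mul_rpow (by positivity) (by positivity),
      e2, e3, e4, ← hq]
    field_simp
  rw [← mul_div_assoc, div_le_iff₀ (Real.rpow_pos_of_pos hT0 _)]
  refine le_of_pow_le_pow_left₀ two_ne_zero (by positivity) ?_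
  have hlT0 : 0 ≤ Real.log T := by
    refine Real.log_nonneg ?_
    have hY1 : 1 ≤ Y := by
      have h1 : (1 / 2 : ℝ) ^ 2 ≤ l ^ (3 / 2 : ℝ) := by
        refine le_trans ?_ (Real.rpow_le_rpow (by norm_num) hlh (by norm_num))
        rw [← Real.rpow_natCast]
        exact Real.rpow_le_rpow_of_exponent_ge (by norm_num) (by norm_num) (by norm_num)
      have h2 : (2 : ℝ) ^ 3 ≤ (1 / ε) ^ 3 := pow_le_pow_left₀ two_pos.le hε' 3
      have := mul_le_mul h2 h1 (by positivity) (by positivity)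
      rw [← hY] at this
      linarith
    exact (one_le_mul_of_one_le_of_one_le (one_le_pow₀ hδ1) hY1).trans hT
  rw [mul_pow, Real.sq_sqrt hlT0, hT23]
  have h1 := mul_le_mul_of_nonneg_left hlogT (sq_nonneg K)
  have h2 : 0 ≤ δ * (q * l) := by positivity
  have h3 : 14 * K ^ 2 * (δ * (q * l)) ≤ δ * (δ * (q * l)) :=
    mul_le_mul_of_nonneg_right (by rw [hδ]; linarith) h2
  linarith

theorem two_le_inv_pow_mul_log {ε : ℝ} (hε : 0 < ε) (hε2 : ε ≤ 1 / 2) :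
    2 ≤ (1 / ε) ^ 3 * Real.log (1 / ε) ^ (3 / 2 : ℝ) := by
  have hε' : 2 ≤ 1 / ε := by rw [le_div_iff₀ hε]; linarith
  have hlh : 1 / 2 ≤ Real.log (1 / ε) := by
    have := Real.log_le_log two_pos hε'
    linarith [Real.log_two_gt_d9]
  have h1 : (1 / 2 : ℝ) ^ 2 ≤ Real.log (1 / ε) ^ (3 / 2 : ℝ) := by
    refine le_trans ?_ (Real.rpow_le_rpow (by norm_num) hlh (by norm_num))
    rw [← Real.rpow_natCast]
    exact Real.rpow_le_rpow_of_exponent_ge (by norm_num) (by norm_num) (by norm_num)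
  have h2 : (2 : ℝ) ^ 3 ≤ (1 / ε) ^ 3 := pow_le_pow_left₀ two_pos.le hε' 3
  have := mul_le_mul h2 h1 (by positivity) (by positivity)
  linarith

/-! ### IS-MBPG -/

section Main

variable {d : ℕ} {S A : Type*} [MeasurableSpace S] [MeasurableSpace A] {p : Constants}
  {M : MDP S A} {π : Policy d S A} {b : Fin p.H → ℝ}

theorem isTuned_isMBPG (hp : p.Valid) (θ₁ : Param d) :
    (isMBPG p M π b θ₁).IsTuned p.G p.L p.Bsq where
  G_pos := hp.G_pos
  L_pos := hp.L_pos
  Bsq_pos := hp.Bsq_pos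
  k_pos := hp.k_pos
  c_eq := rfl
  two_mul_sq_le := le_max_left _ _
  cube_le := (le_max_left _ _).trans (le_max_right _ _)
  cube_le' := (le_max_right _ _).trans (le_max_right _ _)

theorem isOracle_isMBPG (hp : p.Valid) (θ₁ : Param d)
    (hb : ∀ (j : Fin p.H) s a, |p.γ ^ (j : ℕ) * M.reward s a - b j| ≤ p.γ ^ (j : ℕ) * p.R)
    (hB : π.BoundedScore p.Mg p.Mh)
    (hvar : ∀ θ, ∫ τ, ‖M.pgt π p.γ b τ θ - gradient (M.J π p.γ p.H) θ‖ ^ 2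
      ∂(M.trajLaw π θ p.H) ≤ p.σ ^ 2)
    (hV : ∀ θ' θ, evariance (fun τ => π.weight τ θ' θ) (M.trajLaw π θ p.H) ≤
      ENNReal.ofReal p.W) :
    (isMBPG p M π b θ₁).IsOracle (M.J π p.γ p.H) p.G p.L p.Bsq p.σ where
  prob θ := M.isProbabilityMeasure_trajLaw π θ p.H
  measurable_law := MDP.measurable_trajLaw hB p.H
  measurable_grad := MDP.measurable_pgt hB b
  measurable_weight := hB.measurable_weight p.H
  norm_grad_le := MDP.norm_pgt_le hB hp.γ_mem hp.R_pos.le hp.Mg_pos.le hb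
  differentiable θ := (MDP.hasGradientAt_J hB hb θ).differentiableAt
  norm_gradient_sub_le θ' θ :=
    (MDP.norm_gradient_J_sub_le hB hp.γ_mem hp.R_pos.le hp.Mg_pos.le hp.Mh_pos.le hb θ' θ).trans
      (mul_le_mul_of_nonneg_right hp.smoothness_le (norm_nonneg _))
  integral_grad θ := (MDP.gradient_J hB hb θ).symm
  memLp_weight θ' θ := MDP.memLp_weight (hV θ' θ)
  integral_weight_smul_grad θ' θ :=
    (M.integral_trajLaw_eq π θ' θ p.H _).symm.trans (MDP.gradient_J hB hb θ').symm
  integral_correction_sq_le θ' θ :=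
    (MDP.integral_norm_pgt_sub_weight_smul_sq_le hB hp.γ_mem hp.R_pos.le hp.Mg_pos.le
      hp.Mh_pos.le hp.W_pos.le hb (hV θ' θ)).trans (mul_le_mul_of_nonneg_right
        (mul_le_mul_of_nonneg_left hp.correction_le_Bsq two_pos.le) (sq_nonneg _))
  variance_le := hvar

end Main

end

theorem theorem1 (p : Constants)
    (hR : 0 < p.R) (hγ : 0 < p.γ ∧ p.γ < 1)
    (hMg : 0 < p.Mg) (hMh : 0 < p.Mh) (hσ : 0 < p.σ) (hW : 0 < p.W) (hk : 0 < p.k) :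
    -- the constant `C` depends on `p` only
    ∃ C : ℝ, 0 < C ∧
      ∀ (d : ℕ) (S A : Type*) [MeasurableSpace S] [MeasurableSpace A]
        (M : MDP S A) (π : Policy d S A) (b : Fin p.H → ℝ) (θ₁ : Param d),
      -- rewards in `[-R, R]`; baselines admissible for this bound (for instance `b = 0`)
      (∀ s a, |M.reward s a| ≤ p.R) →
      (∀ (j : Fin p.H) s a,
        |p.γ ^ (j : ℕ) * M.reward s a - b j| ≤ p.γ ^ (j : ℕ) * p.R) →
      -- bounded gradient and Hessian of `log π_θ`
      π.BoundedScore p.Mg p.Mh →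
      -- bounded variance of the stochastic gradient
      (∀ θ, ∫ τ, ‖M.pgt π p.γ b τ θ - gradient (M.J π p.γ p.H) θ‖ ^ 2 ∂(M.trajLaw π θ p.H)
        ≤ p.σ ^ 2) →
      -- bounded variance of the importance weights
      (∀ θ' θ, evariance (fun τ => π.weight τ θ' θ) (M.trajLaw π θ p.H)
        ≤ ENNReal.ofReal p.W) →
      Differentiable ℝ (M.J π p.γ p.H) ∧
      BddAbove (Set.range (M.J π p.γ p.H)) ∧
      -- the convergence bound
      (∀ T : ℕ, 1 ≤ T →
        Integrable (fun x => ‖gradient (M.J π p.γ p.H)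
            ((isMBPG p M π b θ₁).iterateOfRun x.1 x.2)‖) ((isMBPG p M π b θ₁).outputLaw T) ∧
        ∫ x, ‖gradient (M.J π p.γ p.H) ((isMBPG p M π b θ₁).iterateOfRun x.1 x.2)‖
            ∂((isMBPG p M π b θ₁).outputLaw T)
          = 1 / (T : ℝ) * ∑ i : Fin T,
            ∫ τ, ‖gradient (M.J π p.γ p.H) ((isMBPG p M π b θ₁).iterateOfRun τ i)‖
              ∂((isMBPG p M π b θ₁).runLaw T) ∧
        ∫ x, ‖gradient (M.J π p.γ p.H) ((isMBPG p M π b θ₁).iterateOfRun x.1 x.2)‖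
            ∂((isMBPG p M π b θ₁).outputLaw T)
          ≤ (Real.sqrt (2 * p.Omega ((⨆ θ, M.J π p.γ p.H θ) - M.J π p.γ p.H θ₁) T)
                * p.m ^ (1 / 6 : ℝ)
              + 2 * p.Omega ((⨆ θ, M.J π p.γ p.H θ) - M.J π p.γ p.H θ₁) T ^ (3 / 4 : ℝ))
              / Real.sqrt T
            + 2 * Real.sqrt (p.Omega ((⨆ θ, M.J π p.γ p.H θ) - M.J π p.γ p.H θ₁) T)
              * p.σ ^ (1 / 3 : ℝ) / (T : ℝ) ^ (1 / 3 : ℝ)) ∧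
      -- `Ω = O(ln T)`
      (∀ T : ℕ, 2 ≤ T →
        p.Omega ((⨆ θ, M.J π p.γ p.H θ) - M.J π p.γ p.H θ₁) T ≤ C * Real.log T) ∧
      -- sample complexity: `N` iterations, hence `N` trajectories, reach accuracy `ε`
      (∀ ε : ℝ, 0 < ε → ε ≤ 1 / 2 →
        ∃ N : ℕ, 1 ≤ N ∧ (N : ℝ) ≤ C * (1 / ε) ^ 3 * Real.log (1 / ε) ^ (3 / 2 : ℝ) ∧
          ∀ T : ℕ, N ≤ T →
            ∫ x, ‖gradient (M.J π p.γ p.H) ((isMBPG p M π b θ₁).iterateOfRun x.1 x.2)‖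
              ∂((isMBPG p M π b θ₁).outputLaw T) ≤ ε) := by
  have hp : p.Valid := ⟨hR, hγ, hMg, hMh, hσ, hW, hk⟩
  set A := p.omegaRate with hA
  have hA0 : 0 < A := hp.omegaRate_pos
  -- the averaged gradient norm is at most `K √(ln T) / T^{1/3}`
  set K := Real.sqrt (2 * A) * p.m ^ (1 / 6 : ℝ) + 4 * A ^ (3 / 4 : ℝ) +
    2 * Real.sqrt A * p.σ ^ (1 / 3 : ℝ) with hKdef
  have hm := hp.m_pos
  -- from `D ε⁻³ (ln 1/ε)^{3/2}` iterations on, this is at most `ε`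
  set D := (14 * K ^ 2 + 2) ^ 3 with hD
  have hD1 : 1 ≤ D := one_le_pow₀ (by nlinarith [sq_nonneg K])
  refine ⟨A + D + 1, by positivity, ?_⟩
  intro d S A' _ _ M π b θ₁ hr hb hB hvar hV
  have h := isOracle_isMBPG hp θ₁ hb hB hvar hV
  have ht := isTuned_isMBPG (M := M) (π := π) (b := b) hp θ₁
  have hJabs : ∀ θ, |M.J π p.γ p.H θ| ≤ p.H * p.R := MDP.abs_J_le hγ hr
  have hbdd : BddAbove (Set.range (M.J π p.γ p.H)) :=
    ⟨p.H * p.R, by rintro _ ⟨θ, rfl⟩; exact (le_abs_self _).trans (hJabs θ)⟩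
  have hJsup : ∀ θ, M.J π p.γ p.H θ ≤ ⨆ θ, M.J π p.γ p.H θ := fun θ => le_ciSup hbdd θ
  have hgap0 : 0 ≤ (⨆ θ, M.J π p.γ p.H θ) - M.J π p.γ p.H θ₁ := sub_nonneg.2 (hJsup θ₁)
  have hgap : (⨆ θ, M.J π p.γ p.H θ) - M.J π p.γ p.H θ₁ ≤ 2 * (p.H * p.R) := by
    have h1 : ⨆ θ, M.J π p.γ p.H θ ≤ p.H * p.R :=
      ciSup_le fun θ => (le_abs_self _).trans (hJabs θ)
    linarith [(abs_le.1 (hJabs θ₁)).1]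
  set gap := (⨆ θ, M.J π p.γ p.H θ) - M.J π p.γ p.H θ₁ with hgapdef
  have hbound : ∀ T : ℕ, 1 ≤ T →
      ∫ x, ‖gradient (M.J π p.γ p.H) ((isMBPG p M π b θ₁).iterateOfRun x.1 x.2)‖
        ∂((isMBPG p M π b θ₁).outputLaw T) ≤
      (Real.sqrt (2 * p.Omega gap T) * p.m ^ (1 / 6 : ℝ) + 2 * p.Omega gap T ^ (3 / 4 : ℝ)) /
        Real.sqrt T + 2 * Real.sqrt (p.Omega gap T) * p.σ ^ (1 / 3 : ℝ) /
          (T : ℝ) ^ (1 / 3 : ℝ) := by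
    intro T hT
    rw [(h.integral_outputLaw hT).2]
    refine h.average_le ht hJsup hσ.le hT (hp.Omega_pos hgap0) (le_of_eq ?_)
    unfold Constants.Omega
    rw [← mul_assoc, show (isMBPG p M π b θ₁).k = p.k from rfl, mul_one_div_cancel hk.ne', one_mul]
    rfl
  refine ⟨h.differentiable, hbdd, fun T hT =>
    ⟨(h.integral_outputLaw hT).1, (h.integral_outputLaw hT).2, hbound T hT⟩, ?_, ?_⟩
  · intro T hT
    have hlog : 0 ≤ Real.log (T : ℝ) := Real.log_natCast_nonneg T
    refine (hp.Omega_le hgap hT).trans (mul_le_mul_of_nonneg_right ?_ hlog)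
    linarith
  · intro ε hε hε2
    have hY := two_le_inv_pow_mul_log hε hε2
    set Y := (1 / ε) ^ 3 * Real.log (1 / ε) ^ (3 / 2 : ℝ) with hYdef
    have hDY : 2 ≤ D * Y := by nlinarith
    have hceil : D * Y ≤ ⌈D * Y⌉₊ := Nat.le_ceil _
    have hN2 : 2 ≤ ⌈D * Y⌉₊ := by exact_mod_cast hDY.trans hceil
    refine ⟨⌈D * Y⌉₊, by omega, ?_, ?_⟩
    · have h1 := (Nat.ceil_lt_add_one (by linarith : 0 ≤ D * Y)).le
      rw [mul_assoc, ← hYdef]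
      have h2 : 0 ≤ A * Y := by positivity
      linarith
    · intro T hT
      have hT2 : 2 ≤ T := hN2.trans hT
      have hTR : (1 : ℝ) ≤ T := by exact_mod_cast (by omega : 1 ≤ T)
      have hDT : D * Y ≤ T := hceil.trans (by exact_mod_cast hT)
      exact (hbound T (by omega)).trans ((rate_le_sqrt_log_div (hp.Omega_pos hgap0).le hA0.le
        (by positivity) (by positivity) hTR (hp.Omega_le hgap hT2)).trans
        (sqrt_log_div_le_of_le hε hε2 hDT))
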